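/- Let $G$ be a finite simple undirected graph, with chromatic number $\chi(G)$ and maximum clique size $\omega(G)$. The Chair (also called the fork) is the graph on five vertices obtained from the claw $K_{1,3}$ by subdividing one edge once, and HVN is the graph on five vertices that consists of a $K_4$ and a fifth vertex adjacent to exactly two vertices of that $K_4$. If $G$ contains neither the Chair nor HVN as an induced subgraph, then $$\chi(G) \le \frac{3\,\omega(G)}{2}.$$ -/

import Mathlib

/-- The chair (also called the fork): the claw with centre `0` and leaves `1`, `2`, `3`, one edge of
which is subdivided. It has the edges `01`, `02`, `03` and `34`. -/
def chairGraph : SimpleGraph (Fin 5) :=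
  SimpleGraph.fromEdgeSet {s(0, 1), s(0, 2), s(0, 3), s(3, 4)}

/-- The graph HVN: the complete graph on `0`, `1`, `2`, `3` together with the vertex `4`, which is
adjacent to exactly two vertices, `0` and `1`, of that complete graph. -/
def hvnGraph : SimpleGraph (Fin 5) :=
  SimpleGraph.fromEdgeSet
    {s(0, 1), s(0, 2), s(0, 3), s(1, 2), s(1, 3), s(2, 3), s(4, 0), s(4, 1)}

/-! A minimal counterexample is vertex-critical for `k = ⌊3m/2⌋` colours, where `m` is its clique
number. It is connected, has minimum degree at least `k`, and no neighbourhood is contained in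
another. In a colouring of `G - v`, the vertex `v` sees every colour, and a neighbour that alone has
its colour sees all other colours. The cases `m = 2`, `m = 3` and `m ≥ 4` have different proofs; HVN
matters only in the last.

For `m = 2`, three neighbours of a vertex are independent. Chairs and connectedness show that the
vertices with at least two neighbours among them, and the remaining vertices, are two independent
sets, so the graph is even bipartite (`Critical.false_of_cliqueFree_three`).

For `m = 3`, removing an independent set that meets all triangles would reduce to `m = 2` and save a
colour, so every nonempty independent set misses a triangle. Hence an independent triple that no
vertex meets exactly once extends to a sun, and explicit four-colourings show that it has no common
neighbour (`CriticalFour.not_goodTriple`). Two consequences follow: adjacent vertices have at most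
two common neighbours, and there is no claw (`CriticalFour.not_claw`). So every neighbourhood is
triangle-free with no independent triple, and degrees are four or five. Kempe chains exclude degree
four (`CriticalFour.not_rainbow`). All neighbourhoods are then pentagons, the graph looks locally
like the icosahedron, and no pentagon can repeat a colour (`CriticalFour.not_wheel`), although only
four colours are available.

For `m ≥ 4`, HVN forces a vertex with two neighbours in a big clique to miss exactly one vertex of
it. Such near-twins are excluded (`CriticalLarge.not_twinClique`), so a vertex outside a big clique
has at most one neighbour in it. It follows that every vertex lies in two big cliques that cover its
neighbourhood and meet only there, as in a line graph. The last step is Shannon's argument for edge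
colourings: three sets of missing colours are pairwise disjoint, and counting gives `2k ≤ 3m - 2`
(`CriticalLarge.not_bigClique`). -/

namespace SimpleGraph

variable {V : Type*} {G : SimpleGraph V}

/-- `G` has no induced chair with centre `c`, leaves `a`, `b` and subdivided edge `c x p`. -/
def ChairFree (G : SimpleGraph V) : Prop :=
  ∀ c a b x p : V, G.Adj c a → G.Adj c b → G.Adj c x → G.Adj x p → a ≠ b →
    ¬G.Adj a b → ¬G.Adj a x → ¬G.Adj b x → ¬G.Adj c p → ¬G.Adj a p → ¬G.Adj b p → False

/-- No vertex `e` of `G` has exactly two neighbours `a`, `b` in a complete subgraph `a b c d`. -/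
def HVNFree (G : SimpleGraph V) : Prop :=
  ∀ a b c d e : V, G.Adj a b → G.Adj a c → G.Adj a d → G.Adj b c → G.Adj b d → G.Adj c d →
    G.Adj e a → G.Adj e b → ¬G.Adj e c → ¬G.Adj e d → False

/-- `f` is a proper colouring of `G` on the set `s`, with colours less than `k`. -/
def ColorsOn (G : SimpleGraph V) (s : Set V) (k : ℕ) (f : V → ℕ) : Prop :=
  (∀ u ∈ s, f u < k) ∧ ∀ u ∈ s, ∀ w ∈ s, G.Adj u w → f u ≠ f w

/-- `G` is not `k`-colourable, but becomes so when any vertex is removed. -/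
structure Critical (G : SimpleGraph V) (k : ℕ) : Prop where
  not_colors : ∀ f, ¬G.ColorsOn Set.univ k f
  colors_compl : ∀ v, ∃ f, G.ColorsOn {v}ᶜ k f

/-! ### Partial colourings and vertex-critical graphs -/

theorem ColorsOn.mono {s t : Set V} {k l : ℕ} {f : V → ℕ} (h : G.ColorsOn t k f) (hst : s ⊆ t)
    (hkl : k ≤ l) : G.ColorsOn s l f :=
  ⟨fun u hu => (h.1 u (hst hu)).trans_le hkl, fun u hu w hw => h.2 u (hst hu) w (hst hw)⟩

/-- Colour the vertex `v`, outside `s`, with a colour that no neighbour in `s` has. -/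
theorem ColorsOn.update_insert {s : Set V} {k : ℕ} {f : V → ℕ} [DecidableEq V]
    (h : G.ColorsOn s k f) {v : V} {c : ℕ} (hc : c < k)
    (hv : ∀ n ∈ s, n ≠ v → G.Adj v n → f n ≠ c) :
    G.ColorsOn (insert v s) k (Function.update f v c) := by
  refine ⟨fun u hu => ?_, fun u hu w hw huw => ?_⟩
  · by_cases huv : u = v
    · simp [huv, hc]
    · simpa [huv] using h.1 u (hu.resolve_left huv)
  · by_cases huv : u = v
    · subst huv
      have hw' : w ≠ u := huw.ne'
      simpa [hw'] using (hv w (hw.resolve_left hw') hw' huw).symm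
    · by_cases hwv : w = v
      · subst hwv
        simpa [huv] using hv u (hu.resolve_left huv) huv huw.symm
      · simpa [huv, hwv] using h.2 u (hu.resolve_left huv) w (hw.resolve_left hwv) huw

/-- Change the colour of the vertex `v`. -/
theorem ColorsOn.update {s : Set V} {k : ℕ} {f : V → ℕ} [DecidableEq V]
    (h : G.ColorsOn s k f) {v : V} {c : ℕ} (hc : c < k) (hv : ∀ n ∈ s, G.Adj v n → f n ≠ c) :
    G.ColorsOn s k (Function.update f v c) :=
  (h.update_insert hc fun n hn _ => hv n hn).mono (Set.subset_insert _ _) le_rfl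

namespace Critical

variable {k : ℕ} (h : G.Critical k)
include h

theorem exists_adj_color {v : V} {f : V → ℕ} (hf : G.ColorsOn {v}ᶜ k f) {c : ℕ} (hc : c < k) :
    ∃ n, G.Adj v n ∧ f n = c := by
  classical
  by_contra! hn
  refine h.not_colors _ ((hf.update_insert hc fun n _ _ => hn n).mono ?_ le_rfl)
  intro u _
  by_cases hu : u = v <;> simp [hu]

theorem le_card {v : V} {t : Finset V} (ht : ∀ n, G.Adj v n → n ∈ t) : k ≤ t.card := by
  classical
  obtain ⟨f, hf⟩ := h.colors_compl v
  calc k = (Finset.range k).card := by simp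
    _ ≤ (t.image f).card := by
      refine Finset.card_le_card fun c hc => ?_
      obtain ⟨n, hn, rfl⟩ := h.exists_adj_color hf (Finset.mem_range.1 hc)
      exact Finset.mem_image_of_mem f (ht n hn)
    _ ≤ t.card := Finset.card_image_le

/-- If every neighbour of `u` were a neighbour of `w`, a colouring of `G - u` would extend to `u`
with the colour of `w`. -/
theorem exists_adj_not_adj {u w : V} (huw : u ≠ w) :
    ∃ z, G.Adj u z ∧ ¬G.Adj w z := by
  obtain ⟨f, hf⟩ := h.colors_compl u
  obtain ⟨z, hz, hzw⟩ := h.exists_adj_color hf (hf.1 w huw.symm)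
  exact ⟨z, hz, fun hwz => hf.2 w huw.symm z hz.ne' hwz hzw.symm⟩

/-- A critical graph is connected: a proper union of components and its complement each avoid some
vertex, so they can be coloured separately. -/
theorem eq_univ_of_closed {s : Set V} (hs : s.Nonempty) (hcl : ∀ u ∈ s, ∀ w, G.Adj u w → w ∈ s) :
    s = Set.univ := by
  classical
  by_contra hne
  obtain ⟨v, hv⟩ := (Set.ne_univ_iff_exists_notMem s).1 hne
  obtain ⟨u, hu⟩ := hs
  obtain ⟨f, hf⟩ := h.colors_compl v
  obtain ⟨g, hg⟩ := h.colors_compl u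
  have hf' : ∀ {x}, x ∈ s → x ∈ ({v}ᶜ : Set V) := fun hx hxv => hv (hxv ▸ hx)
  have hg' : ∀ {x}, x ∉ s → x ∈ ({u}ᶜ : Set V) := fun hx hxu => hx (hxu ▸ hu)
  refine h.not_colors (fun x => if x ∈ s then f x else g x) ⟨fun x _ => ?_, fun x _ y _ hxy => ?_⟩
  · by_cases hx : x ∈ s
    · simpa [hx] using hf.1 x (hf' hx)
    · simpa [hx] using hg.1 x (hg' hx)
  · by_cases hx : x ∈ s
    · have hy := hcl x hx y hxy
      simpa [hx, hy] using hf.2 x (hf' hx) y (hf' hy) hxy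
    · have hy : y ∉ s := fun hy => hx (hcl y hy x hxy.symm)
      simpa [hx, hy] using hg.2 x (hg' hx) y (hg' hy) hxy

/-- A neighbour of the uncoloured vertex that alone has its colour sees every other colour. -/
theorem exists_adj_of_unique {v n : V} {f : V → ℕ} (hf : G.ColorsOn {v}ᶜ k f) (hn : G.Adj v n)
    (huniq : ∀ n', G.Adj v n' → f n' = f n → n' = n) {c : ℕ} (hc : c < k) (hcn : c ≠ f n) :
    ∃ z, G.Adj n z ∧ z ≠ v ∧ f z = c := by
  classical
  by_contra! hz
  obtain ⟨n', hn', hfn'⟩ := h.exists_adj_color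
    (hf.update (v := n) hc fun z hzv hnz => hz z hnz hzv) (hf.1 n hn.ne')
  by_cases hnn : n' = n
  · subst hnn; simp at hfn'; exact hcn hfn'
  · simp [hnn] at hfn'; exact hnn (huniq n' hn' hfn')

end Critical

/-! ### Kempe chains -/

/-- The subgraph of `G` on the vertices of `s` with colours `i` and `j`. -/
def kempe (G : SimpleGraph V) (s : Set V) (f : V → ℕ) (i j : ℕ) : SimpleGraph V where
  Adj u w := G.Adj u w ∧ u ∈ s ∧ w ∈ s ∧ (f u = i ∧ f w = j ∨ f u = j ∧ f w = i)
  symm := ⟨fun u w h => ⟨h.1.symm, h.2.2.1, h.2.1, by tauto⟩⟩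
  loopless := ⟨fun u h => G.loopless.irrefl u h.1⟩

open Classical in
/-- The colouring that results from exchanging the colours `i` and `j` on the Kempe component of
`a`. -/
noncomputable def kempeSwap (G : SimpleGraph V) (s : Set V) (f : V → ℕ) (i j : ℕ) (a : V) : V → ℕ :=
  fun u => if (G.kempe s f i j).Reachable a u then Equiv.swap i j (f u) else f u

theorem ColorsOn.kempeSwap {s : Set V} {k : ℕ} {f : V → ℕ} (h : G.ColorsOn s k f) {i j : ℕ}
    (hi : i < k) (hj : j < k) (a : V) : G.ColorsOn s k (G.kempeSwap s f i j a) := by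
  classical
  refine ⟨fun u hu => ?_, fun u hu w hw huw => ?_⟩
  · have := h.1 u hu
    unfold SimpleGraph.kempeSwap
    split_ifs
    · rw [Equiv.swap_apply_def]; split_ifs <;> assumption
    · exact this
  · have hne := h.2 u hu w hw huw
    have key : ∀ x ∈ s, ∀ y ∈ s, G.Adj x y → (G.kempe s f i j).Reachable a x →
        ¬(G.kempe s f i j).Reachable a y → Equiv.swap i j (f x) ≠ f y := by
      intro x hx y hy hxy hax hay heq
      apply hay
      refine hax.trans (Adj.reachable ⟨hxy, hx, hy, ?_⟩)
      have hne' := h.2 x hx y hy hxy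
      rw [Equiv.swap_apply_def] at heq
      split_ifs at heq with h1 h2
      · exact Or.inl ⟨h1, heq.symm⟩
      · exact Or.inr ⟨h2, heq.symm⟩
      · exact absurd heq hne'
    unfold SimpleGraph.kempeSwap
    split_ifs with h1 h2 h2
    · exact fun heq => hne ((Equiv.swap i j).injective heq)
    · exact key u hu w hw huw h1 h2
    · exact (key w hw u hu huw.symm h2 h1).symm
    · exact hne

theorem kempeSwap_of_not_reachable {s : Set V} {f : V → ℕ} {i j : ℕ} {a u : V}
    (h : ¬(G.kempe s f i j).Reachable a u) : G.kempeSwap s f i j a u = f u := if_neg h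

theorem kempeSwap_of_ne {s : Set V} {f : V → ℕ} {i j : ℕ} {a u : V} (hi : f u ≠ i) (hj : f u ≠ j) :
    G.kempeSwap s f i j a u = f u := by
  unfold kempeSwap
  split_ifs
  · exact Equiv.swap_apply_of_ne_of_ne hi hj
  · rfl

theorem kempeSwap_self {s : Set V} {f : V → ℕ} {i j : ℕ} {a : V} :
    G.kempeSwap s f i j a a = Equiv.swap i j (f a) := if_pos (Reachable.refl a)

/-- A connected graph of maximum degree two has at most two vertices of degree at most one. -/
theorem not_three_ends [Finite V] {H : SimpleGraph V}
    (hdeg : ∀ u x y z, H.Adj u x → H.Adj u y → H.Adj u z → x = y ∨ x = z ∨ y = z)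
    {a b c : V} (hab : a ≠ b) (hac : a ≠ c) (hbc : b ≠ c) (hrb : H.Reachable a b)
    (hrc : H.Reachable a c) (ha : ∀ x y, H.Adj a x → H.Adj a y → x = y)
    (hb : ∀ x y, H.Adj b x → H.Adj b y → x = y) (hc : ∀ x y, H.Adj c x → H.Adj c y → x = y) :
    False := by
  classical
  have := Fintype.ofFinite V
  let C := H.connectedComponentMk a
  have hCb : b ∈ C := (ConnectedComponent.sound hrb).symm
  have hCc : c ∈ C := (ConnectedComponent.sound hrc).symm
  have hconn : C.toSimpleGraph.Connected := C.connected_toSimpleGraph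
  have h1 := hconn.card_vert_le_card_edgeSet_add_one
  have h2 := C.toSimpleGraph.sum_degrees_eq_twice_card_edges
  have hle : ∀ u : C, C.toSimpleGraph.degree u ≤ 2 := by
    intro u
    by_contra! hu
    obtain ⟨x, y, z, hx, hy, hz, hxy, hxz, hyz⟩ := Finset.two_lt_card_iff.1 hu
    simp only [mem_neighborFinset] at hx hy hz
    rcases hdeg u x y z hx hy hz with h | h | h
    · exact hxy (Subtype.ext h)
    · exact hxz (Subtype.ext h)
    · exact hyz (Subtype.ext h)
  have hle1 : ∀ u : C, (∀ x y, H.Adj u x → H.Adj u y → x = y) → C.toSimpleGraph.degree u ≤ 1 := by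
    intro u hu
    by_contra! h
    obtain ⟨x, hx, y, hy, hxy⟩ := Finset.one_lt_card.1 h
    simp only [mem_neighborFinset] at hx hy
    exact hxy (Subtype.ext (hu x y hx hy))
  let a' : C := ⟨a, rfl⟩
  let b' : C := ⟨b, hCb⟩
  let c' : C := ⟨c, hCc⟩
  have hT : ({a', b', c'} : Finset C).card = 3 := by
    rw [Finset.card_eq_three]
    exact ⟨a', b', c', fun h => hab (congrArg Subtype.val h), fun h => hac (congrArg Subtype.val h),
      fun h => hbc (congrArg Subtype.val h), rfl⟩
  -- A connected graph on `n` vertices has degree sum at least `2n - 2`; three vertices of degree at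
  -- most one, with all others at most two, leave only `2n - 3`.
  have h3 : ∑ u : C, (C.toSimpleGraph.degree u + if u ∈ ({a', b', c'} : Finset C) then 1 else 0)
      ≤ ∑ _u : C, 2 := by
    refine Finset.sum_le_sum fun u _ => ?_
    split_ifs with hu
    · simp only [Finset.mem_insert, Finset.mem_singleton] at hu
      rcases hu with rfl | rfl | rfl
      · exact Nat.succ_le_succ (hle1 a' ha)
      · exact Nat.succ_le_succ (hle1 b' hb)
      · exact Nat.succ_le_succ (hle1 c' hc)
    · simpa using hle u
  rw [Finset.sum_add_distrib, h2, Finset.sum_ite_mem, Finset.univ_inter] at h3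
  simp only [Finset.sum_const, smul_eq_mul, mul_one, hT, Finset.card_univ] at h3
  rw [Nat.card_eq_fintype_card, Nat.card_eq_fintype_card, ← edgeFinset_card] at h1
  omega

/-! ### Clique number two -/

theorem Critical.exists_three_adj [Finite V] {k : ℕ} (h : G.Critical k) (hk : 3 ≤ k) (v : V) :
    ∃ a b c, G.Adj v a ∧ G.Adj v b ∧ G.Adj v c ∧ a ≠ b ∧ a ≠ c ∧ b ≠ c := by
  classical
  have := Fintype.ofFinite V
  have hcard := h.le_card (v := v) (t := Finset.univ.filter (G.Adj v)) (by simp)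
  obtain ⟨a, b, c, ha, hb, hc, hab, hac, hbc⟩ := Finset.two_lt_card_iff.1 (hk.trans hcard)
  simp only [Finset.mem_filter, Finset.mem_univ, true_and] at ha hb hc
  exact ⟨a, b, c, ha, hb, hc, hab, hac, hbc⟩

/-- `u` has at least two neighbours among `a`, `b`, `c`. -/
def AdjTwo (G : SimpleGraph V) (a b c u : V) : Prop :=
  G.Adj u a ∧ G.Adj u b ∨ G.Adj u a ∧ G.Adj u c ∨ G.Adj u b ∧ G.Adj u c

/-- An independent triple such that no vertex has exactly one neighbour in it. -/
structure GoodTriple (G : SimpleGraph V) (a b c : V) : Prop where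
  ne_ab : a ≠ b
  ne_ac : a ≠ c
  ne_bc : b ≠ c
  not_ab : ¬G.Adj a b
  not_ac : ¬G.Adj a c
  not_bc : ¬G.Adj b c
  adjTwo : ∀ u, G.Adj u a ∨ G.Adj u b ∨ G.Adj u c → G.AdjTwo a b c u

/-- The neighbours `a`, `b`, `c` of `v` are independent. A chair at `v` shows that no vertex has
exactly one neighbour among them, and the graph splits into two independent sets: the vertices with
at least two such neighbours, and the others. -/
theorem Critical.false_of_cliqueFree_three [Finite V] (hch : G.ChairFree) (h3 : G.CliqueFree 3)
    (h : G.Critical 3) : False := by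
  classical
  have htri : ∀ u v w, G.Adj u v → G.Adj u w → G.Adj v w → False := fun u v w huv huw hvw =>
    h3 {u, v, w} (is3Clique_triple_iff.2 ⟨huv, huw, hvw⟩)
  have hsym : ∀ u v, G.Adj u v → G.Adj v u := fun u v => Adj.symm
  rcases isEmpty_or_nonempty V with hV | ⟨⟨v⟩⟩
  · exact h.not_colors (fun _ => 0) ⟨fun u => hV.elim u, fun u => hV.elim u⟩
  obtain ⟨a, b, c, ha, hb, hc, hab, hac, hbc⟩ := h.exists_three_adj le_rfl v
  have two : ∀ u, G.Adj u a ∨ G.Adj u b ∨ G.Adj u c → G.AdjTwo a b c u := by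
    intro u hu
    have h1 := hch v a b c u
    have h2 := hch v a c b u
    have h3 := hch v b c a u
    unfold AdjTwo
    grind
  have hmid : ∀ n r r', G.AdjTwo a b c n → ¬G.AdjTwo a b c r → ¬G.AdjTwo a b c r' → G.Adj n r →
      G.Adj r r' → False := by
    intro n r r' hn hr hr' hnr hrr'
    have h1 := hch n a b r r'
    have h2 := hch n a c r r'
    have h3 := hch n b c r r'
    have h4 := two r
    have h5 := two r'
    unfold AdjTwo at *
    grind
  have hind : ∀ r r', G.Adj r r' → ¬G.AdjTwo a b c r → ¬G.AdjTwo a b c r' → False := by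
    intro r r' hrr' hr hr'
    -- By `hmid` the ends of edges between vertices of the second kind form a closed set. By
    -- connectedness it would be everything, but `v` is of the first kind.
    have huniv := h.eq_univ_of_closed
      (s := {u | ¬G.AdjTwo a b c u ∧ ∃ w, ¬G.AdjTwo a b c w ∧ G.Adj u w})
      ⟨r, hr, r', hr', hrr'⟩ (by
        rintro u ⟨hu, w, hw, huw⟩ z huz
        by_cases hz : G.AdjTwo a b c z
        · exact (hmid z u w hz hu hw huz.symm huw).elim
        · exact ⟨hz, u, hu, huz.symm⟩)
    have : v ∈ {u | ¬G.AdjTwo a b c u ∧ ∃ w, ¬G.AdjTwo a b c w ∧ G.Adj u w} := huniv ▸ trivial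
    exact this.1 (Or.inl ⟨ha, hb⟩)
  refine h.not_colors (fun u => if G.AdjTwo a b c u then 1 else 0)
    ⟨fun u _ => by dsimp only; split_ifs <;> norm_num, fun u _ w _ huw => ?_⟩
  -- Two vertices of the first kind share a neighbour in the triple, so an edge between them would
  -- give a triangle.
  have := hind u w huw
  dsimp only
  split_ifs with h1 h2 h2 <;> simp_all
  unfold AdjTwo at *
  grind

/-! ### Clique number three: suns and good triples -/

/-- A chair-free and `K₄`-free graph that is vertex-critical for four colours, in which
deleting any independent set that meets all triangles leaves a three-colourable graph. -/
structure CriticalFour (G : SimpleGraph V) : Prop where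
  critical : G.Critical 4
  chair : G.ChairFree
  k4 : ∀ a b c d, G.Adj a b → G.Adj a c → G.Adj a d → G.Adj b c → G.Adj b d → G.Adj c d → False
  stable : ∀ W : Set V, W.Nonempty → (∀ u ∈ W, ∀ w ∈ W, ¬G.Adj u w) →
    ∃ u v w, u ∉ W ∧ v ∉ W ∧ w ∉ W ∧ G.Adj u v ∧ G.Adj u w ∧ G.Adj v w

theorem Critical.false_of_cover (h : G.Critical 4) (A B C D : V → Prop)
    (hcover : ∀ u, A u ∨ B u ∨ C u ∨ D u) (hA : ∀ u w, A u → A w → ¬G.Adj u w)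
    (hB : ∀ u w, B u → B w → ¬G.Adj u w) (hC : ∀ u w, C u → C w → ¬G.Adj u w)
    (hD : ∀ u w, D u → D w → ¬G.Adj u w) : False := by
  classical
  refine h.not_colors (fun u => if A u then 0 else if B u then 1 else if C u then 2 else 3)
    ⟨fun u _ => ?_, fun u _ w _ huw => ?_⟩
  · dsimp only
    split_ifs <;> norm_num
  · have hu := hcover u
    have hw := hcover w
    have h1 := hA u w
    have h2 := hB u w
    have h3 := hC u w
    have h4 := hD u w
    dsimp only
    split_ifs <;> simp_all

theorem GoodTriple.perm₁₂ {a b c : V} (h : G.GoodTriple a b c) : G.GoodTriple b a c where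
  ne_ab := h.ne_ab.symm
  ne_ac := h.ne_bc
  ne_bc := h.ne_ac
  not_ab := mt Adj.symm h.not_ab
  not_ac := h.not_bc
  not_bc := h.not_ac
  adjTwo u hu := by have := h.adjTwo u; unfold AdjTwo at *; grind

theorem GoodTriple.perm₂₃ {a b c : V} (h : G.GoodTriple a b c) : G.GoodTriple a c b where
  ne_ab := h.ne_ac
  ne_ac := h.ne_ab
  ne_bc := h.ne_bc.symm
  not_ab := h.not_ac
  not_ac := h.not_ab
  not_bc := mt Adj.symm h.not_bc
  adjTwo u hu := by have := h.adjTwo u; unfold AdjTwo at *; grind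

/-- A good triple together with a triangle that is its transversal in the complement. -/
structure Sun (G : SimpleGraph V) (x₁ x₂ x₃ m₁ m₂ m₃ : V) : Prop extends GoodTriple G x₁ x₂ x₃ where
  m₁x₁ : ¬G.Adj m₁ x₁
  m₁x₂ : G.Adj m₁ x₂
  m₁x₃ : G.Adj m₁ x₃
  m₂x₁ : G.Adj m₂ x₁
  m₂x₂ : ¬G.Adj m₂ x₂
  m₂x₃ : G.Adj m₂ x₃
  m₃x₁ : G.Adj m₃ x₁
  m₃x₂ : G.Adj m₃ x₂
  m₃x₃ : ¬G.Adj m₃ x₃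
  m₁m₂ : G.Adj m₁ m₂
  m₁m₃ : G.Adj m₁ m₃
  m₂m₃ : G.Adj m₂ m₃

namespace Sun

variable {x₁ x₂ x₃ m₁ m₂ m₃ : V} (S : G.Sun x₁ x₂ x₃ m₁ m₂ m₃)
include S

theorem perm₁₂ : G.Sun x₂ x₁ x₃ m₂ m₁ m₃ :=
  ⟨S.toGoodTriple.perm₁₂, S.m₂x₂, S.m₂x₁, S.m₂x₃, S.m₁x₂, S.m₁x₁, S.m₁x₃, S.m₃x₂, S.m₃x₁, S.m₃x₃,
    S.m₁m₂.symm, S.m₂m₃, S.m₁m₃⟩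

theorem perm₂₃ : G.Sun x₁ x₃ x₂ m₁ m₃ m₂ :=
  ⟨S.toGoodTriple.perm₂₃, S.m₁x₁, S.m₁x₃, S.m₁x₂, S.m₃x₁, S.m₃x₃, S.m₃x₂, S.m₂x₁, S.m₂x₃, S.m₂x₂,
    S.m₁m₃, S.m₁m₂, S.m₂m₃.symm⟩

/-- Chairs centred at `m₁` would make `r` adjacent to `m₂` and `m₃`, completing a `K₄`. -/
theorem not_adj_m₁ (hG : G.CriticalFour) {r : V} (h1 : ¬G.Adj r x₁ ∧ r ≠ x₁)
    (h2 : ¬G.Adj r x₂ ∧ r ≠ x₂) (h3 : ¬G.Adj r x₃ ∧ r ≠ x₃) : ¬G.Adj r m₁ := by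
  intro h
  have hs : ∀ u v, G.Adj u v → G.Adj v u := fun u v => Adj.symm
  obtain ⟨⟨_, _, _, _, _, _, _⟩, _, _, _, _, _, _, _, _, _, _, _, _⟩ := S
  have := hG.chair m₁ r x₂ m₂ x₁
  have := hG.chair m₁ r x₃ m₃ x₁
  have := hG.k4 r m₁ m₂ m₃
  grind

/-- If `r` and `n` were adjacent, chairs centred at `n` would make `n` adjacent to `m₁` and `m₂`,
then to `x₃`, and `n m₁ m₂ x₃` would be a `K₄`. -/
theorem not_adj_of_adj₁₂ (hG : G.CriticalFour) {r n : V} (h1 : ¬G.Adj r x₁ ∧ r ≠ x₁)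
    (h2 : ¬G.Adj r x₂ ∧ r ≠ x₂) (h3 : ¬G.Adj r x₃ ∧ r ≠ x₃)
    (hn1 : G.Adj n x₁) (hn2 : G.Adj n x₂) : ¬G.Adj r n := by
  intro h
  have hs : ∀ u v, G.Adj u v → G.Adj v u := fun u v => Adj.symm
  have r1 := S.not_adj_m₁ hG h1 h2 h3
  have r2 := S.perm₁₂.not_adj_m₁ hG h2 h1 h3
  obtain ⟨⟨_, _, _, _, _, _, _⟩, _, _, _, _, _, _, _, _, _, _, _, _⟩ := S
  have := hG.chair n r x₂ x₁ m₂
  have := hG.chair n r x₁ x₂ m₁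
  have := hG.chair n r x₁ m₁ x₃
  have := hG.k4 n m₁ m₂ x₃
  grind

/-- By the preceding lemmas the vertices that are neither in the triple nor adjacent to it form a
closed set, which connectedness makes empty. -/
theorem adjTwo_of_ne (hG : G.CriticalFour) {u : V} (h1 : u ≠ x₁) (h2 : u ≠ x₂) (h3 : u ≠ x₃) :
    G.AdjTwo x₁ x₂ x₃ u := by
  by_contra hu
  have hR := hG.critical.eq_univ_of_closed (s := {r | (¬G.Adj r x₁ ∧ r ≠ x₁) ∧
    (¬G.Adj r x₂ ∧ r ≠ x₂) ∧ (¬G.Adj r x₃ ∧ r ≠ x₃)})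
    ⟨u, by have := S.adjTwo u; simp only [Set.mem_ofPred_eq]; tauto⟩ (by
      rintro r ⟨h1, h2, h3⟩ n hrn
      have e1 := S.adjTwo n
      have e2 := S.not_adj_of_adj₁₂ hG (n := n) h1 h2 h3
      have e3 := S.perm₂₃.not_adj_of_adj₁₂ hG (n := n) h1 h3 h2
      have e4 := S.perm₁₂.perm₂₃.not_adj_of_adj₁₂ hG (n := n) h2 h3 h1
      unfold AdjTwo at e1
      have hs : ∀ u v, G.Adj u v → G.Adj v u := fun u v => Adj.symm
      simp only [Set.mem_ofPred_eq]
      grind)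
  have : x₁ ∈ {r | (¬G.Adj r x₁ ∧ r ≠ x₁) ∧
    (¬G.Adj r x₂ ∧ r ≠ x₂) ∧ (¬G.Adj r x₃ ∧ r ≠ x₃)} := hR ▸ trivial
  exact this.1.2 rfl

/-- Two vertices outside the triple share a neighbour in it, which with `q` and an edge between them
would be a `K₄`. -/
theorem not_adj_of_hub (hG : G.CriticalFour) {q : V} (hq1 : G.Adj q x₁) (hq2 : G.Adj q x₂)
    (hq3 : G.Adj q x₃) (u w : V) (hu : u ≠ x₁ ∧ u ≠ x₂ ∧ u ≠ x₃) (hw : w ≠ x₁ ∧ w ≠ x₂ ∧ w ≠ x₃)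
    (hqu : G.Adj q u) (hqw : G.Adj q w) : ¬G.Adj u w := by
  intro huw
  have k1 := hG.k4 q u w x₁
  have k2 := hG.k4 q u w x₂
  have k3 := hG.k4 q u w x₃
  have t1 := S.adjTwo_of_ne hG hu.1 hu.2.1 hu.2.2
  have t2 := S.adjTwo_of_ne hG hw.1 hw.2.1 hw.2.2
  unfold AdjTwo at t1 t2
  tauto

/-- Otherwise four colours suffice for a graph with a sun whose hub misses the triangle. -/
theorem exists_of_not_adj_m (hG : G.CriticalFour) {q : V} (hq1 : G.Adj q x₁) (hq2 : G.Adj q x₂)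
    (hq3 : G.Adj q x₃) (hm2 : ¬G.Adj q m₂) (hm3 : ¬G.Adj q m₃)
    (hadj : ∀ n, n ≠ x₁ → n ≠ x₂ → n ≠ x₃ → n ≠ m₁ → n ≠ m₂ → n ≠ m₃ → n ≠ q → G.Adj q n) :
    ∃ n, G.Adj n q ∧ G.Adj n m₁ ∧ G.Adj n m₂ ∧ G.Adj n x₁ ∧ G.Adj n x₂ ∧ ¬G.Adj n x₃ ∧
      ¬G.Adj n m₃ := by
  have hs : ∀ u v, G.Adj u v → G.Adj v u := fun u v => Adj.symm
  have hirr : ∀ u, ¬G.Adj u u := G.loopless.irrefl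
  have hB := S.not_adj_of_hub hG hq1 hq2 hq3
  by_contra! hn
  have hn' : ∀ n, n ≠ x₁ → n ≠ x₂ → n ≠ x₃ → G.Adj n q → G.Adj n m₁ → G.Adj n m₂ → False := by
    intro n h1 h2 h3 hq h4 h5
    have := S.adjTwo_of_ne hG h1 h2 h3
    have := hn n
    have := hG.k4 n m₁ m₂ x₃
    have := hG.k4 n m₁ m₂ m₃
    obtain ⟨⟨_, _, _, _, _, _, _⟩, _, _, _, _, _, _, _, _, _, _, _, _⟩ := S
    unfold AdjTwo at *
    grind
  obtain ⟨⟨_, _, _, _, _, _, _⟩, _, _, _, _, _, _, _, _, _, _, _, _⟩ := S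
  -- The neighbours of the hub outside the triple are independent, so they may be divided freely:
  -- those adjacent to `m₁` join `m₂`, where `hn'` excludes conflicts, and the others join `m₁`.
  refine hG.critical.false_of_cover (fun u => u = x₁ ∨ u = x₂ ∨ u = x₃) (fun u => u = q ∨ u = m₃)
    (fun u => u = m₁ ∨ (u ≠ x₁ ∧ u ≠ x₂ ∧ u ≠ x₃) ∧ G.Adj q u ∧ ¬G.Adj u m₁)
    (fun u => u = m₂ ∨ (u ≠ x₁ ∧ u ≠ x₂ ∧ u ≠ x₃) ∧ G.Adj q u ∧ G.Adj u m₁) ?_ ?_ ?_ ?_ ?_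
  · intro u
    have := hadj u
    grind
  all_goals grind

theorem adj_of_adj₁₂_of_not_adj_m (hG : G.CriticalFour) {q : V} (hq2 : G.Adj q x₂)
    (hq3 : G.Adj q x₃) (hm1 : ¬G.Adj q m₁) (hm2 : ¬G.Adj q m₂) (hm3 : ¬G.Adj q m₃) (n : V)
    (hn3 : n ≠ m₃) (hnq : n ≠ q)
    (h1 : G.Adj n x₁) (h2 : G.Adj n x₂) : G.Adj q n := by
  have hs : ∀ u v, G.Adj u v → G.Adj v u := fun u v => Adj.symm
  obtain ⟨⟨_, _, _, _, _, _, _⟩, _, _, _, _, _, _, _, _, _, _, _, _⟩ := S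
  by_contra hnadj
  have := hG.chair x₂ q n m₁ m₂
  have := hG.chair x₂ q n m₃ m₂
  have := hG.chair x₂ m₃ n q x₃
  have := hG.chair x₃ q n m₁ m₃
  have := hG.k4 x₁ m₂ m₃ n
  have := hG.k4 x₂ m₁ m₃ n
  have := hG.k4 x₃ m₁ m₂ n
  grind +splitImp

theorem adj_of_not_adj_m (hG : G.CriticalFour) {q : V} (hq1 : G.Adj q x₁) (hq2 : G.Adj q x₂)
    (hq3 : G.Adj q x₃) (hm1 : ¬G.Adj q m₁) (hm2 : ¬G.Adj q m₂) (hm3 : ¬G.Adj q m₃)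
    (n : V) (hn : n ≠ x₁ ∧ n ≠ x₂ ∧ n ≠ x₃) (hn1 : n ≠ m₁) (hn2 : n ≠ m₂) (hn3 : n ≠ m₃)
    (hnq : n ≠ q) : G.Adj q n := by
  rcases S.adjTwo_of_ne hG hn.1 hn.2.1 hn.2.2 with h | h | h
  · exact S.adj_of_adj₁₂_of_not_adj_m hG hq2 hq3 hm1 hm2 hm3 n hn3 hnq h.1 h.2
  · exact S.perm₂₃.adj_of_adj₁₂_of_not_adj_m hG hq3 hq2 hm1 hm3 hm2 n hn2 hnq h.1 h.2
  · exact S.perm₁₂.perm₂₃.adj_of_adj₁₂_of_not_adj_m hG hq3 hq1 hm2 hm3 hm1 n hn1 hnq h.1 h.2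

/-- The hub sees every vertex outside the sun, and these vertices are pairwise non-adjacent. The
vertices `a`, `b`, `c`, one for each edge of the triangle, force by chairs at `q` that each of them
has two neighbours in the triangle; the pair it sees determines its colour class. -/
theorem false_of_not_adj_m (hG : G.CriticalFour) {q : V} (hq1 : G.Adj q x₁) (hq2 : G.Adj q x₂)
    (hq3 : G.Adj q x₃) (hm1 : ¬G.Adj q m₁) (hm2 : ¬G.Adj q m₂) (hm3 : ¬G.Adj q m₃) : False := by
  have hs : ∀ u v, G.Adj u v → G.Adj v u := fun u v => Adj.symm
  have hirr : ∀ u, ¬G.Adj u u := G.loopless.irrefl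
  have hB := S.not_adj_of_hub hG hq1 hq2 hq3
  have hadj := S.adj_of_not_adj_m hG hq1 hq2 hq3 hm1 hm2 hm3
  obtain ⟨a, _, _, _, _, _, _, _⟩ := S.exists_of_not_adj_m hG hq1 hq2 hq3 hm2 hm3
    fun n h1 h2 h3 => hadj n ⟨h1, h2, h3⟩
  obtain ⟨b, _, _, _, _, _, _, _⟩ := S.perm₂₃.exists_of_not_adj_m hG hq1 hq3 hq2 hm3 hm2
    fun n h1 h2 h3 h4 h5 h6 => hadj n ⟨h1, h3, h2⟩ h4 h6 h5
  obtain ⟨c, _, _, _, _, _, _, _⟩ := S.perm₁₂.perm₂₃.exists_of_not_adj_m hG hq2 hq3 hq1 hm3 hm1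
    fun n h1 h2 h3 h4 h5 h6 => hadj n ⟨h3, h1, h2⟩ h6 h4 h5
  have two := fun n (hn : n ≠ x₁ ∧ n ≠ x₂ ∧ n ≠ x₃) => S.adjTwo_of_ne hG hn.1 hn.2.1 hn.2.2
  obtain ⟨⟨_, _, _, _, _, _, _⟩, _, _, _, _, _, _, _, _, _, _, _, _⟩ := S
  have hm : ∀ n, (n ≠ x₁ ∧ n ≠ x₂ ∧ n ≠ x₃) → n ≠ m₁ → n ≠ m₂ → n ≠ m₃ → n ≠ q →
      G.AdjTwo m₁ m₂ m₃ n := by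
    intro n hn h1 h2 h3 hq
    have := hadj n hn h1 h2 h3 hq
    have := hG.chair q b n c m₂
    have := hG.chair q c n a m₁
    have := hG.chair q a n b m₃
    have := hB a n
    have := hB b n
    have := hB c n
    have := hB a b
    have := hB a c
    have := hB b c
    clear two
    unfold AdjTwo
    grind +splitImp
  have ht : ∀ n, (n ≠ x₁ ∧ n ≠ x₂ ∧ n ≠ x₃) → (G.Adj n m₁ → G.Adj n m₂ → ¬G.Adj n x₃) ∧
      (G.Adj n m₁ → G.Adj n m₃ → ¬G.Adj n x₂) ∧ (G.Adj n m₂ → G.Adj n m₃ → ¬G.Adj n x₁) := by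
    intro n hn
    have := hG.k4 n m₁ m₂ x₃
    have := hG.k4 n m₁ m₃ x₂
    have := hG.k4 n m₂ m₃ x₁
    grind
  have h4 := fun n => hG.k4 n m₁ m₂ m₃
  clear two
  refine hG.critical.false_of_cover
    (fun u => u = x₁ ∨ u = m₁ ∨ (u ≠ x₁ ∧ u ≠ x₂ ∧ u ≠ x₃) ∧ G.Adj q u ∧ G.Adj u m₂ ∧ G.Adj u m₃)
    (fun u => u = x₂ ∨ u = m₂ ∨ (u ≠ x₁ ∧ u ≠ x₂ ∧ u ≠ x₃) ∧ G.Adj q u ∧ G.Adj u m₁ ∧ G.Adj u m₃)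
    (fun u => u = q ∨ u = m₃)
    (fun u => u = x₃ ∨ (u ≠ x₁ ∧ u ≠ x₂ ∧ u ≠ x₃) ∧ G.Adj q u ∧ G.Adj u m₁ ∧ G.Adj u m₂)
    ?_ ?_ ?_ ?_ ?_
  · intro u
    have := hadj u
    have := hm u
    unfold AdjTwo at this
    grind
  · grind
  · grind
  · grind
  · grind

theorem adj_m₁_or_m₂ (hG : G.CriticalFour) {q : V} (hq1 : G.Adj q x₁) (hq2 : G.Adj q x₂)
    (hm1 : ¬G.Adj q m₁) (hm2 : ¬G.Adj q m₂) (n : V) (hn : n ≠ x₁ ∧ n ≠ x₂ ∧ n ≠ x₃) (hnq : n ≠ q)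
    (hqn : ¬G.Adj q n) : G.Adj n m₁ ∨ G.Adj n m₂ := by
  have hs : ∀ u v, G.Adj u v → G.Adj v u := fun u v => Adj.symm
  have := S.adjTwo_of_ne hG hn.1 hn.2.1 hn.2.2
  obtain ⟨⟨_, _, _, _, _, _, _⟩, _, _, _, _, _, _, _, _, _, _, _, _⟩ := S
  have := hG.chair x₁ q n m₂ m₁
  have := hG.chair x₂ q n m₁ m₂
  unfold AdjTwo at *
  grind

theorem not_adj_m₃ (hG : G.CriticalFour) {q : V} (hq1 : G.Adj q x₁)
    (hq2 : G.Adj q x₂) (hq3 : G.Adj q x₃) (hm1 : ¬G.Adj q m₁) (hm2 : ¬G.Adj q m₂)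
    (hm3 : G.Adj q m₃) (n : V) (hn : n ≠ x₁ ∧ n ≠ x₂ ∧ n ≠ x₃) (hnq : n ≠ q) (hn1 : n ≠ m₁)
    (hn2 : n ≠ m₂) : ¬G.Adj n m₃ := by
  have hs : ∀ u v, G.Adj u v → G.Adj v u := fun u v => Adj.symm
  have := S.adjTwo_of_ne hG hn.1 hn.2.1 hn.2.2
  have := S.adj_m₁_or_m₂ hG hq1 hq2 hm1 hm2 n hn hnq
  obtain ⟨⟨_, _, _, _, _, _, _⟩, _, _, _, _, _, _, _, _, _, _, _, _⟩ := S
  have := hG.k4 x₁ m₂ m₃ n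
  have := hG.k4 x₁ m₃ q n
  have := hG.k4 x₂ m₁ m₃ n
  have := hG.k4 x₂ m₃ q n
  have := hG.chair x₁ m₂ n q x₂
  have := hG.chair x₂ q n m₁ m₂
  have := hG.chair x₃ m₁ n q x₁
  unfold AdjTwo at *
  grind +splitImp

theorem adj_x₂ (hG : G.CriticalFour) {q : V}
    (hq2 : G.Adj q x₂) (hm1 : ¬G.Adj q m₁) (hm2 : ¬G.Adj q m₂)
    (n : V) (hqn : ¬G.Adj q n) (h1 : G.Adj n m₁)
    (h2 : ¬G.Adj n m₂) (hn : n ≠ m₂) : G.Adj n x₂ := by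
  have hs : ∀ u v, G.Adj u v → G.Adj v u := fun u v => Adj.symm
  obtain ⟨⟨_, _, _, _, _, _, _⟩, _, _, _, _, _, _, _, _, _, _, _, _⟩ := S
  have := hG.chair m₁ m₂ n x₂ q
  grind

/-- Without such a vertex four colours suffice: the triple is one class, and the remaining vertices
are divided by adjacency to `q` and to `m₁`. -/
theorem exists_adj_m₁_m₂ (hG : G.CriticalFour) {q : V} (hq1 : G.Adj q x₁)
    (hq2 : G.Adj q x₂) (hq3 : G.Adj q x₃) (hm1 : ¬G.Adj q m₁) (hm2 : ¬G.Adj q m₂)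
    (hm3 : G.Adj q m₃) : ∃ e, (e ≠ x₁ ∧ e ≠ x₂ ∧ e ≠ x₃) ∧ e ≠ m₃ ∧ ¬G.Adj q e ∧ G.Adj e m₁ ∧
      G.Adj e m₂ := by
  have hs : ∀ u v, G.Adj u v → G.Adj v u := fun u v => Adj.symm
  have hirr : ∀ u, ¬G.Adj u u := G.loopless.irrefl
  have hB := S.not_adj_of_hub hG hq1 hq2 hq3
  have hm := S.adj_m₁_or_m₂ hG hq1 hq2 hm1 hm2
  have h3 := S.not_adj_m₃ hG hq1 hq2 hq3 hm1 hm2 hm3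
  have hx2 := S.adj_x₂ hG hq2 hm1 hm2
  have hx1 := S.perm₁₂.adj_x₂ hG hq1 hm2 hm1
  by_contra! he
  have k1 : ∀ n n', G.Adj n m₁ → G.Adj n' m₁ → G.Adj n x₂ → G.Adj n' x₂ → ¬G.Adj n n' :=
    fun n n' h1 h2 h3 h4 h5 => hG.k4 n n' m₁ x₂ h5 h1 h3 h2 h4 S.m₁x₂
  have k2 : ∀ n n', G.Adj n m₂ → G.Adj n' m₂ → G.Adj n x₁ → G.Adj n' x₁ → ¬G.Adj n n' :=
    fun n n' h1 h2 h3 h4 h5 => hG.k4 n n' m₂ x₁ h5 h1 h3 h2 h4 S.m₂x₁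
  obtain ⟨⟨_, _, _, _, _, _, adjTwo⟩, _, _, _, _, _, _, _, _, _, _, _, _⟩ := S
  refine hG.critical.false_of_cover (fun u => u = x₁ ∨ u = x₂ ∨ u = x₃)
    (fun u => u = q ∨ u = m₁ ∨ (u ≠ x₁ ∧ u ≠ x₂ ∧ u ≠ x₃) ∧ u ≠ m₂ ∧ ¬G.Adj q u ∧ ¬G.Adj u m₁)
    (fun u => u = m₂ ∨ (u ≠ x₁ ∧ u ≠ x₂ ∧ u ≠ x₃) ∧ ¬G.Adj q u ∧ G.Adj u m₁ ∧ u ≠ m₂)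
    (fun u => u = m₃ ∨ (u ≠ x₁ ∧ u ≠ x₂ ∧ u ≠ x₃) ∧ G.Adj q u) ?_ ?_ ?_ ?_ ?_
  · intro u
    grind
  · grind
  · intro u w hu hw huw
    have := hm u
    have := hm w
    have := k2 u w
    have := hx1 u
    have := hx1 w
    clear hB hm h3 hx1 hx2 k1 k2 he adjTwo
    by_cases u = q <;> by_cases w = q <;> by_cases u = m₁ <;> by_cases w = m₁ <;> grind
  · intro u w hu hw huw
    have := he u
    have := he w
    have := k1 u w
    have := hx2 u
    have := hx2 w
    clear hB hm h3 hx1 hx2 k1 k2 he adjTwo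
    by_cases u = m₃ <;> by_cases w = m₃ <;> grind
  · intro u w hu hw huw
    have := hB u w
    have := h3 u
    have := h3 w
    clear hB hm h3 hx1 hx2 k1 k2 he
    grind

/-- With `e` from `exists_adj_m₁_m₂`, chairs leave no non-neighbour of `q` outside the triple except
`q`, `m₁`, `m₂` and `e`. The remaining structure is explicit enough to be four-coloured. -/
theorem false_of_adj_m₃ (hG : G.CriticalFour) {q : V} (hq1 : G.Adj q x₁)
    (hq2 : G.Adj q x₂) (hq3 : G.Adj q x₃) (hm1 : ¬G.Adj q m₁) (hm2 : ¬G.Adj q m₂)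
    (hm3 : G.Adj q m₃) : False := by
  obtain ⟨e, he, hem3, heq, he1, he2⟩ := S.exists_adj_m₁_m₂ hG hq1 hq2 hq3 hm1 hm2 hm3
  have hs : ∀ u v, G.Adj u v → G.Adj v u := fun u v => Adj.symm
  have hirr : ∀ u, ¬G.Adj u u := G.loopless.irrefl
  have two := fun n (hn : n ≠ x₁ ∧ n ≠ x₂ ∧ n ≠ x₃) => S.adjTwo_of_ne hG hn.1 hn.2.1 hn.2.2
  have hB := S.not_adj_of_hub hG hq1 hq2 hq3
  have hm := S.adj_m₁_or_m₂ hG hq1 hq2 hm1 hm2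
  have h3 := S.not_adj_m₃ hG hq1 hq2 hq3 hm1 hm2 hm3
  obtain ⟨⟨_, _, _, _, _, _, adjTwo⟩, _, _, _, _, _, _, _, _, _, _, _, _⟩ := S
  have hex : G.Adj e x₁ ∧ G.Adj e x₂ ∧ ¬G.Adj e x₃ ∧ e ≠ q ∧ e ≠ m₁ ∧ e ≠ m₂ := by
    have := hG.k4 x₃ m₁ m₂ e
    have := two e he
    unfold AdjTwo at this
    grind
  obtain ⟨_, _, _, _, _, _⟩ := hex
  have hq : ∀ n, (n ≠ x₁ ∧ n ≠ x₂ ∧ n ≠ x₃) → n ≠ q → n ≠ m₁ → n ≠ m₂ → n ≠ e → G.Adj q n := by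
    intro n hn h1 h2 h4 h5
    by_contra hqn
    have := hm n hn h1 hqn
    have := two n hn
    have := h3 n hn h1 h2 h4
    have := h3 e
    have := hG.chair m₁ m₂ n x₂ q
    have := hG.chair m₁ e n m₃ q
    have := hG.k4 x₂ m₁ m₃ n
    have := hG.k4 x₂ m₁ e n
    have := hG.k4 x₃ m₁ m₂ n
    have := hG.chair m₂ m₁ n x₁ q
    have := hG.chair m₂ e n m₃ q
    have := hG.k4 x₁ m₂ m₃ n
    have := hG.k4 x₁ m₂ e n
    clear hm hB h3 two
    unfold AdjTwo at *
    grind +splitImp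
  have hem : ¬G.Adj e m₃ := by have := h3 e; grind
  -- A neighbour `n₀` of `q` complete to the triple bounds the whole graph: there is no vertex
  -- beyond the sun, `q`, `e` and `n₀`. If there is none, each neighbour of `q` outside the triple
  -- misses exactly one triple vertex and may share its colour.
  by_cases h0 : ∃ n, G.Adj q n ∧ G.Adj n x₁ ∧ G.Adj n x₂ ∧ G.Adj n x₃
  · obtain ⟨n₀, _, _, _, _⟩ := h0
    have n1 : n₀ ≠ m₁ ∧ n₀ ≠ m₂ ∧ n₀ ≠ m₃ ∧ n₀ ≠ e ∧ (n₀ ≠ x₁ ∧ n₀ ≠ x₂ ∧ n₀ ≠ x₃) := by grind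
    have hn0 : ∀ n, G.Adj q n → (n ≠ x₁ ∧ n ≠ x₂ ∧ n ≠ x₃) → n = n₀ ∨ n = m₃ := by
      intro n hqn hn
      by_contra! hne
      have := hB n n₀
      have := h3 n
      have := h3 n₀
      have := two n hn
      have := hG.k4 x₁ m₂ e n₀
      have := hG.k4 x₂ m₁ e n₀
      have := hG.k4 x₃ m₁ m₂ n₀
      have := hG.chair x₁ n₀ n m₃ m₁
      have := hG.chair x₁ m₃ n₀ e n
      have := hG.chair x₁ m₃ e n x₃
      have := hG.chair x₂ n₀ n m₃ m₂
      have := hG.chair x₂ m₃ n₀ e n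
      have := hG.chair x₂ m₃ e n x₃
      have := hG.chair x₃ n₀ n m₁ m₃
      have := hG.chair x₃ n₀ n m₂ m₃
      have := hG.chair m₁ m₃ n x₃ n₀
      have := hG.chair m₂ m₃ n x₃ n₀
      have := hG.k4 x₁ m₂ e n
      have := hG.k4 x₂ m₁ e n
      clear hm hB h3 two
      unfold AdjTwo at *
      grind +splitImp
    have := hG.k4 x₁ m₂ e n₀
    have := hG.chair x₂ m₃ e n₀ x₃
    have := h3 n₀
    refine hG.critical.false_of_cover (fun u => u = x₁ ∨ u = x₂ ∨ u = x₃)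
      (fun u => u = q ∨ u = m₁) (fun u => u = m₂ ∨ u = n₀) (fun u => u = m₃ ∨ u = e) ?_ ?_ ?_ ?_ ?_
    · intro u
      have := hq u
      have := hn0 u
      grind
    · clear hm hB h3 two hq hn0; grind
    · clear hm hB h3 two hq hn0; grind
    · clear hm hB h3 two hq hn0; grind +splitImp
    · clear hm hB h3 two hq hn0; grind
  · push Not at h0
    have hm2 : ∀ n, G.Adj q n → G.Adj n x₁ → G.Adj n x₃ → ¬G.Adj n m₂ := by
      intro n h1 h2 h4
      have := h0 n
      have := hG.k4 x₁ m₂ e n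
      have := hG.k4 x₁ m₃ q n
      have := hG.chair x₁ m₃ e n x₃
      clear hm hB h3 two hq h0
      grind +splitImp
    have hm1 : ∀ n, G.Adj q n → G.Adj n x₂ → G.Adj n x₃ → ¬G.Adj n m₁ := by
      intro n h1 h2 h4
      have := h0 n
      have := hG.k4 x₂ m₁ e n
      have := hG.k4 x₂ m₃ q n
      have := hG.chair x₂ m₃ e n x₃
      clear hm hB h3 two hq h0
      grind +splitImp
    have hme : ∀ n, G.Adj q n → G.Adj n x₁ → G.Adj n x₂ → n ≠ m₃ → ¬G.Adj n e := by
      intro n h1 h2 h4 h5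
      have := h0 n
      have := hG.chair q x₃ m₃ n e
      have := hG.k4 x₂ m₃ q n
      clear hm hB h3 two hq h0
      grind +splitImp
    refine hG.critical.false_of_cover
      (fun u => u = x₁ ∨ u = m₁ ∨ (u ≠ x₁ ∧ u ≠ x₂ ∧ u ≠ x₃) ∧ G.Adj q u ∧ G.Adj u x₂ ∧ G.Adj u x₃)
      (fun u => u = x₂ ∨ u = m₂ ∨ (u ≠ x₁ ∧ u ≠ x₂ ∧ u ≠ x₃) ∧ G.Adj q u ∧ G.Adj u x₁ ∧ G.Adj u x₃)
      (fun u => u = x₃ ∨ u = m₃ ∨ u = e ∨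
        (u ≠ x₁ ∧ u ≠ x₂ ∧ u ≠ x₃) ∧ G.Adj q u ∧ G.Adj u x₁ ∧ G.Adj u x₂)
      (fun u => u = q) ?_ ?_ ?_ ?_ ?_
    · intro u
      have := hq u
      have := two u
      unfold AdjTwo at this
      grind
    · intro u w hu hw huw
      have := h0 u
      have := h0 w
      have := hB u w
      have := hm1 u
      have := hm1 w
      clear hm hB h3 two hq h0 hm1 hm2 hme adjTwo
      grind
    · intro u w hu hw huw
      have := h0 u
      have := h0 w
      have := hB u w
      have := hm2 u
      have := hm2 w
      clear hm hB h3 two hq h0 hm1 hm2 hme adjTwo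
      grind
    · intro u w hu hw huw
      have := h0 u
      have := h0 w
      have := hB u w
      have := hme u
      have := hme w
      have := h3 u
      have := h3 w
      clear hm hB h3 two hq h0 hm1 hm2 hme adjTwo
      by_cases u = m₃ <;> by_cases w = m₃ <;> grind
    · grind

end Sun

/-- By `K₄`-freeness each `xᵢ` is missed by a vertex of the triangle, and each vertex of the
triangle misses at most one `xᵢ`; so the misses form a bijection. -/
theorem GoodTriple.exists_sun_of_adj {x₁ x₂ x₃ p q r : V} (hx : G.GoodTriple x₁ x₂ x₃)
    (hk : ∀ a b c d, G.Adj a b → G.Adj a c → G.Adj a d → G.Adj b c → G.Adj b d → ¬G.Adj c d)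
    (tp : G.AdjTwo x₁ x₂ x₃ p) (tq : G.AdjTwo x₁ x₂ x₃ q) (tr : G.AdjTwo x₁ x₂ x₃ r)
    (hpq : G.Adj p q) (hpr : G.Adj p r) (hqr : G.Adj q r) :
    ∃ m₁ m₂ m₃, G.Sun x₁ x₂ x₃ m₁ m₂ m₃ := by
  have hsun : ∀ m₁ m₂ m₃, G.AdjTwo x₁ x₂ x₃ m₁ → G.AdjTwo x₁ x₂ x₃ m₂ → G.AdjTwo x₁ x₂ x₃ m₃ →
      G.Adj m₁ m₂ → G.Adj m₁ m₃ → G.Adj m₂ m₃ → ¬G.Adj m₁ x₁ → ¬G.Adj m₂ x₂ → ¬G.Adj m₃ x₃ →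
      ∃ m₁ m₂ m₃, G.Sun x₁ x₂ x₃ m₁ m₂ m₃ := by
    intro m₁ m₂ m₃ t1 t2 t3 h12 h13 h23 h1 h2 h3
    simp only [AdjTwo, h1, h2, h3, false_and, and_false, false_or, or_false] at t1 t2 t3
    exact ⟨m₁, m₂, m₃, hx, h1, t1.1, t1.2, t2.1, h2, t2.2, t3.1, t3.2, h3, h12, h13, h23⟩
  have s1 := hsun p q r tp tq tr hpq hpr hqr
  have s2 := hsun p r q tp tr tq hpr hpq hqr.symm
  have s3 := hsun q p r tq tp tr hpq.symm hqr hpr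
  have s4 := hsun q r p tq tr tp hqr hpq.symm hpr.symm
  have s5 := hsun r p q tr tp tq hpr.symm hqr.symm hpq
  have s6 := hsun r q p tr tq tp hqr.symm hpr.symm hpq.symm
  have hmiss : ∀ x, ¬G.Adj p x ∨ ¬G.Adj q x ∨ ¬G.Adj r x := by
    intro x
    have := hk p q r x hpq hpr
    grind
  by_contra hno
  simp only [hno, imp_false] at s1 s2 s3 s4 s5 s6
  unfold AdjTwo at tp tq tr
  clear hsun hx
  rcases hmiss x₁ with h1 | h1 | h1 <;> rcases hmiss x₂ with h2 | h2 | h2 <;>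
    rcases hmiss x₃ with h3 | h3 | h3 <;> grind

namespace CriticalFour

/-- A set with two nonadjacent vertices cannot be complete to its neighbourhood if the latter is
independent. -/
theorem false_of_module (hG : G.CriticalFour) {Y W : Set V} {y z v : V} (hy : y ∈ Y) (hz : z ∈ Y)
    (hyz : y ≠ z) (nyz : ¬G.Adj y z) (hYW : ∀ u ∈ Y, ∀ w ∈ W, G.Adj u w)
    (hY : ∀ u ∈ Y, ∀ w, G.Adj u w → w ∈ Y ∨ w ∈ W) (hW : ∀ u ∈ W, ∀ w ∈ W, ¬G.Adj u w)
    (hv : v ∉ Y) : False := by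
  have hs : ∀ u v, G.Adj u v → G.Adj v u := fun u v => Adj.symm
  -- Along an edge outside `W`, neighbours in `W` are kept: otherwise a chair has centre `a`, leaves
  -- `y`, `z` and the path `a u w`.
  have claim : ∀ u w a, u ∉ W → w ∉ W → G.Adj u w → a ∈ W → G.Adj u a → G.Adj w a := by
    intro u w a hu hw huw ha hua
    by_cases huY : u ∈ Y
    · exact hYW w ((hY u huY w huw).resolve_right hw) a ha
    by_cases hwY : w ∈ Y
    · exact hYW w hwY a ha
    have h1 := hG.chair a y z u w
    have := hY y hy u
    have := hY z hz u
    have := hY y hy w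
    have := hY z hz w
    have := hYW y hy a ha
    have := hYW z hz a ha
    grind
  obtain rfl | ⟨a, ha⟩ := W.eq_empty_or_nonempty
  · have := hG.critical.eq_univ_of_closed ⟨y, hy⟩
      (fun u hu w huw => (hY u hu w huw).resolve_right (by simp))
    exact hv (this ▸ trivial)
  have huniv := hG.critical.eq_univ_of_closed (s := {u | u ∈ W ∨ ∃ a ∈ W, G.Adj u a})
    ⟨a, Or.inl ha⟩ (by
      rintro u hu w huw
      by_cases hw : w ∈ W
      · exact Or.inl hw
      by_cases huW : u ∈ W
      · exact Or.inr ⟨u, huW, huw.symm⟩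
      obtain ⟨a, ha, hua⟩ := hu.resolve_left huW
      exact Or.inr ⟨a, ha, claim u w a huW hw huw ha hua⟩)
  -- `W` dominates the graph, so a triangle that avoids `W` has a neighbour in `W`, which by `claim`
  -- is common to its three vertices.
  obtain ⟨u, v, w, hu, hv, hw, huv, huw, hvw⟩ := hG.stable W ⟨a, ha⟩ hW
  have hu' : u ∈ {u | u ∈ W ∨ ∃ a ∈ W, G.Adj u a} := huniv ▸ trivial
  obtain ⟨a, ha, hua⟩ := hu'.resolve_left hu
  exact hG.k4 u v w a huv huw hua hvw (claim u v a hu hv huv ha hua) (claim u w a hu hw huw ha hua)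

/-- `R` consists of the vertices remote from the triple and `Z` is a maximal independent subset of
it. The triple together with `Z` is independent, so some triangle avoids it; this triangle also
avoids `R`, and then each of its vertices has two neighbours in the triple. -/
theorem exists_sun [Finite V] (hG : G.CriticalFour) {x₁ x₂ x₃ : V} (hx : G.GoodTriple x₁ x₂ x₃) :
    ∃ m₁ m₂ m₃, G.Sun x₁ x₂ x₃ m₁ m₂ m₃ := by
  have hs : ∀ u v, G.Adj u v → G.Adj v u := fun u v => Adj.symm
  let R : Set V := {r | (¬G.Adj r x₁ ∧ r ≠ x₁) ∧ (¬G.Adj r x₂ ∧ r ≠ x₂) ∧ (¬G.Adj r x₃ ∧ r ≠ x₃)}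
  obtain ⟨Z, -, ⟨hZR, hZ⟩, hZmax⟩ := (Set.toFinite
    {Z : Set V | Z ⊆ R ∧ ∀ u ∈ Z, ∀ w ∈ Z, ¬G.Adj u w}).exists_le_maximal
    (a := ∅) ⟨by simp, by simp⟩
  have hmax : ∀ r ∈ R, r ∉ Z → ∃ z ∈ Z, G.Adj r z := by
    intro r hr hrZ
    by_contra! hno
    apply hrZ
    refine hZmax (y := insert r Z) ⟨Set.insert_subset hr hZR, ?_⟩ (Set.subset_insert r Z)
      (Set.mem_insert r Z)
    rintro u (rfl | hu) w (rfl | hw)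
    · exact G.loopless.irrefl _
    · exact hno w hw
    · exact fun h => hno u hu h.symm
    · exact hZ u hu w hw
  have htwo : ∀ n, n ∉ R → n ≠ x₁ → n ≠ x₂ → n ≠ x₃ → G.AdjTwo x₁ x₂ x₃ n := by
    intro n hn h1 h2 h3
    have := hx.adjTwo n
    simp only [R, Set.mem_ofPred_eq] at hn
    grind
  -- adjacent vertices of `R` have the same neighbours outside `R`
  have hprop : ∀ r ∈ R, ∀ r' ∈ R, G.Adj r r' → ∀ n, n ∉ R → G.Adj r n → G.Adj r' n := by
    intro r hr r' hr' hrr n hn hrn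
    have h1 := hG.chair n x₁ x₂ r r'
    have h2 := hG.chair n x₁ x₃ r r'
    have h3 := hG.chair n x₂ x₃ r r'
    have h4 := htwo n hn (fun h => hr.1.1 (h ▸ hrn)) (fun h => hr.2.1.1 (h ▸ hrn))
      (fun h => hr.2.2.1 (h ▸ hrn))
    obtain ⟨⟨_, _⟩, ⟨_, _⟩, ⟨_, _⟩⟩ := hr
    obtain ⟨⟨_, _⟩, ⟨_, _⟩, ⟨_, _⟩⟩ := hr'
    obtain ⟨_, _, _, _, _, _, -⟩ := hx
    clear htwo hmax hZ hZmax hZR hn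
    unfold AdjTwo at h4
    grind
  -- Let `z` in `Z` be a neighbour of `r`. The vertices of `R` with the same neighbours outside `R`
  -- as `r` form a module, so by `false_of_module` every neighbour of `r` outside `Z` is adjacent to
  -- `z`, and the triangle extends to a `K₄`.
  have hR : ∀ p q r, p ∉ Z → q ∉ Z → r ∉ Z → r ∈ R → G.Adj p q → G.Adj p r → G.Adj q r → False := by
    intro p q r hp hq hr hrR hpq hpr hqr
    obtain ⟨z, hz, hrz⟩ := hmax r hrR hr
    have hzR := hZR hz
    have hY : ∀ u ∈ {y | y ∈ R ∧ ∀ n, n ∉ R → (G.Adj y n ↔ G.Adj r n)}, ∀ w, G.Adj u w →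
        w ∈ {y | y ∈ R ∧ ∀ n, n ∉ R → (G.Adj y n ↔ G.Adj r n)} ∨ w ∈ {n | n ∉ R ∧ G.Adj r n} := by
      rintro u ⟨hu, hun⟩ w huw
      by_cases hw : w ∈ R
      · exact Or.inl ⟨hw, fun n hn => ⟨fun h => (hun n hn).1 (hprop w hw u hu huw.symm n hn h),
          fun h => hprop u hu w hw huw n hn ((hun n hn).2 h)⟩⟩
      · exact Or.inr ⟨hw, (hun w hw).1 huw⟩
    have hzY : z ∈ {y | y ∈ R ∧ ∀ n, n ∉ R → (G.Adj y n ↔ G.Adj r n)} :=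
      ⟨hzR, fun n hn => ⟨hprop z hzR r hrR hrz.symm n hn, hprop r hrR z hzR hrz n hn⟩⟩
    have hadj : ∀ p, p ∉ Z → G.Adj r p → G.Adj z p := by
      intro p hp hrp
      rcases hY r ⟨hrR, fun n hn => Iff.rfl⟩ p hrp with hpY | hpW
      · by_contra hzp
        refine hG.false_of_module (v := x₁) hpY hzY (fun h => hp (h ▸ hz)) (fun h => hzp h.symm)
          (W := {n | n ∉ R ∧ G.Adj r n}) (fun u hu w hw => (hu.2 w hw.1).2 hw.2) hY ?_
          (fun h => h.1.1.2 rfl)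
        exact fun u hu w hw huw => hG.k4 r z u w hrz hu.2 hw.2 ((hzY.2 u hu.1).2 hu.2)
          ((hzY.2 w hw.1).2 hw.2) huw
      · exact hprop r hrR z hzR hrz p hpW.1 hrp
    exact hG.k4 z p q r (hadj p hp hpr.symm) (hadj q hq hqr.symm) hrz.symm hpq hpr hqr
  obtain ⟨p, q, r, hp, hq, hr, hpq, hpr, hqr⟩ := hG.stable ({x₁, x₂, x₃} ∪ Z) ⟨x₁, by simp⟩ (by
    have h1 : ∀ u ∈ Z, ¬G.Adj u x₁ ∧ ¬G.Adj u x₂ ∧ ¬G.Adj u x₃ := fun u hu =>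
      ⟨(hZR hu).1.1, (hZR hu).2.1.1, (hZR hu).2.2.1⟩
    obtain ⟨_, _, _, _, _, _, -⟩ := hx
    have hirr : ∀ u, ¬G.Adj u u := G.loopless.irrefl
    simp only [Set.mem_union, Set.mem_insert_iff, Set.mem_singleton_iff]
    intro u hu w hw
    have := hZ u
    have := h1 u
    have := h1 w
    clear htwo hmax hZ hZmax hZR hprop hR
    grind)
  simp only [Set.mem_union, Set.mem_insert_iff, Set.mem_singleton_iff, not_or] at hp hq hr
  have tp := htwo p fun h => hR q r p hq.2 hr.2 hp.2 h hqr hpq.symm hpr.symm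
  have tq := htwo q fun h => hR p r q hp.2 hr.2 hq.2 h hpr hpq hqr.symm
  have tr := htwo r fun h => hR p q r hp.2 hq.2 hr.2 h hpq hpr hqr
  exact hx.exists_sun_of_adj hG.k4 (tp hp.1.1 hp.1.2.1 hp.1.2.2) (tq hq.1.1 hq.1.2.1 hq.1.2.2)
    (tr hr.1.1 hr.1.2.1 hr.1.2.2) hpq hpr hqr

/-- A good triple has no common neighbour. -/
theorem not_goodTriple [Finite V] (hG : G.CriticalFour) {a b c q : V} (hx : G.GoodTriple a b c)
    (ha : G.Adj q a) (hb : G.Adj q b) (hc : G.Adj q c) : False := by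
  obtain ⟨m₁, m₂, m₃, S⟩ := hG.exists_sun hx
  have h12 := hG.k4 q m₁ m₂ c
  have h13 := hG.k4 q m₁ m₃ b
  have h23 := hG.k4 q m₂ m₃ a
  have f0 := S.false_of_not_adj_m hG ha hb hc
  have f1 := S.perm₁₂.perm₂₃.false_of_adj_m₃ hG hb hc ha
  have f2 := S.perm₂₃.false_of_adj_m₃ hG ha hc hb
  have f3 := S.false_of_adj_m₃ hG ha hb hc
  obtain ⟨-, _, _, _, _, _, _, _, _, _, _, _, _⟩ := S
  by_cases G.Adj q m₁ <;> by_cases G.Adj q m₂ <;> by_cases G.Adj q m₃ <;> grind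

/-- Two adjacent vertices have at most two common neighbours. -/
theorem common_neighbors [Finite V] (hG : G.CriticalFour) {s a x y z : V} (hsa : G.Adj s a)
    (hsx : G.Adj s x) (hsy : G.Adj s y) (hsz : G.Adj s z) (hax : G.Adj a x) (hay : G.Adj a y)
    (haz : G.Adj a z) (hxy : x ≠ y) (hxz : x ≠ z) (hyz : y ≠ z) : False := by
  have nxy := fun h => hG.k4 s a x y hsa hsx hsy hax hay h
  have nxz := fun h => hG.k4 s a x z hsa hsx hsz hax haz h
  have nyz := fun h => hG.k4 s a y z hsa hsy hsz hay haz h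
  -- A vertex `u` adjacent to exactly one of `x`, `y`, `z` would end a chair centred at `s` or at
  -- `a`, unless it is adjacent to both, which would give a `K₄`.
  refine hG.not_goodTriple ⟨hxy, hxz, hyz, nxy, nxz, nyz, fun u hu => ?_⟩ hsx hsy hsz
  have hs : ∀ u v, G.Adj u v → G.Adj v u := fun u v => Adj.symm
  have := hG.chair s y z x u
  have := hG.chair a y z x u
  have := hG.k4 s a x u
  have := hG.chair s x z y u
  have := hG.chair a x z y u
  have := hG.k4 s a y u
  have := hG.chair s x y z u
  have := hG.chair a x y z u
  have := hG.k4 s a z u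
  unfold AdjTwo
  by_cases G.Adj s u <;> by_cases G.Adj a u <;> grind

end CriticalFour

/-! ### Clique number three: there is no claw -/

theorem Critical.exists_adj_ne (h : G.Critical 4) (v p q r : V) :
    ∃ n, G.Adj v n ∧ n ≠ p ∧ n ≠ q ∧ n ≠ r := by
  classical
  by_contra! hno
  have h1 := h.le_card (v := v) (t := {p, q, r}) (fun n hn => by
    have := hno n hn
    simp only [Finset.mem_insert, Finset.mem_singleton]
    tauto)
  have h2 := Finset.card_le_three (a := p) (b := q) (c := r)
  omega

/-- `w` is the only neighbour of `x` that is neither equal nor adjacent to `v`. -/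
def UniqueOuter (G : SimpleGraph V) (v x w : V) : Prop :=
  ¬G.Adj v w ∧ w ≠ v ∧ G.Adj x w ∧ ∀ z, G.Adj x z → ¬G.Adj v z → z ≠ v → z = w

/-- `a`, `b`, `c` are independent neighbours of `v`, and another neighbour `y` of `v` is
adjacent to `a` only. -/
def OddTriple (G : SimpleGraph V) (v a b c y : V) : Prop :=
  (G.Adj v a ∧ G.Adj v b ∧ G.Adj v c ∧ G.Adj v y) ∧ (a ≠ b ∧ a ≠ c ∧ b ≠ c) ∧
    (¬G.Adj a b ∧ ¬G.Adj a c ∧ ¬G.Adj b c) ∧ G.Adj y a ∧ ¬G.Adj y b ∧ ¬G.Adj y c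

theorem OddTriple.symm {v a b c y : V} (h : G.OddTriple v a b c y) : G.OddTriple v a c b y := by
  have := fun h : G.Adj c b => h.symm
  unfold OddTriple at *
  grind

theorem OddTriple.swap {v a b c y : V} (h : G.OddTriple v a b c y) : G.OddTriple v y b c a := by
  have hs : ∀ u v, G.Adj u v → G.Adj v u := fun u v => Adj.symm
  unfold OddTriple at *
  grind

namespace CriticalFour

variable [Finite V] (hG : G.CriticalFour)
include hG

/-- Otherwise the neighbours of `x` other than `v`, of which there are at least three, would all be
common neighbours of `v` and `x`. -/
theorem exists_outer {v x : V} (hx : G.Adj v x) : ∃ z, G.Adj x z ∧ ¬G.Adj v z ∧ z ≠ v := by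
  by_contra! hno
  obtain ⟨p, h1, h2, -, -⟩ := hG.critical.exists_adj_ne x v v v
  obtain ⟨q, h3, h4, h5, -⟩ := hG.critical.exists_adj_ne x v p p
  obtain ⟨r, h6, h7, h8, h9⟩ := hG.critical.exists_adj_ne x v p q
  have h10 : G.Adj v p := by_contra fun h => h2 (hno p h1 h)
  have h11 : G.Adj v q := by_contra fun h => h4 (hno q h3 h)
  have h12 : G.Adj v r := by_contra fun h => h7 (hno r h6 h)
  exact hG.common_neighbors hx h10 h11 h12 h1 h3 h6 h5.symm h8.symm h9.symm

/-- The leaves of a claw are not a good triple, since `v` is a common neighbour. The vertex that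
sees exactly one of them must be adjacent to `v`, as otherwise it ends a chair. -/
theorem exists_oddTriple {v a b c : V} (ha : G.Adj v a) (hb : G.Adj v b) (hc : G.Adj v c)
    (hab : a ≠ b) (hac : a ≠ c) (hbc : b ≠ c) (nab : ¬G.Adj a b) (nac : ¬G.Adj a c)
    (nbc : ¬G.Adj b c) : ∃ y, G.OddTriple v a b c y ∨ G.OddTriple v b a c y ∨
      G.OddTriple v c a b y := by
  have hs : ∀ u v, G.Adj u v → G.Adj v u := fun u v => Adj.symm
  by_contra! hno
  refine hG.not_goodTriple ⟨hab, hac, hbc, nab, nac, nbc, fun u hu => ?_⟩ ha hb hc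
  have h1 := hG.chair v b c a u
  have h2 := hG.chair v a c b u
  have h3 := hG.chair v a b c u
  have h4 := hno u
  unfold OddTriple at h4
  unfold AdjTwo
  by_cases G.Adj v u <;> grind

omit [Finite V] in
theorem adj_of_oddTriple {v a b c y z : V} (h : G.OddTriple v a b c y) (hza : G.Adj a z)
    (hzv : ¬G.Adj v z) : G.Adj y z := by
  have hs : ∀ u v, G.Adj u v → G.Adj v u := fun u v => Adj.symm
  unfold OddTriple at h
  have := hG.chair v b c a z
  have := hG.chair v y c b z
  have := hG.chair v y b c z
  have := hG.chair z b c a y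
  by_cases G.Adj b z <;> by_cases G.Adj c z <;> grind +splitImp

/-- The adjacent vertices `a` and `y` have the same neighbours outside the closed neighbourhood of
`v`. As `v` is already common to them, two such neighbours would make three. Degree at least four
then provides `y₂`. -/
theorem uniqueOuter_of_oddTriple {v a b c y : V} (h : G.OddTriple v a b c y) :
    ∃ w y₂, G.UniqueOuter v a w ∧ G.UniqueOuter v y w ∧ G.Adj v y₂ ∧ G.Adj a y₂ ∧ y₂ ≠ y := by
  have hs : ∀ u v, G.Adj u v → G.Adj v u := fun u v => Adj.symm
  have hay := fun z => hG.adj_of_oddTriple (z := z) h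
  have hya := fun z => hG.adj_of_oddTriple (z := z) h.swap
  obtain ⟨w, haw, hvw, hwv⟩ := hG.exists_outer h.1.1
  have huniq : ∀ z, G.Adj a z → ¬G.Adj v z → z ≠ v → z = w := by
    intro z haz hvz hz
    by_contra hzw
    have := hay z haz hvz
    have := hay w haw hvw
    unfold OddTriple at h
    exact hG.common_neighbors (s := a) (a := y) (x := v) (y := z) (z := w) (by grind) (by grind)
      haz haw (by grind) (by grind) (by grind) hz.symm hwv.symm hzw
  obtain ⟨y₂, h1, h2, h3, h4⟩ := hG.critical.exists_adj_ne a v w y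
  refine ⟨w, y₂, ⟨hvw, hwv, haw, huniq⟩, ⟨hvw, hwv, hay w haw hvw, fun z hyz hvz hz =>
    huniq z (hya z hyz hvz) hvz hz⟩, ?_, h1, h4⟩
  by_contra hv
  exact h3 (huniq y₂ h1 hv h2)

theorem adj_xor_of_oddTriple {v a b c y y₂ z : V} (h : G.OddTriple v a b c y)
    (hy₂ : G.Adj v y₂ ∧ G.Adj a y₂ ∧ y₂ ≠ y) (hvz : ¬G.Adj v z) (hza : ¬G.Adj a z)
    (hzy : ¬G.Adj y z) (hzb : G.Adj b z) (hzc : G.Adj c z) :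
    G.Adj y₂ z ∧ (G.Adj b y₂ ∧ ¬G.Adj c y₂ ∨ ¬G.Adj b y₂ ∧ G.Adj c y₂) := by
  have hs : ∀ u v, G.Adj u v → G.Adj v u := fun u v => Adj.symm
  unfold OddTriple at h
  have := hG.k4 v a y y₂
  have h1 : ¬(G.Adj b y₂ ∧ G.Adj c y₂) := fun ⟨h1, h2⟩ =>
    hG.common_neighbors (s := v) (a := y₂) (x := a) (y := b) (z := c) hy₂.1 (by grind) (by grind)
      (by grind) (by grind) (by grind) (by grind) (by grind) (by grind) (by grind)
  have := hG.chair v y₂ y b z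
  have := hG.chair v y₂ y c z
  have := hG.chair z b c y₂ a
  by_cases G.Adj b y₂ <;> by_cases G.Adj c y₂ <;> by_cases G.Adj y₂ z <;> grind +splitImp

theorem oddTriple_false_of_same {v a b c y y₂ y₃ w z : V} (h : G.OddTriple v a b c y)
    (hvw : ¬G.Adj v w) (hw : w ≠ v) (haw : G.Adj a w)
    (hy₂ : G.Adj v y₂ ∧ G.Adj a y₂ ∧ y₂ ≠ y) (hy₃ : G.Adj v y₃ ∧ G.Adj y y₃ ∧ y₃ ≠ a)
    (hvz : ¬G.Adj v z) (hz : z ≠ v) (hzw : z ≠ w) (hzb : G.Adj b z)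
    (h2z : G.Adj y₂ z) (h3z : G.Adj y₃ z)
    (h2b : G.Adj b y₂) (h2c : ¬G.Adj c y₂) (h3b : G.Adj b y₃) (h3c : ¬G.Adj c y₃) : False := by
  have hs : ∀ u v, G.Adj u v → G.Adj v u := fun u v => Adj.symm
  have k1 := hG.k4 v a y y₂
  have k2 := hG.k4 v a y y₃
  have k3 := hG.k4 v b y₂ y₃
  have h1 : G.OddTriple v y₂ y c b := by
    unfold OddTriple at *
    grind
  have h2 : G.OddTriple v y₃ a c b := by
    unfold OddTriple at *
    grind
  obtain ⟨w₁, _, ⟨-, -, -, u1⟩, ⟨-, -, -, u2⟩, -⟩ := hG.uniqueOuter_of_oddTriple h1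
  obtain ⟨w₂, _, ⟨-, -, -, u3⟩, -, -⟩ := hG.uniqueOuter_of_oddTriple h2
  have := u1 z h2z hvz hz
  have := u2 z hzb hvz hz
  have := u3 z h3z hvz hz
  have : ¬G.Adj y₂ w := fun h => by grind
  have : ¬G.Adj b w := fun h => by grind
  have : ¬G.Adj y₃ w := fun h => by grind
  have := hG.chair v y₃ c a w
  have := hG.chair v y₂ y₃ c w
  clear u1 u2 u3
  unfold OddTriple at *
  grind +splitImp

theorem oddTriple_false_of_different {v a b c y y₂ y₃ w z : V} (h : G.OddTriple v a b c y)
    (hvw : ¬G.Adj v w) (hw : w ≠ v) (haw : G.Adj a w)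
    (hy₂ : G.Adj v y₂ ∧ G.Adj a y₂ ∧ y₂ ≠ y) (hy₃ : G.Adj v y₃ ∧ G.Adj y y₃ ∧ y₃ ≠ a)
    (hvz : ¬G.Adj v z) (hz : z ≠ v) (hzw : z ≠ w) (hzb : G.Adj b z)
    (h3z : G.Adj y₃ z)
    (h2b : G.Adj b y₂) (h2c : ¬G.Adj c y₂) (h3b : ¬G.Adj b y₃) (h3c : G.Adj c y₃) : False := by
  have hs : ∀ u v, G.Adj u v → G.Adj v u := fun u v => Adj.symm
  have k1 := hG.k4 v a y y₂
  have k2 := hG.k4 v a y y₃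
  have h1 : G.OddTriple v y₂ y c b := by
    unfold OddTriple at *
    grind
  have h2 : G.OddTriple v y₃ a b c := by
    unfold OddTriple at *
    grind
  obtain ⟨w₁, _, -, ⟨-, -, -, u2⟩, -⟩ := hG.uniqueOuter_of_oddTriple h1
  obtain ⟨w₂, _, ⟨-, -, -, u3⟩, -, -⟩ := hG.uniqueOuter_of_oddTriple h2
  have := u2 z hzb hvz hz
  have := u3 z h3z hvz hz
  have : ¬G.Adj b w := fun h => by grind
  have : ¬G.Adj y₃ w := fun h => by grind
  have := hG.chair v b y₃ a w
  clear u2 u3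
  unfold OddTriple at *
  grind +splitImp

/-- A second outer neighbour `z` of `b` is also adjacent to `c`, by a chair at `v`. The further
neighbours `y₂` of `a` and `y₃` of `y` both see `z` and exactly one of `b`, `c`; the same choice and
different choices both lead to new odd triples whose unique outer neighbours conflict. -/
theorem outer_eq_of_oddTriple {v a b c y w z : V} (h : G.OddTriple v a b c y)
    (ha : G.UniqueOuter v a w) (hzb : G.Adj b z) (hvz : ¬G.Adj v z) (hz : z ≠ v) : z = w := by
  have hs : ∀ u v, G.Adj u v → G.Adj v u := fun u v => Adj.symm
  by_contra hzw
  obtain ⟨w₁, y₂, -, ⟨-, -, h1, h2⟩, hy₂⟩ := hG.uniqueOuter_of_oddTriple h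
  obtain ⟨w₂, y₃, -, -, hy₃⟩ := hG.uniqueOuter_of_oddTriple h.swap
  obtain ⟨hvw, hwv, haw, hu⟩ := ha
  have hza : ¬G.Adj a z := fun haz => hzw (hu z haz hvz hz)
  have hzy : ¬G.Adj y z := fun hyz => hza (hG.adj_of_oddTriple h.swap hyz hvz)
  have hzc : G.Adj c z := by
    have := hG.chair v a c b z
    clear h1 h2 hu
    unfold OddTriple at h
    grind
  obtain ⟨h2z, h2⟩ := hG.adj_xor_of_oddTriple h hy₂ hvz hza hzy hzb hzc
  obtain ⟨h3z, h3⟩ := hG.adj_xor_of_oddTriple h.swap hy₃ hvz hzy hza hzb hzc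
  rcases h2 with h2 | h2 <;> rcases h3 with h3 | h3
  · exact hG.oddTriple_false_of_same h hvw hwv haw hy₂ hy₃ hvz hz hzw hzb h2z h3z h2.1 h2.2
      h3.1 h3.2
  · exact hG.oddTriple_false_of_different h hvw hwv haw hy₂ hy₃ hvz hz hzw hzb h3z h2.1 h2.2
      h3.1 h3.2
  · exact hG.oddTriple_false_of_different h.symm hvw hwv haw hy₂ hy₃ hvz hz hzw hzc h3z h2.2
      h2.1 h3.2 h3.1
  · exact hG.oddTriple_false_of_same h.symm hvw hwv haw hy₂ hy₃ hvz hz hzw hzc h2z h3z h2.2 h2.1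
      h3.2 h3.1

theorem exists_uniqueOuter_of_oddTriple {v a b c y : V} (h : G.OddTriple v a b c y) :
    ∃ w, G.UniqueOuter v a w ∧ G.UniqueOuter v b w ∧ G.UniqueOuter v c w := by
  obtain ⟨w, -, ha, -, -⟩ := hG.uniqueOuter_of_oddTriple h
  have key : ∀ {b c}, G.OddTriple v a b c y → G.UniqueOuter v b w := by
    intro b c h
    have huniq := fun z hbz hvz hz => hG.outer_eq_of_oddTriple (z := z) h ha hbz hvz hz
    obtain ⟨z, hbz, hvz, hz⟩ := hG.exists_outer h.1.2.1
    exact ⟨ha.1, ha.2.1, huniq z hbz hvz hz ▸ hbz, huniq⟩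
  exact ⟨w, ha, key h, key h.symm⟩

theorem exists_uniqueOuter {v a b c : V} (ha : G.Adj v a) (hb : G.Adj v b) (hc : G.Adj v c)
    (hab : a ≠ b) (hac : a ≠ c) (hbc : b ≠ c) (nab : ¬G.Adj a b) (nac : ¬G.Adj a c)
    (nbc : ¬G.Adj b c) :
    ∃ w, G.UniqueOuter v a w ∧ G.UniqueOuter v b w ∧ G.UniqueOuter v c w := by
  obtain ⟨y, h | h | h⟩ := hG.exists_oddTriple ha hb hc hab hac hbc nab nac nbc <;>
  · obtain ⟨w, h1, h2, h3⟩ := hG.exists_uniqueOuter_of_oddTriple h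
    exact ⟨w, by assumption, by assumption, by assumption⟩

end CriticalFour

theorem UniqueOuter.eq {v x w w' : V} (h : G.UniqueOuter v x w) (h' : G.UniqueOuter v x w') :
    w' = w := h.2.2.2 w' h'.2.2.1 h'.1 h'.2.1

namespace CriticalFour

variable [Finite V] (hG : G.CriticalFour)
include hG

theorem adj_of_uniqueOuter {v a b x w : V} (ha : G.Adj v a) (hb : G.Adj v b) (hx : G.Adj v x)
    (hab : a ≠ b) (hxa : x ≠ a) (hxb : x ≠ b) (nab : ¬G.Adj a b) (nxa : ¬G.Adj x a)
    (nxb : ¬G.Adj x b) (hw : G.UniqueOuter v a w) : G.UniqueOuter v x w := by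
  obtain ⟨w', h1, h2, -⟩ := hG.exists_uniqueOuter hx ha hb hxa hxb hab nxa nxb nab
  exact hw.eq h2 ▸ h1

/-- Since `w` is the only outer neighbour of `c`, degree four gives `c` two neighbours `c₁`, `c₂` in
the neighbourhood of `v`, and `x`, `c₁`, `c₂` are the leaves of another claw. If `c₁` or `c₂` misses
`a` and `b`, it links the two claws. Otherwise the bound on common neighbours leaves no room for the
vertex that makes `a`, `b`, `c` an odd triple. -/
theorem adj_of_uniqueOuter_of_adj {v a b c x w : V} (ha : G.Adj v a) (hb : G.Adj v b)
    (hc : G.Adj v c) (hx : G.Adj v x) (hab : a ≠ b) (hac : a ≠ c) (hbc : b ≠ c) (nab : ¬G.Adj a b)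
    (nac : ¬G.Adj a c) (nbc : ¬G.Adj b c) (hxa : G.Adj x a) (hxb : G.Adj x b)
    (hw : G.UniqueOuter v a w) (hwc : G.UniqueOuter v c w) : G.UniqueOuter v x w := by
  have hs : ∀ u v, G.Adj u v → G.Adj v u := fun u v => Adj.symm
  have h3 : ∀ y p q r, G.Adj v y → G.Adj v p → G.Adj v q → G.Adj v r → G.Adj y p → G.Adj y q →
      G.Adj y r → p ≠ q → p ≠ r → q ≠ r → False :=
    fun y p q r h1 h2 h3 h4 h5 h6 h7 h8 h9 h10 =>
      hG.common_neighbors h1 h2 h3 h4 h5 h6 h7 h8 h9 h10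
  have hxc : ¬G.Adj x c := fun h => h3 x a b c hx ha hb hc hxa hxb h hab hac hbc
  obtain ⟨c₁, hc1, h1v, h1w, -⟩ := hG.critical.exists_adj_ne c v w w
  obtain ⟨c₂, hc2, h2v, h2w, h12⟩ := hG.critical.exists_adj_ne c v w c₁
  have hv1 : G.Adj v c₁ := by_contra fun h => h1w (hwc.2.2.2 c₁ hc1 h h1v)
  have hv2 : G.Adj v c₂ := by_contra fun h => h2w (hwc.2.2.2 c₂ hc2 h h2v)
  have n12 : ¬G.Adj c₁ c₂ := fun h => hG.k4 v c c₁ c₂ hc hv1 hv2 hc1 hc2 h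
  have hne : c₁ ≠ a ∧ c₁ ≠ b ∧ c₂ ≠ a ∧ c₂ ≠ b ∧ x ≠ c₁ ∧ x ≠ c₂ := by
    refine ⟨?_, ?_, ?_, ?_, ?_, ?_⟩ <;> rintro rfl <;> grind
  obtain ⟨_, _, _, _, _, _⟩ := hne
  have nx1 : ¬G.Adj x c₁ := fun h => h3 x a b c₁ hx ha hb hv1 hxa hxb h hab (by grind) (by grind)
  have nx2 : ¬G.Adj x c₂ := fun h => h3 x a b c₂ hx ha hb hv2 hxa hxb h hab (by grind) (by grind)
  obtain ⟨w', hx', h1', h2'⟩ := hG.exists_uniqueOuter hx hv1 hv2 (by grind) (by grind) h12.symm nx1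
    nx2 n12
  have hfin : ∀ d, G.Adj v d → d ≠ a → d ≠ b → ¬G.Adj d a → ¬G.Adj d b → G.UniqueOuter v d w' →
      G.UniqueOuter v x w := by
    intro d hd hda hdb nda ndb hdw
    have := hG.adj_of_uniqueOuter ha hb hd hab hda hdb nab nda ndb hw
    exact hdw.eq this ▸ hx'
  by_cases h1 : ¬G.Adj c₁ a ∧ ¬G.Adj c₁ b
  · exact hfin c₁ hv1 (by grind) (by grind) h1.1 h1.2 h1'
  by_cases h2 : ¬G.Adj c₂ a ∧ ¬G.Adj c₂ b
  · exact hfin c₂ hv2 (by grind) (by grind) h2.1 h2.2 h2'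
  exfalso
  have e1 := h3 a x c₁ c₂ ha hx hv1 hv2
  have e2 := h3 b x c₁ c₂ hb hx hv1 hv2
  obtain ⟨y, hy⟩ := hG.exists_oddTriple ha hb hc hab hac hbc nab nac nbc
  have a1 := h3 a x c₁ y ha hx hv1
  have a2 := h3 a x c₂ y ha hx hv2
  have b1 := h3 b x c₁ y hb hx hv1
  have b2 := h3 b x c₂ y hb hx hv2
  have d := h3 c c₁ c₂ y hc hv1 hv2
  unfold OddTriple at hy
  clear hfin h3 hw hwc hx' h1' h2'
  by_cases G.Adj c₁ a <;> by_cases G.Adj c₂ a <;> by_cases G.Adj c₁ b <;> by_cases G.Adj c₂ b <;>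
    rcases hy with hy | hy | hy <;> grind +splitImp

/-- Every neighbour of `v` turns out to be adjacent to the common outer vertex `w`, so the
neighbourhood of `v` lies in that of `w`, against criticality. -/
theorem not_claw {v a b c : V} (ha : G.Adj v a) (hb : G.Adj v b) (hc : G.Adj v c) (hab : a ≠ b)
    (hac : a ≠ c) (hbc : b ≠ c) (nab : ¬G.Adj a b) (nac : ¬G.Adj a c) (nbc : ¬G.Adj b c) :
    False := by
  obtain ⟨w, hwa, hwb, hwc⟩ := hG.exists_uniqueOuter ha hb hc hab hac hbc nab nac nbc
  obtain ⟨x, hx, hwx⟩ := hG.critical.exists_adj_not_adj hwa.2.1.symm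
  suffices G.UniqueOuter v x w from hwx this.2.2.1.symm
  have nba := mt Adj.symm nab
  have nca := mt Adj.symm nac
  have ncb := mt Adj.symm nbc
  by_cases hxa : x = a
  · exact hxa ▸ hwa
  by_cases hxb : x = b
  · exact hxb ▸ hwb
  by_cases hxc : x = c
  · exact hxc ▸ hwc
  by_cases h1 : G.Adj x a <;> by_cases h2 : G.Adj x b <;> by_cases h3 : G.Adj x c
  · exact (hG.common_neighbors hx ha hb hc h1 h2 h3 hab hac hbc).elim
  · exact hG.adj_of_uniqueOuter_of_adj ha hb hc hx hab hac hbc nab nac nbc h1 h2 hwa hwc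
  · exact hG.adj_of_uniqueOuter_of_adj ha hc hb hx hac hab hbc.symm nac nab ncb h1 h3 hwa hwb
  · exact hG.adj_of_uniqueOuter hb hc hx hbc hxb hxc nbc h2 h3 hwb
  · exact hG.adj_of_uniqueOuter_of_adj hb hc ha hx hbc hab.symm hac.symm nbc nba nca h2 h3 hwb hwa
  · exact hG.adj_of_uniqueOuter ha hc hx hac hxa hxc nac h1 h3 hwa
  · exact hG.adj_of_uniqueOuter ha hb hx hab hxa hxb nab h1 h2 hwa
  · exact hG.adj_of_uniqueOuter ha hb hx hab hxa hxb nab h1 h2 hwa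

end CriticalFour

/-! ### Kempe chains around an uncoloured vertex -/

theorem Reachable.mem_of_closed {H : SimpleGraph V} {s : Set V} {u w : V} (h : H.Reachable u w)
    (hu : u ∈ s) (hs : ∀ x ∈ s, ∀ y, H.Adj x y → y ∈ s) : w ∈ s := by
  obtain ⟨p⟩ := h
  induction p with
  | nil => exact hu
  | cons hadj p ih => exact ih (hs _ hu _ hadj)

/-- Move the uncoloured vertex from `v` to its only neighbour of the colour of `c`. -/
theorem ColorsOn.move [DecidableEq V] {k : ℕ} {f : V → ℕ} {v c : V} (hf : G.ColorsOn {v}ᶜ k f)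
    (hvc : G.Adj v c) (hc : ∀ n, G.Adj v n → f n = f c → n = c) :
    G.ColorsOn {c}ᶜ k (Function.update f v (f c)) := by
  refine ((hf.mono (s := {v, c}ᶜ) (by simp) le_rfl).update_insert (v := v)
    (hf.1 c hvc.ne') fun n hn _ hvn hfn => hn (Or.inr (hc n hvn hfn))).mono ?_ le_rfl
  intro x hx
  by_cases hxv : x = v <;> simp_all

/-- Otherwise an exchange on the chain of `b` leaves no neighbour of `v` with the colour of `b`. -/
theorem Critical.kempe_reachable {k : ℕ} (h : G.Critical k) {f : V → ℕ} {v b c : V}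
    (hf : G.ColorsOn {v}ᶜ k f) (hvb : G.Adj v b) (hvc : G.Adj v c)
    (hb : ∀ n, G.Adj v n → f n = f b → n = b) (hc : ∀ n, G.Adj v n → f n = f c → n = c)
    (hbc : f b ≠ f c) : (G.kempe {v}ᶜ f (f b) (f c)).Reachable b c := by
  by_contra hr
  obtain ⟨n, hvn, hn⟩ := h.exists_adj_color
    (hf.kempeSwap (hf.1 b hvb.ne') (hf.1 c hvc.ne') b) (hf.1 b hvb.ne')
  by_cases hnb : n = b
  · subst hnb
    rw [kempeSwap_self, Equiv.swap_apply_left] at hn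
    exact hbc hn.symm
  by_cases hnc : n = c
  · subst hnc
    rw [kempeSwap_of_not_reachable hr] at hn
    exact hbc hn.symm
  rw [kempeSwap_of_ne (fun h => hnb (hb n hvn h)) (fun h => hnc (hc n hvn h))] at hn
  exact hnb (hb n hvn hn)

/-- Otherwise exchange on the chain of `r`. As `a` has no coloured neighbours of these two colours
except possibly `b` and `r`, the colour of `r` becomes free at `a`; recolouring `a` frees its old
colour at `v`. -/
theorem Critical.kempe_reachable_of_adj {k : ℕ} (h : G.Critical k) {f : V → ℕ} {v a b r : V}
    (hf : G.ColorsOn {v}ᶜ k f) (hva : G.Adj v a) (hvb : G.Adj v b) (hr : r ≠ v)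
    (ha : ∀ n, G.Adj v n → f n = f a → n = a) (hab : f a ≠ f b) (har : f a ≠ f r)
    (hfr : f b ≠ f r)
    (hanb : ∀ n, n ≠ v → G.Adj a n → f n = f b → n = b)
    (hanr : ∀ n, n ≠ v → G.Adj a n → f n = f r → n = r) :
    (G.kempe {v}ᶜ f (f b) (f r)).Reachable b r := by
  classical
  by_contra hbr
  have hg := hf.kempeSwap (hf.1 b hvb.ne') (hf.1 r hr) r
  have hbr' : ¬(G.kempe {v}ᶜ f (f b) (f r)).Reachable r b := fun h => hbr h.symm
  have hga : G.kempeSwap {v}ᶜ f (f b) (f r) r a = f a := kempeSwap_of_ne hab har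
  have hupd : ∀ n ∈ ({v}ᶜ : Set V), G.Adj a n → G.kempeSwap {v}ᶜ f (f b) (f r) r n ≠ f r := by
    intro n hnv han hn
    unfold kempeSwap at hn
    split_ifs at hn with hrn
    · rw [Equiv.swap_apply_def] at hn
      split_ifs at hn with h1 h2
      · exact hbr' (hanb n hnv han h1 ▸ hrn)
      · exact hfr hn
      · exact h2 hn
    · obtain rfl := hanr n hnv han hn
      exact hrn (Reachable.refl _)
  obtain ⟨n, hvn, hn⟩ := h.exists_adj_color (hg.update (v := a) (hf.1 r hr) hupd)
    (hf.1 a hva.ne')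
  by_cases hna : n = a
  · subst hna
    simp at hn
    exact har hn.symm
  · simp only [ne_eq, hna, not_false_eq_true, Function.update_of_ne] at hn
    unfold kempeSwap at hn
    split_ifs at hn with hrn
    · rw [Equiv.swap_apply_def] at hn
      split_ifs at hn
      · exact har hn.symm
      · exact hab hn.symm
      · exact hna (ha n hvn hn)
    · exact hna (ha n hvn hn)

/-! ### Clique number three: degrees and neighbourhoods -/

namespace CriticalFour

variable [Finite V] (hG : G.CriticalFour)
include hG

theorem eq_of_adj {v x p q r : V} (hx : G.Adj v x) (hp : G.Adj v p) (hq : G.Adj v q)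
    (hr : G.Adj v r) (hxp : G.Adj x p) (hxq : G.Adj x q) (hxr : G.Adj x r) :
    p = q ∨ p = r ∨ q = r := by
  by_contra! h
  exact hG.common_neighbors hx hp hq hr hxp hxq hxr h.1 h.2.1 h.2.2

theorem eq_of_not_adj {v x p q r : V} (hx : G.Adj v x) (hp : G.Adj v p) (hq : G.Adj v q)
    (hr : G.Adj v r) (nxp : ¬G.Adj x p) (nxq : ¬G.Adj x q) (nxr : ¬G.Adj x r) (hpx : x ≠ p)
    (hqx : x ≠ q) (hrx : x ≠ r) : p = q ∨ p = r ∨ q = r := by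
  by_contra! h
  have h1 : G.Adj p q := by_contra fun h1 => hG.not_claw hx hp hq hpx hqx h.1 nxp nxq h1
  have h2 : G.Adj p r := by_contra fun h1 => hG.not_claw hx hp hr hpx hrx h.2.1 nxp nxr h1
  have h3 : G.Adj q r := by_contra fun h1 => hG.not_claw hx hq hr hqx hrx h.2.2 nxq nxr h1
  exact hG.k4 v p q r hp hq hr h1 h2 h3

theorem adj_or_adj_or_eq {v x p q r : V} (hx : G.Adj v x) (hp : G.Adj v p) (hq : G.Adj v q)
    (hr : G.Adj v r) : G.Adj x p ∨ G.Adj x q ∨ G.Adj x r ∨ x = p ∨ x = q ∨ x = r ∨ p = q ∨ p = r ∨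
      q = r := by
  by_contra! h
  have := hG.eq_of_not_adj hx hp hq hr
  tauto

/-- A vertex has degree at most five. -/
theorem mem_of_five {v a b c d e : V} (ha : G.Adj v a) (hb : G.Adj v b) (hc : G.Adj v c)
    (hd : G.Adj v d) (he : G.Adj v e) (hab : a ≠ b) (hac : a ≠ c) (had : a ≠ d) (hae : a ≠ e)
    (hbc : b ≠ c) (hbd : b ≠ d) (hbe : b ≠ e) (hcd : c ≠ d) (hce : c ≠ e) (hde : d ≠ e) {n : V}
    (hn : G.Adj v n) : n = a ∨ n = b ∨ n = c ∨ n = d ∨ n = e := by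
  by_contra! h
  have h1 := fun p q r hp hq hr => hG.eq_of_adj (p := p) (q := q) (r := r) hn hp hq hr
  have h2 := fun p q r hp hq hr => hG.eq_of_not_adj (p := p) (q := q) (r := r) hn hp hq hr
  have s1 := h1 a b c ha hb hc
  have s2 := h1 a b d ha hb hd
  have s3 := h1 a b e ha hb he
  have s4 := h1 a c d ha hc hd
  have s5 := h1 a c e ha hc he
  have s6 := h1 a d e ha hd he
  have s7 := h1 b c d hb hc hd
  have s8 := h1 b c e hb hc he
  have s9 := h1 b d e hb hd he
  have s10 := h1 c d e hc hd he
  have t1 := h2 a b c ha hb hc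
  have t2 := h2 a b d ha hb hd
  have t3 := h2 a b e ha hb he
  have t4 := h2 a c d ha hc hd
  have t5 := h2 a c e ha hc he
  have t6 := h2 a d e ha hd he
  have t7 := h2 b c d hb hc hd
  have t8 := h2 b c e hb hc he
  have t9 := h2 b d e hb hd he
  have t10 := h2 c d e hc hd he
  clear h1 h2
  simp only [hab, hac, had, hae, hbc, hbd, hbe, hcd, hce, hde, or_self, imp_false, ne_eq, h.1,
    h.2.1, h.2.2.1, h.2.2.2.1, h.2.2.2.2, not_false_eq_true, not_true_eq_false] at *
  by_cases G.Adj n a <;> by_cases G.Adj n b <;> by_cases G.Adj n c <;> by_cases G.Adj n d <;>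
    by_cases G.Adj n e <;> simp_all

/-- If `b` and `r` were not adjacent, then `b`, `c` and `r` would be three ends of one Kempe chain.
Claw-freeness gives degrees at most two, and degree at most one where a neighbour off the chain (`v`
for `b` and `c`, `a` for `r`) misses the chain neighbours. -/
theorem adj_of_kempe {f : V → ℕ} {v a b c r : V} (hf : G.ColorsOn {v}ᶜ 4 f) (hva : G.Adj v a)
    (hvb : G.Adj v b) (hvc : G.Adj v c) (ha : ∀ n, G.Adj v n → f n = f a → n = a)
    (hb : ∀ n, G.Adj v n → f n = f b → n = b) (hc : ∀ n, G.Adj v n → f n = f c → n = c)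
    (hab : f a ≠ f b) (hac : f a ≠ f c) (hbc : f b ≠ f c) (nbc : ¬G.Adj b c) (hrv : r ≠ v)
    (nvr : ¬G.Adj v r) (har : G.Adj a r) (hfr : f r = f c)
    (hanb : ∀ n, n ≠ v → G.Adj a n → f n = f b → n = b)
    (hanr : ∀ n, n ≠ v → G.Adj a n → f n = f c → n = r) : G.Adj b r := by
  by_contra nbr
  have h1 := hG.critical.kempe_reachable hf hvb hvc hb hc hbc
  have h2 := hG.critical.kempe_reachable_of_adj hf hva hvb hrv ha hab (hfr ▸ hac) (hfr ▸ hbc) hanb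
    (hfr ▸ hanr)
  rw [hfr] at h2
  have hne : ∀ x y, x ≠ v → y ≠ v → f x = f y → ¬G.Adj x y := fun x y hx hy h hxy =>
    hf.2 x hx y hy hxy h
  refine not_three_ends (H := G.kempe {v}ᶜ f (f b) (f c)) ?_ (a := b) (b := c) (c := r) ?_ ?_ ?_ h1
    h2 ?_ ?_ ?_
  · rintro u x y z ⟨hux, huv, hxv, hx⟩ ⟨huy, -, hyv, hy⟩ ⟨huz, -, hzv, hz⟩
    by_contra! h
    exact hG.not_claw hux huy huz h.1 h.2.1 h.2.2 (hne x y hxv hyv (by grind))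
      (hne x z hxv hzv (by grind)) (hne y z hyv hzv (by grind))
  · rintro rfl
    exact hbc rfl
  · rintro rfl
    exact hbc hfr
  · rintro rfl
    exact nvr hvc
  · rintro x y ⟨hux, huv, hxv, hx⟩ ⟨huy, -, hyv, hy⟩
    by_contra h
    have h1 : ∀ x, G.Adj v x → f x = f c → G.Adj b x → False := fun x h1 h2 h3 =>
      nbc (hc x h1 h2 ▸ h3)
    exact hG.not_claw hvb.symm hux huy (Ne.symm hxv) (Ne.symm hyv) h
      (fun h => h1 x h (by grind) hux) (fun h => h1 y h (by grind) huy) (hne x y hxv hyv (by grind))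
  · rintro x y ⟨hux, huv, hxv, hx⟩ ⟨huy, -, hyv, hy⟩
    by_contra h
    have h1 : ∀ x, G.Adj v x → f x = f b → G.Adj c x → False := fun x h1 h2 h3 =>
      nbc (hb x h1 h2 ▸ h3.symm)
    exact hG.not_claw hvc.symm hux huy (Ne.symm hxv) (Ne.symm hyv) h
      (fun h => h1 x h (by grind) hux) (fun h => h1 y h (by grind) huy) (hne x y hxv hyv (by grind))
  · rintro x y ⟨hux, huv, hxv, hx⟩ ⟨huy, -, hyv, hy⟩
    by_contra h
    have h1 : ∀ x, x ≠ v → f x = f b → G.Adj r x → ¬G.Adj a x := fun x h1 h2 h3 h4 =>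
      nbr (hanb x h1 h4 h2 ▸ h3.symm)
    refine hG.not_claw har.symm hux huy ?_ ?_ h (h1 x hxv (by grind) hux)
      (h1 y hyv (by grind) huy) (hne x y hxv hyv (by grind))
    · rintro rfl
      grind
    · rintro rfl
      grind

end CriticalFour

/-! ### Clique number three: no vertex of degree four -/

/-- `f` colours all vertices but `v`, whose neighbours are `a`, `b`, `c`, `d` and have distinct
colours. -/
structure Rainbow (G : SimpleGraph V) (f : V → ℕ) (v a b c d : V) : Prop where
  colors : G.ColorsOn {v}ᶜ 4 f
  va : G.Adj v a
  vb : G.Adj v b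
  vc : G.Adj v c
  vd : G.Adj v d
  mem : ∀ n, G.Adj v n → n = a ∨ n = b ∨ n = c ∨ n = d
  ab : f a ≠ f b
  ac : f a ≠ f c
  ad : f a ≠ f d
  bc : f b ≠ f c
  bd : f b ≠ f d
  cd : f c ≠ f d

namespace Rainbow

variable {f : V → ℕ} {v a b c d : V} (h : G.Rainbow f v a b c d)
include h

theorem rotate : G.Rainbow f v b c d a :=
  ⟨h.colors, h.vb, h.vc, h.vd, h.va, fun n hn => by have := h.mem n hn; tauto, h.bc, h.bd,
    h.ab.symm, h.cd, h.ac.symm, h.ad.symm⟩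

theorem swap : G.Rainbow f v b a c d :=
  ⟨h.colors, h.vb, h.va, h.vc, h.vd, fun n hn => by have := h.mem n hn; tauto, h.ab.symm, h.bc,
    h.bd, h.ac, h.ad, h.cd⟩

theorem swap₂₄ : G.Rainbow f v a d c b :=
  ⟨h.colors, h.va, h.vd, h.vc, h.vb, fun n hn => by have := h.mem n hn; tauto, h.ad, h.ac, h.ab,
    h.cd.symm, h.bd.symm, h.bc.symm⟩

theorem swap₃₄ : G.Rainbow f v a b d c :=
  ⟨h.colors, h.va, h.vb, h.vd, h.vc, fun n hn => by have := h.mem n hn; tauto, h.ab, h.ad, h.ac,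
    h.bd, h.bc, h.cd.symm⟩

theorem unique (n n' : V) (hn : G.Adj v n) (hn' : G.Adj v n') (hff : f n = f n') : n = n' := by
  obtain ⟨-, -, -, -, -, mem, _, _, _, _, _, _⟩ := h
  have := mem n hn
  have := mem n' hn'
  grind

theorem ne_of_adj {x y : V} (hx : x ≠ v) (hy : y ≠ v) (hxy : G.Adj x y) : f x ≠ f y :=
  h.colors.2 x hx y hy hxy

theorem exists_adj (hG : G.Critical 4) {n m : V} (hn : G.Adj v n) (hm : G.Adj v m) (hnm : m ≠ n) :
    ∃ z, G.Adj n z ∧ z ≠ v ∧ f z = f m :=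
  hG.exists_adj_of_unique h.colors hn (fun n' hn' hff => h.unique n' n hn' hn hff)
    (h.colors.1 m hm.ne') fun hff => hnm (h.unique m n hm hn hff)

end Rainbow

theorem Critical.rainbow (hG : G.Critical 4) {f : V → ℕ} {v a b c d : V}
    (hf : G.ColorsOn {v}ᶜ 4 f) (ha : G.Adj v a) (hb : G.Adj v b) (hc : G.Adj v c) (hd : G.Adj v d)
    (hmem : ∀ n, G.Adj v n → n = a ∨ n = b ∨ n = c ∨ n = d) : G.Rainbow f v a b c d := by
  have key : ∀ i < 4, f a = i ∨ f b = i ∨ f c = i ∨ f d = i := by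
    intro i hi
    obtain ⟨n, hn, rfl⟩ := hG.exists_adj_color hf hi
    rcases hmem n hn with rfl | rfl | rfl | rfl <;> simp
  have h0 := key 0 (by norm_num)
  have h1 := key 1 (by norm_num)
  have h2 := key 2 (by norm_num)
  have h3 := key 3 (by norm_num)
  exact ⟨hf, ha, hb, hc, hd, hmem, by omega, by omega, by omega, by omega, by omega, by omega⟩

namespace CriticalFour

variable [Finite V] (hG : G.CriticalFour)
include hG

/-- The neighbours of a vertex of degree four do not induce two disjoint edges. -/
theorem not_rainbow_matching {f : V → ℕ} {v a b c d : V} (h : G.Rainbow f v a b c d)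
    (hab : G.Adj a b) (nac : ¬G.Adj a c) (nad : ¬G.Adj a d) (nbc : ¬G.Adj b c) (nbd : ¬G.Adj b d) :
    False := by
  have hu := h.unique
  have hne : b ≠ a ∧ c ≠ a ∧ d ≠ a := ⟨by rintro rfl; exact h.ab rfl, by rintro rfl; exact h.ac rfl,
    by rintro rfl; exact h.ad rfl⟩
  obtain ⟨r, har, hrv, hr⟩ := h.exists_adj hG.critical h.va h.vc hne.2.1
  obtain ⟨s, has, hsv, hs⟩ := h.exists_adj hG.critical h.va h.vd hne.2.2
  have nvr : ¬G.Adj v r := fun hvr => nac (hu r c hvr h.vc hr ▸ har)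
  have nvs : ¬G.Adj v s := fun hvs => nad (hu s d hvs h.vd hs ▸ has)
  have hrs : r ≠ s := by rintro rfl; exact h.cd (hr.symm.trans hs)
  have hadj : G.Adj r s := by_contra fun hn =>
    hG.not_claw h.va.symm har has (Ne.symm hrv) (Ne.symm hsv) hrs nvr nvs hn
  have ha : ∀ n, n ≠ v → G.Adj a n → n = b ∨ n = r ∨ n = s := by
    intro n hnv han
    by_cases hvn : G.Adj v n
    · have := h.mem n hvn
      have := G.loopless.irrefl a
      grind
    · have := hG.eq_of_not_adj h.va.symm har has han nvr nvs hvn (Ne.symm hrv) (Ne.symm hsv)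
        (Ne.symm hnv)
      grind
  have uniq : ∀ {x}, G.Adj v x → ∀ n, G.Adj v n → f n = f x → n = x := fun hx n hn hff =>
    hu n _ hn hx hff
  have := h.bc
  have := h.bd
  have := h.cd
  have hbr := hG.adj_of_kempe h.colors h.va h.vb h.vc (uniq h.va) (uniq h.vb) (uniq h.vc) h.ab h.ac
    h.bc nbc hrv nvr har hr (fun n h1 h2 h3 => by have := ha n h1 h2; grind)
    (fun n h1 h2 h3 => by have := ha n h1 h2; grind)
  have hbs := hG.adj_of_kempe h.colors h.va h.vb h.vd (uniq h.va) (uniq h.vb) (uniq h.vd) h.ab h.ad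
    h.bd nbd hsv nvs has hs (fun n h1 h2 h3 => by have := ha n h1 h2; grind)
    (fun n h1 h2 h3 => by have := ha n h1 h2; grind)
  exact hG.k4 a b r s hab har has hbr hbs hadj

/-- The neighbour `r` of `a` with the colour of `c` is on the Kempe chain of `b`. If both
alternatives failed, this chain would be contained in `{b, c}`. -/
theorem exists_adj_of_rainbow_path {f : V → ℕ} {v a b c d : V} (h : G.Rainbow f v a b c d)
    (hab : G.Adj a b) (hbc : G.Adj b c) (nac : ¬G.Adj a c) (nad : ¬G.Adj a d) :
    (∃ t, G.Adj b t ∧ t ≠ v ∧ t ≠ c ∧ f t = f c) ∨ ∃ t, G.Adj c t ∧ t ≠ v ∧ t ≠ b ∧ f t = f b := by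
  have hu := h.unique
  have hne : b ≠ a ∧ c ≠ a ∧ d ≠ a := ⟨by rintro rfl; exact h.ab rfl, by rintro rfl; exact h.ac rfl,
    by rintro rfl; exact h.ad rfl⟩
  obtain ⟨r, har, hrv, hr⟩ := h.exists_adj hG.critical h.va h.vc hne.2.1
  obtain ⟨s, has, hsv, hs⟩ := h.exists_adj hG.critical h.va h.vd hne.2.2
  have nvr : ¬G.Adj v r := fun hvr => nac (hu r c hvr h.vc hr ▸ har)
  have nvs : ¬G.Adj v s := fun hvs => nad (hu s d hvs h.vd hs ▸ has)
  have ha : ∀ n, n ≠ v → G.Adj a n → n = b ∨ n = r ∨ n = s := by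
    intro n hnv han
    by_cases hvn : G.Adj v n
    · have := h.mem n hvn
      have := G.loopless.irrefl a
      grind
    · have := hG.eq_of_not_adj h.va.symm har has han nvr nvs hvn (Ne.symm hrv) (Ne.symm hsv)
        (Ne.symm hnv)
      have := h.cd
      grind
  have := h.bc
  have := h.bd
  have := h.cd
  have hreach := hG.critical.kempe_reachable_of_adj (b := b) (r := r) h.colors h.va h.vb hrv
    (fun n hn hff => hu n _ hn h.va hff) h.ab (hr ▸ h.ac) (hr ▸ h.bc)
    (fun n h1 h2 h3 => by have := ha n h1 h2; grind)
    (fun n h1 h2 h3 => by have := ha n h1 h2; grind)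
  by_contra! hno
  have := hreach.mem_of_closed (s := {b, c}) (by simp) (by
    rintro x (rfl | rfl) y ⟨hxy, -, hyv, hxy'⟩
    · have := hno.1 y hxy hyv
      simp only [Set.mem_insert_iff, Set.mem_singleton_iff]
      grind
    · have := hno.2 y hxy hyv
      simp only [Set.mem_insert_iff, Set.mem_singleton_iff]
      grind)
  rcases this with rfl | rfl
  · exact h.bc hr
  · exact nvr h.vc

end CriticalFour

namespace CriticalFour

variable [Finite V] (hG : G.CriticalFour)
include hG

/-- Claw-freeness fills the neighbourhoods of `b` and `c` up to five known vertices. The missing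
colours then give the edge `e z` the three common neighbours `c`, `p`, `q`. -/
theorem not_rainbow_path_of_adj {f : V → ℕ} {v a b c d t : V} (h : G.Rainbow f v a b c d)
    (hab : G.Adj a b) (hbc : G.Adj b c) (hcd : G.Adj c d) (nac : ¬G.Adj a c) (nbd : ¬G.Adj b d)
    (hbt : G.Adj b t) (htv : t ≠ v) (htc : t ≠ c) (hft : f t = f c) : False := by
  classical
  have hs : ∀ u v, G.Adj u v → G.Adj v u := fun u v => Adj.symm
  have hu := h.unique
  have hmove := fun x (hx : G.Adj v x) => h.colors.move hx (fun n hn hff => hu n x hn hx hff)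
  have hne : ∀ x y, x ≠ v → y ≠ v → G.Adj x y → f x ≠ f y := fun x y => h.ne_of_adj
  have hlt : ∀ x, x ≠ v → f x < 4 := h.colors.1
  obtain ⟨e, hbe, hev, hfe⟩ := h.exists_adj hG.critical h.vb h.vd (fun hdb => h.bd (hdb ▸ rfl))
  obtain ⟨z, hcz, hzv, hfz⟩ := h.exists_adj hG.critical h.vc h.va (fun hac => h.ac (hac ▸ rfl))
  obtain ⟨s, hds, hsv, hfs⟩ := h.exists_adj hG.critical h.vd h.vb (fun hdb => h.bd (hdb ▸ rfl))
  obtain ⟨-, va, vb, vc, vd, mem, ab, ac, ad, bc, bd, cd⟩ := h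
  have hav := va.ne'
  have hbv := vb.ne'
  have hcv := vc.ne'
  have hdv := vd.ne'
  have nvt : ¬G.Adj v t := fun hvt => htc (hu t c hvt vc hft)
  have nve : ¬G.Adj v e := fun hve => nbd (hu e d hve vd hfe ▸ hbe)
  have nvz : ¬G.Adj v z := fun hvz => nac (hu z a hvz va hfz ▸ hcz).symm
  have nvs : ¬G.Adj v s := fun hvs => nbd (hu s b hvs vb hfs ▸ hds).symm
  have ntc : ¬G.Adj t c := fun hn => hne t c htv hcv hn hft
  have nde : ¬G.Adj d e := fun hn => hne d e hdv hev hn hfe.symm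
  have hat : G.Adj t a := by
    have := hG.adj_or_adj_or_eq hbt vb.symm hbc hab.symm
    grind
  have hte : G.Adj t e := by
    have := hG.adj_or_adj_or_eq hbt vb.symm hbc hbe
    grind
  have hce : G.Adj c e := by
    have := hG.adj_or_adj_or_eq hbc hab.symm hbt hbe
    grind
  have hdz : G.Adj d z := by
    have := hG.adj_or_adj_or_eq hcd hbc.symm hce hcz
    grind
  have nbz : ¬G.Adj b z := by
    have := hG.eq_of_adj hbc.symm vc.symm hce hcz vb.symm hbe
    grind
  have hez : G.Adj z e := by
    have := hG.adj_or_adj_or_eq hcz vc.symm hbc.symm hce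
    grind
  have Nb := fun n => hG.mem_of_five (n := n) vb.symm hab.symm hbc hbt hbe hav.symm hcv.symm
    htv.symm hev.symm (by grind) (by grind) (by grind) htc.symm (by grind) (by grind)
  have Nc := fun n => hG.mem_of_five (n := n) vc.symm hbc.symm hcd hce hcz hbv.symm hdv.symm
    hev.symm hzv.symm (by grind) (by grind) (by grind) (by grind) (by grind) (by grind)
  have hgz : ∀ x, x ≠ v → ∀ i, Function.update f v i x = f x := fun x hx i => by simp [hx]
  have hgv : ∀ i, Function.update f v i v = i := fun i => by simp
  -- With the uncoloured vertex moved to `c`, the vertex `z` alone has its colour among the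
  -- neighbours of `c`; with it moved to `b`, the same holds for `e` at `b`. So both see all other
  -- colours.
  obtain ⟨p, hzp, hpc, hgp⟩ := hG.critical.exists_adj_of_unique (hmove c vc) hcz (fun n hcn => by
    have := Nc n hcn
    grind) (hlt c hcv) (by grind)
  obtain ⟨q, hzq, hqc, hgq⟩ := hG.critical.exists_adj_of_unique (hmove c vc) hcz (fun n hcn => by
    have := Nc n hcn
    grind) (hlt b hbv) (by grind)
  obtain ⟨y, hey, hyb, hgy⟩ := hG.critical.exists_adj_of_unique (hmove b vb) hbe (fun n hbn => by
    have := Nb n hbn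
    grind) (hlt b hbv) (by grind)
  have hpv : p ≠ v := by rintro rfl; exact nvz hzp.symm
  have hqv : q ≠ v := by rintro rfl; exact nvz hzq.symm
  have hyv : y ≠ v := by rintro rfl; exact nve hey.symm
  rw [hgz p hpv] at hgp
  rw [hgz q hqv] at hgq
  rw [hgz y hyv] at hgy
  have nvp : ¬G.Adj v p := fun hvp => hpc (hu p c hvp vc hgp)
  have npc : ¬G.Adj p c := fun hn => hne p c hpv hcv hn hgp
  have ndp : ¬G.Adj d p := by
    intro hdp
    have := hG.adj_or_adj_or_eq vd.symm hdz.symm.symm hds hdp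
    grind
  have hep : G.Adj p e := by
    have := hG.adj_or_adj_or_eq hzp hcz.symm hdz.symm hez
    grind
  have Nz := fun n => hG.mem_of_five (n := n) hcz.symm hez hdz.symm hzp hzq (by grind) (by grind)
    (by grind) (by grind) (by grind) (by grind) (by grind) (by grind) (by grind) (by grind)
  have nyc : ¬G.Adj c y := fun hn => by
    have := Nc y hn
    grind
  have nyb : ¬G.Adj y b := fun hn => hne y b hyv hbv hn hgy
  have hyz : G.Adj y z := by
    have := hG.adj_or_adj_or_eq hey hbe.symm hce.symm hez.symm
    grind
  have hyq : y = q := by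
    have := Nz y hyz.symm
    grind
  have := hG.eq_of_adj hez hcz.symm hzp hzq hce.symm hep.symm
  grind

theorem not_rainbow_path {f : V → ℕ} {v a b c d : V} (h : G.Rainbow f v a b c d)
    (hab : G.Adj a b) (hbc : G.Adj b c) (hcd : G.Adj c d) (nac : ¬G.Adj a c) (nad : ¬G.Adj a d)
    (nbd : ¬G.Adj b d) : False := by
  rcases hG.exists_adj_of_rainbow_path h hab hbc nac nad with
    ⟨t, h1, h2, h3, h4⟩ | ⟨t, h1, h2, h3, h4⟩
  · exact hG.not_rainbow_path_of_adj h hab hbc hcd nac nbd h1 h2 h3 h4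
  · exact hG.not_rainbow_path_of_adj h.swap.rotate.rotate.swap hcd.symm hbc.symm hab.symm
      (mt Adj.symm nbd) (mt Adj.symm nac) h1 h2 h3 h4

end CriticalFour

/-- Exchange the colours of two vertices. -/
theorem ColorsOn.exchange [DecidableEq V] {s : Set V} {k : ℕ} {f : V → ℕ} {a p : V}
    (hf : G.ColorsOn s k f) (ha : a ∈ s) (hp : p ∈ s)
    (h1 : ∀ n ∈ s, G.Adj a n → f n = f p → n = p) (h2 : ∀ n ∈ s, G.Adj p n → f n = f a → n = a) :
    G.ColorsOn s k (f ∘ Equiv.swap a p) := by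
  have hs : ∀ u v, G.Adj u v → G.Adj v u := fun u v => Adj.symm
  refine ⟨fun u hu => ?_, fun u hu w hw huw => ?_⟩
  · rw [Function.comp_apply, Equiv.swap_apply_def]
    split_ifs
    · exact hf.1 p hp
    · exact hf.1 a ha
    · exact hf.1 u hu
  · have := hf.2 u hu w hw huw
    have := huw.ne
    simp only [Function.comp_apply, Equiv.swap_apply_def]
    split_ifs <;> grind

/-- Otherwise the colours of `n` and `p` could be exchanged, and `v` would have no neighbour of the
colour of `n`. -/
theorem Critical.exists_adj_second {f : V → ℕ} {k : ℕ} {v n p : V} (hG : G.Critical k)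
    (hf : G.ColorsOn {v}ᶜ k f) (hn : G.Adj v n) (hnu : ∀ w, G.Adj v w → f w = f n → w = n)
    (hpv : p ≠ v) (nvp : ¬G.Adj v p) (hpn : f p ≠ f n)
    (huniq : ∀ y, y ≠ v → G.Adj n y → f y = f p → y = p) :
    ∃ x, G.Adj p x ∧ x ≠ v ∧ x ≠ n ∧ f x = f n := by
  classical
  by_contra! hno
  have hg := hf.exchange (a := n) (p := p) hn.ne' hpv huniq fun x hxv hpx hfx =>
    by_contra fun hxn => hno x hpx hxv hxn hfx
  obtain ⟨w, hvw, hw⟩ := hG.exists_adj_color hg (hf.1 n hn.ne')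
  rw [Function.comp_apply, Equiv.swap_apply_def] at hw
  split_ifs at hw with h1 h2
  · exact hpn hw
  · exact nvp (h2 ▸ hvw)
  · exact h1 (hnu w hvw hw)

namespace CriticalFour

variable [Finite V] (hG : G.CriticalFour)
include hG

/-- The vertices `p`, `e`, `r`, `g` are forced to form a second four-cycle around `a b c d`, as in
an antiprism. The second neighbours of a given colour at `p` and `e` then yield three common
neighbours `b`, `g`, `x` of `p` and `e`. -/
theorem not_rainbow_cycle_of_adj {f : V → ℕ} {v a b c d p : V} (h : G.Rainbow f v a b c d)
    (hab : G.Adj a b) (hbc : G.Adj b c) (hcd : G.Adj c d) (hda : G.Adj d a) (nac : ¬G.Adj a c)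
    (nbd : ¬G.Adj b d) (hap : G.Adj a p) (hbp : G.Adj b p) (hpv : p ≠ v) (hfp : f p = f c) :
    False := by
  have hs : ∀ u v, G.Adj u v → G.Adj v u := fun u v => Adj.symm
  have hu := h.unique
  have hne : ∀ x y, x ≠ v → y ≠ v → G.Adj x y → f x ≠ f y := fun x y => h.ne_of_adj
  have hac : a ≠ c := fun hac => h.ac (hac ▸ rfl)
  have hbd : b ≠ d := fun hbd => h.bd (hbd ▸ rfl)
  obtain ⟨e, hbe, hev, hfe⟩ := h.exists_adj hG.critical h.vb h.vd hbd.symm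
  obtain ⟨r, hcr, hrv, hfr⟩ := h.exists_adj hG.critical h.vc h.va hac
  obtain ⟨g, hdg, hgv, hfg⟩ := h.exists_adj hG.critical h.vd h.vb hbd
  have h' := h
  obtain ⟨-, va, vb, vc, vd, mem, ab, ac, ad, bc, bd, cd⟩ := h'
  have hav := va.ne'
  have hbv := vb.ne'
  have hcv := vc.ne'
  have hdv := vd.ne'
  have nvp : ¬G.Adj v p := fun hvp => nac (hu p c hvp vc hfp ▸ hap)
  have nve : ¬G.Adj v e := fun hve => nbd (hu e d hve vd hfe ▸ hbe)
  have nvr : ¬G.Adj v r := fun hvr => nac (hu r a hvr va hfr ▸ hcr).symm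
  have nvg : ¬G.Adj v g := fun hvg => nbd (hu g b hvg vb hfg ▸ hdg).symm
  have npc : ¬G.Adj p c := fun hn => hne p c hpv hcv hn hfp
  have ned : ¬G.Adj e d := fun hn => hne e d hev hdv hn hfe
  have nra : ¬G.Adj r a := fun hn => hne r a hrv hav hn hfr
  have ngb : ¬G.Adj g b := fun hn => hne g b hgv hbv hn hfg
  have hpe : G.Adj p e := by
    have := hG.adj_or_adj_or_eq hbp vb.symm hbc hbe
    grind
  have hce : G.Adj c e := by
    have := hG.adj_or_adj_or_eq hbc hab.symm hbp hbe
    grind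
  have her : G.Adj e r := by
    have := hG.adj_or_adj_or_eq hce vc.symm hcd hcr
    grind
  have hdr : G.Adj d r := by
    have := hG.adj_or_adj_or_eq hcd hbc.symm hce hcr
    grind
  have hrg : G.Adj r g := by
    have := hG.adj_or_adj_or_eq hdr vd.symm hda hdg
    grind
  have hag : G.Adj a g := by
    have := hG.adj_or_adj_or_eq hda hcd.symm hdr hdg
    grind
  have hgp : G.Adj g p := by
    have := hG.adj_or_adj_or_eq hag va.symm hab hap
    grind
  have Na := fun n => hG.mem_of_five (n := n) va.symm hab hda.symm hap hag hbv.symm hdv.symm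
    hpv.symm hgv.symm (by grind) (by grind) (by grind) (by grind) (by grind) (by grind)
  have Nb := fun n => hG.mem_of_five (n := n) vb.symm hab.symm hbc hbp hbe hav.symm hcv.symm
    hpv.symm hev.symm (by grind) (by grind) (by grind) (by grind) (by grind) (by grind)
  have Nc := fun n => hG.mem_of_five (n := n) vc.symm hbc.symm hcd hce hcr hbv.symm hdv.symm
    hev.symm hrv.symm (by grind) (by grind) (by grind) (by grind) (by grind) (by grind)
  obtain ⟨x, hpx, hxv, hxa, hfx⟩ := hG.critical.exists_adj_second h.colors va
    (fun w hw hff => hu w a hw va hff) hpv nvp (by grind)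
    (fun y hy hay hfy => by have := Na y hay; grind)
  obtain ⟨y, hey, hyv, hyb, hfy⟩ := hG.critical.exists_adj_second h.colors vb
    (fun w hw hff => hu w b hw vb hff) hev nve (by grind)
    (fun y hy hby hfy => by have := Nb y hby; grind)
  have Np := fun n => hG.mem_of_five (n := n) hap.symm hbp.symm hpe hgp.symm hpx (by grind)
    (by grind) (by grind) (by grind) (by grind) (by grind) (by grind) (by grind) (by grind)
    (by grind)
  have Ne := fun n => hG.mem_of_five (n := n) hbe.symm hce.symm hpe.symm her hey (by grind)
    (by grind) (by grind) (by grind) (by grind) (by grind) (by grind) (by grind) (by grind)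
    (by grind)
  have nxb : ¬G.Adj b x := fun hn => by have := Nb x hn; grind
  have nxa : ¬G.Adj x a := fun hn => hne x a hxv hav hn hfx
  have hxe : G.Adj x e := by
    have := hG.adj_or_adj_or_eq hpx hap.symm hbp.symm hpe
    grind
  have nyc : ¬G.Adj c y := fun hn => by have := Nc y hn; grind
  have nyb : ¬G.Adj y b := fun hn => hne y b hyv hbv hn hfy
  have hyp : G.Adj y p := by
    have := hG.adj_or_adj_or_eq hey hbe.symm hce.symm hpe.symm
    grind
  have hyg : y = g := by have := Np y hyp.symm; grind
  have := hG.eq_of_adj hpe hbp.symm hgp.symm hpx hbe.symm (hyg ▸ hey) hxe.symm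
  grind

theorem not_rainbow_cycle {f : V → ℕ} {v a b c d : V} (h : G.Rainbow f v a b c d)
    (hab : G.Adj a b) (hbc : G.Adj b c) (hcd : G.Adj c d) (hda : G.Adj d a) (nac : ¬G.Adj a c)
    (nbd : ¬G.Adj b d) : False := by
  obtain ⟨p, hap, hpv, hfp⟩ := h.exists_adj hG.critical h.va h.vc (fun hca => h.ac (hca ▸ rfl))
  have nvp : ¬G.Adj v p := fun hvp => nac (h.unique p c hvp h.vc hfp ▸ hap)
  by_cases hbp : G.Adj b p
  · exact hG.not_rainbow_cycle_of_adj h hab hbc hcd hda nac nbd hap hbp hpv hfp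
  by_cases hdp : G.Adj d p
  · exact hG.not_rainbow_cycle_of_adj h.swap₂₄ hda.symm hcd.symm hbc.symm hab.symm nac
      (mt Adj.symm nbd) hap hdp hpv hfp
  have := hG.adj_or_adj_or_eq hap h.va.symm hab hda.symm
  have hbd : b ≠ d := fun hbd => h.bd (hbd ▸ rfl)
  have := h.vb.ne
  have := h.vd.ne
  have hs : ∀ u v, G.Adj u v → G.Adj v u := fun u v => Adj.symm
  have := h.vb
  have := h.vd
  grind

/-- A graph on four vertices without triangle or independent triple is two disjoint edges, a path or
a cycle, and each of these is excluded above. -/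
theorem not_rainbow_of_adj {f : V → ℕ} {v a b c d : V} (h : G.Rainbow f v a b c d)
    (hab : G.Adj a b) : False := by
  have hs : ∀ u v, G.Adj u v → G.Adj v u := fun u v => Adj.symm
  have nab : a ≠ b := fun hh => h.ab (hh ▸ rfl)
  have nac : a ≠ c := fun hh => h.ac (hh ▸ rfl)
  have nad : a ≠ d := fun hh => h.ad (hh ▸ rfl)
  have nbc : b ≠ c := fun hh => h.bc (hh ▸ rfl)
  have nbd : b ≠ d := fun hh => h.bd (hh ▸ rfl)
  have ncd : c ≠ d := fun hh => h.cd (hh ▸ rfl)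
  have l1 := hG.eq_of_adj h.va h.vb h.vc h.vd
  have l2 := hG.eq_of_adj h.vb h.va h.vc h.vd
  have l3 := hG.adj_or_adj_or_eq h.vc h.va h.vb h.vd
  have l4 := hG.adj_or_adj_or_eq h.vd h.va h.vb h.vc
  have k1 := hG.k4 v a b c h.va h.vb h.vc
  have k2 := hG.k4 v a b d h.va h.vb h.vd
  have k3 := hG.k4 v a c d h.va h.vc h.vd
  have k4 := hG.k4 v b c d h.vb h.vc h.vd
  have m := hG.not_rainbow_matching h hab
  have p1 := hG.not_rainbow_path h hab
  have p2 := hG.not_rainbow_path h.swap₃₄ hab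
  have p3 := hG.not_rainbow_path h.swap hab.symm
  have p4 := hG.not_rainbow_path h.swap.swap₃₄ hab.symm
  have p5 := hG.not_rainbow_path h.rotate.rotate.rotate
  have p6 := hG.not_rainbow_path h.swap₃₄.rotate.rotate.rotate
  have c1 := hG.not_rainbow_cycle h hab
  have c2 := hG.not_rainbow_cycle h.swap₃₄ hab
  simp only [nab, nac, nad, nbc, nbd, ncd, nac.symm, nbc.symm, nad.symm, nbd.symm, ncd.symm,
    or_self,
    or_false, imp_false, G.adj_comm b a, G.adj_comm c a, G.adj_comm d a, G.adj_comm c b,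
    G.adj_comm d b, G.adj_comm d c, hab, true_imp_iff]
    at l1 l2 l3 l4 k1 k2 k3 k4 m p1 p2 p3 p4 p5 p6 c1 c2
  clear h hG hs nab nac nad nbc nbd ncd
  generalize G.Adj a c = AC at *
  generalize G.Adj a d = AD at *
  generalize G.Adj b c = BC at *
  generalize G.Adj b d = BD at *
  generalize G.Adj c d = CD at *
  by_cases AC <;> by_cases AD <;> by_cases BC <;> by_cases BD <;> by_cases CD <;> simp_all

theorem not_rainbow {f : V → ℕ} {v a b c d : V} (h : G.Rainbow f v a b c d) : False := by
  rcases hG.adj_or_adj_or_eq h.va h.vb h.vc h.vd with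
    hab | hac | had | rfl | rfl | rfl | rfl | rfl |
    rfl
  · exact hG.not_rainbow_of_adj h hab
  · exact hG.not_rainbow_of_adj h.rotate.swap.rotate.rotate.rotate hac
  · exact hG.not_rainbow_of_adj h.swap₂₄ had
  · exact h.ab rfl
  · exact h.ac rfl
  · exact h.ad rfl
  · exact h.bc rfl
  · exact h.bd rfl
  · exact h.cd rfl

/-- Every vertex has degree at least five. -/
theorem exists_fifth {v a b c d : V} (ha : G.Adj v a) (hb : G.Adj v b) (hc : G.Adj v c)
    (hd : G.Adj v d) : ∃ n, G.Adj v n ∧ n ≠ a ∧ n ≠ b ∧ n ≠ c ∧ n ≠ d := by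
  by_contra! hno
  obtain ⟨f, hf⟩ := hG.critical.colors_compl v
  exact hG.not_rainbow (hG.critical.rainbow hf ha hb hc hd fun n hn => by
    have := hno n hn
    tauto)

end CriticalFour

/-! ### Clique number three: pentagonal neighbourhoods -/

/-- The neighbours of `v` induce a cycle `a b c d e`. -/
structure Wheel (G : SimpleGraph V) (v a b c d e : V) : Prop where
  va : G.Adj v a
  vb : G.Adj v b
  vc : G.Adj v c
  vd : G.Adj v d
  ve : G.Adj v e
  ab : G.Adj a b
  bc : G.Adj b c
  cd : G.Adj c d
  de : G.Adj d e
  ea : G.Adj e a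
  ac : ¬G.Adj a c
  bd : ¬G.Adj b d
  ce : ¬G.Adj c e
  da : ¬G.Adj d a
  eb : ¬G.Adj e b
  mem : ∀ n, G.Adj v n → n = a ∨ n = b ∨ n = c ∨ n = d ∨ n = e

theorem Wheel.rotate {v a b c d e : V} (h : G.Wheel v a b c d e) : G.Wheel v b c d e a :=
  ⟨h.vb, h.vc, h.vd, h.ve, h.va, h.bc, h.cd, h.de, h.ea, h.ab, h.bd, h.ce, h.da, h.eb, h.ac,
    fun n hn => by have := h.mem n hn; tauto⟩

namespace CriticalFour

variable [Finite V] (hG : G.CriticalFour)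
include hG

/-- The degree of `v` is five, and a graph on five vertices without triangle or independent triple
is a pentagon. -/
theorem exists_wheel_of_path {v a b c : V} (ha : G.Adj v a) (hb : G.Adj v b) (hc : G.Adj v c)
    (hab : G.Adj a b) (hbc : G.Adj b c) (hac : a ≠ c) : ∃ d e, G.Wheel v a b c d e := by
  have hs : ∀ u v, G.Adj u v → G.Adj v u := fun u v => Adj.symm
  have key : ∀ d e, G.Adj v d → G.Adj v e → d ≠ a → d ≠ b → d ≠ c → e ≠ a → e ≠ b → e ≠ c →
      d ≠ e → G.Adj c d → G.Wheel v a b c d e := by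
    intro d e hd he h1 h2 h3 h4 h5 h6 h7 hcd
    have e1 := hG.eq_of_adj hb ha hc hd hab.symm hbc
    have e2 := hG.eq_of_adj hb ha hc he hab.symm hbc
    have e3 := hG.eq_of_adj hc hb hd he hbc.symm hcd
    have o1 := hG.adj_or_adj_or_eq he hb hc ha
    have o2 := hG.adj_or_adj_or_eq he hb hc hd
    have e4 := hG.eq_of_adj ha hb he hd hab
    have k1 := hG.k4 v a b c ha hb hc hab
    have k2 := fun n => hG.mem_of_five (n := n) ha hb hc hd he hab.ne hac h1.symm h4.symm hbc.ne
      h2.symm h5.symm h3.symm h6.symm h7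
    have nbd : ¬G.Adj b d := by grind
    have nbe : ¬G.Adj b e := by grind
    have nce : ¬G.Adj c e := by grind
    have hea : G.Adj e a := by grind
    have hed : G.Adj e d := by grind
    exact ⟨ha, hb, hc, hd, he, hab, hbc, hcd, hed.symm, hea, fun h => k1 h hbc, nbd, nce, by grind,
      by grind, k2⟩
  obtain ⟨d, hd, h1, h2, h3⟩ := hG.critical.exists_adj_ne v a b c
  obtain ⟨e, he, h4, h5, h6, h7⟩ := hG.exists_fifth ha hb hc hd
  by_cases hcd : G.Adj c d
  · exact ⟨d, e, key d e hd he h1 h2 h3 h4 h5 h6 h7.symm hcd⟩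
  · have := hG.adj_or_adj_or_eq hc ha hd he
    have := hG.k4 v a b c ha hb hc hab
    exact ⟨e, d, key e d he hd h4 h5 h6 h1 h2 h3 h7 (by grind)⟩

theorem eq_of_common {s t x y z : V} (hst : G.Adj s t) (hsx : G.Adj s x) (hsy : G.Adj s y)
    (hsz : G.Adj s z) (htx : G.Adj t x) (hty : G.Adj t y) (htz : G.Adj t z) (hxy : x ≠ y)
    (hxz : x ≠ z) : y = z := by
  have := hG.eq_of_adj hst hsx hsy hsz htx hty htz
  tauto

theorem exists_wheel {v a b c d : V} (ha : G.Adj v a) (hb : G.Adj v b) (hc : G.Adj v c)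
    (hd : G.Adj v d) (hab : G.Adj a b) (hbc : G.Adj b c) (hcd : G.Adj c d) (hac : a ≠ c)
    (hbd : b ≠ d) : ∃ e, G.Wheel v a b c d e := by
  obtain ⟨d', e, h⟩ := hG.exists_wheel_of_path ha hb hc hab hbc hac
  have hbd' : b ≠ d' := by
    rintro rfl
    exact h.da h.ab.symm
  obtain rfl := hG.eq_of_common hc hb hd h.vd hbc.symm hcd h.cd hbd hbd'
  exact ⟨e, h⟩

/-- The wheels around the `nᵢ` close up to a second ring of vertices `mᵢ`, adjacent to `nᵢ` and its
successor, and `z` is opposite to `v`, as in the icosahedron. The colour forced on `m₂` leaves no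
colour for `z`. -/
theorem not_wheel {f : V → ℕ} {v n₀ n₁ n₂ n₃ n₄ : V} (hf : G.ColorsOn {v}ᶜ 4 f)
    (h : G.Wheel v n₀ n₁ n₂ n₃ n₄) (h02 : f n₀ = f n₂) : False := by
  have hs : ∀ u v, G.Adj u v → G.Adj v u := fun u v => Adj.symm
  obtain ⟨v0, v1, v2, v3, v4, a01, a12, a23, a34, a40, b02, b13, b24, b30, b41, mem⟩ := h
  have d02 : n₀ ≠ n₂ := by rintro rfl; exact b30 a23.symm
  have d13 : n₁ ≠ n₃ := by rintro rfl; exact b41 a34.symm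
  have d24 : n₂ ≠ n₄ := by rintro rfl; exact b02 a40.symm
  have d30 : n₃ ≠ n₀ := by rintro rfl; exact b02 a23.symm
  have d41 : n₄ ≠ n₁ := by rintro rfl; exact b13 a34.symm
  obtain ⟨m₁, m₀, W1⟩ := hG.exists_wheel_of_path a01.symm v1.symm a12 v0.symm v2 d02
  have e1v : m₁ ≠ v := by rintro rfl; exact W1.da v0
  have e0v : m₀ ≠ v := by rintro rfl; exact W1.ce v2.symm
  obtain ⟨m₂, W2⟩ := hG.exists_wheel W1.cd a12.symm v2.symm a23 W1.vd.symm v1.symm v3 e1v d13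
  have e2v : m₂ ≠ v := by rintro rfl; exact W2.eb v1
  obtain ⟨m₃, W3⟩ := hG.exists_wheel W2.de a23.symm v3.symm a34 W2.ve.symm v2.symm v4 e2v d24
  have e3v : m₃ ≠ v := by rintro rfl; exact W3.eb v2
  obtain ⟨m₄, W4⟩ := hG.exists_wheel W3.de a34.symm v4.symm a40 W3.ve.symm v3.symm v0 e3v d30
  have e4v : m₄ ≠ v := by rintro rfl; exact W4.eb v3
  obtain ⟨m₀', W0⟩ := hG.exists_wheel W4.de a40.symm v0.symm a01 W4.ve.symm v4.symm v1 e4v d41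
  have e0v' : m₀' ≠ v := by rintro rfl; exact W0.eb v4
  -- The ring closes: `v`, `m₀` and `m₀'` are common neighbours of `n₀` and `n₁`, so the last two
  -- coincide.
  obtain rfl := hG.eq_of_common a01 v0.symm W1.ea.symm W0.ve v1.symm W1.ve W0.de e0v.symm
    e0v'.symm
  obtain ⟨z, Wz⟩ := hG.exists_wheel W0.ea W0.ve.symm W0.de.symm W1.de.symm W0.va.symm a01 W1.vd
    (by rintro rfl; exact b41 W4.ve) (by rintro rfl; exact b02 W1.cd.symm)
  obtain ⟨m₂', Wm1⟩ := hG.exists_wheel Wz.de Wz.vd.symm W1.vd.symm W2.va.symm Wz.ve.symm Wz.vc a12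
    (by rintro rfl; exact Wz.eb a01.symm) (by rintro rfl; exact b02 W0.ve)
  obtain rfl := hG.eq_of_common Wm1.vd Wm1.vc W2.ea.symm Wm1.ve a12.symm W2.ve Wm1.de
    (by rintro rfl; exact b13 W2.de.symm) (by rintro rfl; exact Wm1.eb W1.ve)
  obtain ⟨m₃', Wm2⟩ := hG.exists_wheel Wm1.ea W2.ea W2.ve.symm W2.de.symm Wm1.va.symm W2.va.symm a23
    (by rintro rfl; exact Wm1.ac a12.symm) (by rintro rfl; exact b13 W1.vd)
  obtain rfl := hG.eq_of_common Wm2.vd Wm2.vc W3.ea.symm Wm2.ve a23.symm W3.ve Wm2.de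
    (by rintro rfl; exact b24 W3.de.symm) (by rintro rfl; exact Wm2.eb W2.va)
  have ezv : z ≠ v := by rintro rfl; exact Wz.eb v0
  obtain ⟨hu, hcol⟩ : (f n₁ ≠ f n₀ ∧ f n₃ ≠ f n₀ ∧ f n₄ ≠ f n₀ ∧ f n₁ ≠ f n₃ ∧ f n₁ ≠ f n₄ ∧
      f n₃ ≠ f n₄) ∧ ∀ x, x ≠ v → f x = f n₀ ∨ f x = f n₁ ∨ f x = f n₃ ∨ f x = f n₄ := by
    have key : ∀ i < 4, f n₀ = i ∨ f n₁ = i ∨ f n₃ = i ∨ f n₄ = i := by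
      intro i hi
      obtain ⟨n, hn, rfl⟩ := hG.critical.exists_adj_color hf hi
      rcases mem n hn with rfl | rfl | rfl | rfl | rfl <;> simp [h02]
    have h0 := key 0 (by norm_num)
    have h1 := key 1 (by norm_num)
    have h2 := key 2 (by norm_num)
    have h3 := key 3 (by norm_num)
    refine ⟨by omega, fun x hx => ?_⟩
    have := key (f x) (hf.1 x hx)
    omega
  obtain ⟨u1, u2, u3, u4, u5, u6⟩ := hu
  have hne : ∀ {x y}, G.Adj x y → x ≠ v → y ≠ v → f x ≠ f y := fun h hx hy => hf.2 _ hx _ hy h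
  have q1 : ∀ w, G.Adj v w → f w = f n₁ → w = n₁ := fun w hw hfw => by
    have := mem w hw
    grind
  have q3 : ∀ w, G.Adj v w → f w = f n₃ → w = n₃ := fun w hw hfw => by
    have := mem w hw
    grind
  obtain ⟨w₁, hw1, hw1v, hw1f⟩ := hG.critical.exists_adj_of_unique hf v1 q1 (hf.1 n₃ v3.ne') u4.symm
  obtain ⟨w₂, hw2, hw2v, hw2f⟩ := hG.critical.exists_adj_of_unique hf v1 q1 (hf.1 n₄ v4.ne') u5.symm
  have hm : ∀ w, G.Adj n₁ w → w ≠ v → f w ≠ f n₀ → f m₁ = f w ∨ f m₀ = f w := by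
    intro w hw hwv hfw
    rcases W1.mem w hw with rfl | rfl | rfl | rfl | rfl
    · exact absurd rfl hfw
    · exact absurd rfl hwv
    · exact absurd h02.symm hfw
    · exact Or.inl rfl
    · exact Or.inr rfl
  have hm1 := hm w₁ hw1 hw1v (by omega)
  have hm2 := hm w₂ hw2 hw2v (by omega)
  have nv0 : ¬G.Adj v m₀ := fun h => by
    rcases hG.eq_of_adj v1 v0 v2 h a01.symm a12 W1.ve with rfl | rfl | rfl
    · exact d02 rfl
    · exact G.loopless.irrefl _ W0.ve
    · exact b02 W0.ve
  have nv1 : ¬G.Adj v m₁ := fun h => by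
    rcases hG.eq_of_adj v1 v0 v2 h a01.symm a12 W1.vd with rfl | rfl | rfl
    · exact d02 rfl
    · exact b02 W1.cd.symm
    · exact G.loopless.irrefl _ W2.va
  have g0 := hne W0.ve v0.ne' e0v
  have g1 := hne W2.va v2.ne' e1v
  have g01 := hne W1.de e1v e0v
  have g10 := hne W1.vd v1.ne' e1v
  have g11 := hne W1.ve v1.ne' e0v
  have x1 : f m₂ = f n₁ ∨ f z = f n₁ := by
    obtain ⟨x, hx1, hx2, hx3, hx4⟩ := hG.critical.exists_adj_second hf v1 q1 e1v nv1
      g10.symm (fun y hyv hy hfy => by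
        rcases W1.mem y hy with rfl | rfl | rfl | rfl | rfl <;> grind)
    rcases Wm1.mem x hx1 with rfl | rfl | rfl | rfl | rfl
    · exact Or.inr hx4
    · exact absurd hx4.symm g11
    · exact absurd rfl hx3
    · exact absurd (hx4.symm.trans h02.symm) u1
    · exact Or.inl hx4
  have x3 : f m₂ = f n₁ ∨ f m₃ = f n₁ := by
    obtain ⟨x, hx1, hx2, hx4⟩ := hG.critical.exists_adj_of_unique hf v3 q3 (hf.1 n₁ v1.ne') u4
    rcases W3.mem x hx1 with rfl | rfl | rfl | rfl | rfl
    · exact Or.inl hx4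
    · exact absurd (hx4.symm.trans h02.symm) u1
    · exact absurd rfl hx2
    · exact absurd hx4.symm u5
    · exact Or.inr hx4
  have z0 := hne Wz.ve e0v ezv
  have z1 := hne Wz.de e1v ezv
  have z2 := hne Wm1.ea e2v ezv
  have z3 := hne Wm2.ea e3v ezv
  have c30 := hne W3.ve v3.ne' e3v
  have c31 := hne W3.de v4.ne' e3v
  have c32 := hne W3.ea e3v e2v
  have c3 := hcol m₃ e3v
  have cz := hcol z ezv
  clear hcol hne q1 q3 hm
  -- The vertices `m₀`, `m₁` have the colours of `n₃`, `n₄`. If `z` had the colour of `n₁`, its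
  -- neighbours `m₂`, `m₃` would not, against `x3`; so `m₂` has it by `x1`. Then `m₃` has the colour
  -- of `n₀`, and `z` sees all four colours.
  grind

end CriticalFour

/-- A critical graph is not four-chromatic under the assumptions of `CriticalFour`: every vertex
would have degree five, with a pentagon as its neighbourhood. -/
theorem CriticalFour.false [Finite V] (hG : G.CriticalFour) : False := by
  rcases isEmpty_or_nonempty V with hV | ⟨⟨v⟩⟩
  · exact hG.critical.not_colors (fun _ => 0) ⟨fun u => hV.elim u, fun u => hV.elim u⟩
  obtain ⟨p, a, q, d, e, hW⟩ : ∃ p a q d e, G.Wheel v p a q d e := by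
    obtain ⟨a, b, c, ha, hb, hc, hab, hac, hbc⟩ := hG.critical.exists_three_adj (by norm_num) v
    obtain ⟨d, hd, h1, h2, h3⟩ := hG.critical.exists_adj_ne v a b c
    obtain ⟨e, he, h4, h5, h6, h7⟩ := hG.exists_fifth ha hb hc hd
    have key : ∀ p q, G.Adj v p → G.Adj v q → p ≠ q → G.Adj a p → G.Adj a q →
        ∃ p a q d e, G.Wheel v p a q d e := by
      intro p q hp hq hpq hap haq
      obtain ⟨d, e, h⟩ := hG.exists_wheel_of_path hp ha hq hap.symm haq hpq
      exact ⟨p, a, q, d, e, h⟩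
    have o1 := hG.adj_or_adj_or_eq ha hb hc hd
    have o2 := hG.adj_or_adj_or_eq ha hb hc he
    have o3 := hG.adj_or_adj_or_eq ha hb hd he
    have o4 := hG.adj_or_adj_or_eq ha hc hd he
    have k1 := key b c hb hc hbc
    have k2 := key b d hb hd h2.symm
    have k3 := key b e hb he h5.symm
    have k4 := key c d hc hd h3.symm
    have k5 := key c e hc he h6.symm
    have k6 := key d e hd he h7.symm
    clear key
    by_contra hno
    simp only [hno, imp_false] at k1 k2 k3 k4 k5 k6
    clear hno
    grind
  obtain ⟨f, hf⟩ := hG.critical.colors_compl v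
  -- The five rotations cover all non-adjacent pairs of the pentagon, so it would need five colours.
  have h1 : f p ≠ f q := hG.not_wheel hf hW
  have h2 : f a ≠ f d := hG.not_wheel hf hW.rotate
  have h3 : f q ≠ f e := hG.not_wheel hf hW.rotate.rotate
  have h4 : f d ≠ f p := hG.not_wheel hf hW.rotate.rotate.rotate
  have h5 : f e ≠ f a := hG.not_wheel hf hW.rotate.rotate.rotate.rotate
  have h01 := hf.2 _ hW.va.ne' _ hW.vb.ne' hW.ab
  have h12 := hf.2 _ hW.vb.ne' _ hW.vc.ne' hW.bc
  have h23 := hf.2 _ hW.vc.ne' _ hW.vd.ne' hW.cd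
  have h34 := hf.2 _ hW.vd.ne' _ hW.ve.ne' hW.de
  have h40 := hf.2 _ hW.ve.ne' _ hW.va.ne' hW.ea
  have l0 := hf.1 _ hW.va.ne'
  have l1 := hf.1 _ hW.vb.ne'
  have l2 := hf.1 _ hW.vc.ne'
  have l3 := hf.1 _ hW.vd.ne'
  have l4 := hf.1 _ hW.ve.ne'
  omega

theorem Critical.false_of_cliqueFree_four [Finite V] (hch : G.ChairFree) (h4 : G.CliqueFree 4)
    (h : G.Critical 4)
    (hmin : ∀ s : Set V, s ≠ Set.univ → G.CliqueFreeOn s 3 → ∃ f, G.ColorsOn s 3 f) : False := by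
  classical
  refine CriticalFour.false (G := G) ⟨h, hch, ?_, ?_⟩
  · intro a b c d hab hac had hbc hbd hcd
    exact h4 {a, b, c, d}
      ((is3Clique_triple_iff.2 ⟨hbc, hbd, hcd⟩).insert (by simp [hab, hac, had]))
  · intro W hW hind
    by_contra! hno
    -- If `W` met every triangle, the rest would be three-colourable and `W` could take the fourth
    -- colour.
    obtain ⟨f, hf⟩ := hmin Wᶜ (fun h => by
      obtain ⟨w, hw⟩ := hW
      exact (h ▸ Set.mem_univ w : w ∈ Wᶜ) hw)
      (by
        intro t ht h3
        obtain ⟨a, b, c, hab, hac, hbc, rfl⟩ := is3Clique_iff.1 h3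
        simp only [Finset.coe_insert, Finset.coe_singleton, Set.insert_subset_iff,
          Set.singleton_subset_iff, Set.mem_compl_iff] at ht
        exact hno a b c ht.1 ht.2.1 ht.2.2 hab hac hbc)
    refine h.not_colors (fun u => if u ∈ W then 3 else f u) ⟨fun u _ => ?_, fun u _ w _ huw => ?_⟩
    · by_cases hu : u ∈ W
      · simp [hu]
      · simpa [hu] using (hf.1 u hu).trans (by norm_num)
    · by_cases hu : u ∈ W <;> by_cases hw : w ∈ W
      · exact absurd huw (hind u hu w hw)
      · have := hf.1 w hw
        simp only [hu, hw, if_true, if_false]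
        omega
      · have := hf.1 u hu
        simp only [hu, hw, if_true, if_false]
        omega
      · simpa [hu, hw] using hf.2 u hu w hw huw

/-! ### Clique number at least four: near-twins of big cliques -/

/-- A vertex-critical graph for `k` colours without induced chair or HVN, whose cliques have at
most `m` vertices, where `k` is at least `(3 * m - 1) / 2`. -/
structure CriticalLarge (G : SimpleGraph V) (m k : ℕ) : Prop where
  critical : G.Critical k
  chair : G.ChairFree
  hvn : G.HVNFree
  four_le : 4 ≤ m
  le : 3 * m ≤ 2 * k + 1
  card_le : ∀ s : Finset V, G.IsClique (s : Set V) → s.card ≤ m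

/-- A maximal clique with at least four vertices. -/
structure BigClique (G : SimpleGraph V) (K : Finset V) : Prop where
  adj : ∀ a ∈ K, ∀ b ∈ K, a ≠ b → G.Adj a b
  exists_not_adj : ∀ u, u ∉ K → ∃ q ∈ K, ¬G.Adj u q
  four_le : 4 ≤ K.card

/-- `u` is a vertex outside `K` that is adjacent to all vertices of `K` but `x`. -/
def MissesOnly (G : SimpleGraph V) (K : Finset V) (x u : V) : Prop :=
  u ∉ K ∧ ¬G.Adj u x ∧ ∀ q ∈ K, q ≠ x → G.Adj u q

theorem exists_pair_ne {K : Finset V} (hK : 4 ≤ K.card) (x y : V) :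
    ∃ p ∈ K, ∃ q ∈ K, p ≠ q ∧ p ≠ x ∧ p ≠ y ∧ q ≠ x ∧ q ≠ y := by
  classical
  have h1 := Finset.pred_card_le_card_erase (s := K) (a := x)
  have h2 := Finset.pred_card_le_card_erase (s := K.erase x) (a := y)
  have h3 : 1 < ((K.erase x).erase y).card := by omega
  obtain ⟨p, hp, q, hq, hpq⟩ := Finset.one_lt_card.1 h3
  simp only [Finset.mem_erase] at hp hq
  exact ⟨p, hp.2.2, q, hq.2.2, hpq, hp.2.1, hp.1, hq.2.1, hq.1⟩

namespace BigClique

variable {K : Finset V} (hK : G.BigClique K) (hhv : G.HVNFree)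
include hK hhv

/-- Two non-neighbours of `u` in the clique would form an HVN with `a`, `b` and `u`. -/
theorem missesOnly {u a b x : V} (hu : u ∉ K) (ha : a ∈ K) (hb : b ∈ K) (hab : a ≠ b)
    (hua : G.Adj u a) (hub : G.Adj u b) (hx : x ∈ K) (hux : ¬G.Adj u x) : G.MissesOnly K x u := by
  refine ⟨hu, hux, fun q hq hqx => by_contra fun huq => ?_⟩
  have hadj := hK.adj
  have hax : a ≠ x := by rintro rfl; exact hux hua
  have hbx : b ≠ x := by rintro rfl; exact hux hub
  have haq : a ≠ q := by rintro rfl; exact huq hua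
  have hbq : b ≠ q := by rintro rfl; exact huq hub
  exact hhv a b x q u (hadj a ha b hb hab) (hadj a ha x hx hax) (hadj a ha q hq haq)
    (hadj b hb x hx hbx) (hadj b hb q hq hbq) (hadj x hx q hq hqx.symm) hua hub hux huq

theorem not_adj_of_missesOnly {x i j : V} (hx : x ∈ K) (hi : G.MissesOnly K x i)
    (hj : G.MissesOnly K x j) : ¬G.Adj i j := by
  intro hij
  obtain ⟨p, hp, q, hq, hpq, hpx, -, hqx, -⟩ := exists_pair_ne hK.four_le x x
  exact hhv p q i j x (hK.adj p hp q hq hpq) (hi.2.2 p hp hpx).symm (hj.2.2 p hp hpx).symm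
    (hi.2.2 q hq hqx).symm (hj.2.2 q hq hqx).symm hij (hK.adj x hx p hp hpx.symm)
    (hK.adj x hx q hq hqx.symm) (fun h => hi.2.1 h.symm) (fun h => hj.2.1 h.symm)

theorem not_adj_of_adj_of_not_adj {x x' z q : V} (hx : x ∈ K) (hx' : G.MissesOnly K x x')
    (hzx : G.Adj z x) (hzx' : ¬G.Adj z x') (hq : q ∈ K) (hqx : q ≠ x) : ¬G.Adj z q := by
  intro hzq
  have hz : z ∉ K := fun hz => hzx' (hx'.2.2 z hz hzx.ne).symm
  obtain ⟨r, hr, hzr⟩ := hK.exists_not_adj z hz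
  have hm := hK.missesOnly hhv hz hx hq hqx.symm hzx hzq hr hzr
  have hrx : r ≠ x := by rintro rfl; exact hzr hzx
  obtain ⟨p, hp, s, hs, hps, hpx, hpr, hsx, hsr⟩ := exists_pair_ne hK.four_le x r
  exact hhv p s r x' z (hK.adj p hp s hs hps) (hK.adj p hp r hr hpr) (hx'.2.2 p hp hpx).symm
    (hK.adj s hs r hr hsr) (hx'.2.2 s hs hsx).symm (hx'.2.2 r hr hrx).symm (hm.2.2 p hp hpr)
    (hm.2.2 s hs hsr) hzr hzx'

theorem not_adj_of_adj_missesOnly {x x' z q : V} (hx : x ∈ K) (hx' : G.MissesOnly K x x')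
    (hzx' : G.Adj z x') (hzx : ¬G.Adj z x) (hq : q ∈ K) (hqx : q ≠ x) : ¬G.Adj z q := by
  intro hzq
  have hz : z ∉ K := by
    intro hz
    by_cases h : z = x
    · exact hx'.2.1 (h ▸ hzx'.symm)
    · exact hzx (hK.adj z hz x hx h)
  obtain ⟨p, hp, s, hs, hps, hpx, hpq, hsx, hsq⟩ := exists_pair_ne hK.four_le x q
  have h2 : ∀ p ∈ K, p ≠ x → p ≠ q → ¬G.Adj z p := by
    intro p hp hpx hpq hzp
    exact hK.not_adj_of_missesOnly hhv hx (hK.missesOnly hhv hz hq hp hpq.symm hzq hzp hx hzx) hx'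
      hzx'
  exact hhv q x' p s z (hx'.2.2 q hq hqx).symm (hK.adj q hq p hp hpq.symm)
    (hK.adj q hq s hs hsq.symm) (hx'.2.2 p hp hpx) (hx'.2.2 s hs hsx) (hK.adj p hp s hs hps) hzq
    hzx' (h2 p hp hpx hpq) (h2 s hs hsx hsq)

/-- Two different vertices of a big clique are not both replaceable. -/
theorem eq_of_missesOnly {k : ℕ} (hch : G.ChairFree) (hcr : G.Critical k) {x x' y y' : V}
    (hx : x ∈ K) (hy : y ∈ K) (hx' : G.MissesOnly K x x') (hy' : G.MissesOnly K y y') : x = y := by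
  by_contra hxy
  have hs : ∀ u v, G.Adj u v → G.Adj v u := fun u v => Adj.symm
  obtain ⟨p, hp, q, hq, hpq, hpx, hpy, hqx, hqy⟩ := exists_pair_ne hK.four_le x y
  have axy := hK.adj x hx y hy hxy
  have axp := hK.adj x hx p hp hpx.symm
  have axq := hK.adj x hx q hq hqx.symm
  have ayp := hK.adj y hy p hp hpy.symm
  have ayq := hK.adj y hy q hq hqy.symm
  have apq := hK.adj p hp q hq hpq
  have bxp := hx'.2.2 p hp hpx
  have bxq := hx'.2.2 q hq hqx
  have bxy := hx'.2.2 y hy (Ne.symm hxy)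
  have byp := hy'.2.2 p hp hpy
  have byq := hy'.2.2 q hq hqy
  have byx := hy'.2.2 x hx hxy
  have nx := hx'.2.1
  have ny := hy'.2.1
  have axy' : G.Adj x' y' := by
    by_contra h
    exact hhv p q y x' y' apq ayp.symm bxp.symm ayq.symm bxq.symm bxy.symm byp byq ny
      (fun h' => h h'.symm)
  -- Criticality separates `x` from `x'` by private neighbours `z`, `z'`, and `y` from `y'` by `w`,
  -- `w'`. These miss the rest of the configuration, and chairs make them pairwise adjacent; then
  -- `x` is the centre of a chair with leaves `y`, `y'` and path `x z z'`.
  obtain ⟨z, hxz, nxz⟩ := hcr.exists_adj_not_adj (u := x) (w := x') (fun h => hx'.1 (h ▸ hx))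
  obtain ⟨z', hxz', nxz'⟩ := hcr.exists_adj_not_adj (u := x') (w := x) (fun h => hx'.1 (h ▸ hx))
  obtain ⟨w, hyw, nyw⟩ := hcr.exists_adj_not_adj (u := y) (w := y') (fun h => hy'.1 (h ▸ hy))
  obtain ⟨w', hyw', nyw'⟩ := hcr.exists_adj_not_adj (u := y') (w := y) (fun h => hy'.1 (h ▸ hy))
  have z1 := fun q => hK.not_adj_of_adj_of_not_adj hhv (q := q) hx hx' hxz.symm
    (fun h => nxz h.symm)
  have z2 := fun q => hK.not_adj_of_adj_missesOnly hhv (q := q) hx hx' hxz'.symm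
    (fun h => nxz' h.symm)
  have w1 := fun q => hK.not_adj_of_adj_of_not_adj hhv (q := q) hy hy' hyw.symm
    (fun h => nyw h.symm)
  have w2 := fun q => hK.not_adj_of_adj_missesOnly hhv (q := q) hy hy' hyw'.symm
    (fun h => nyw' h.symm)
  have zp := z1 p hp hpx
  have zq := z1 q hq hqx
  have zy := z1 y hy (Ne.symm hxy)
  have zp' := z2 p hp hpx
  have zq' := z2 q hq hqx
  have zy' := z2 y hy (Ne.symm hxy)
  have wp := w1 p hp hpy
  have wq := w1 q hq hqy
  have wx := w1 x hx hxy
  have wp' := w2 p hp hpy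
  have wq' := w2 q hq hqy
  have wx' := w2 x hx hxy
  have h1 := hhv x y' p q z
  have h2 := hhv x' y' p q z'
  have h3 := hhv y x' p q w
  have h4 := hhv y' x' p q w'
  have c1 := hch y w x' x z
  have c2 := hch y w x x' z'
  have c3 := hch y' w' x' x z
  have c4 := hch y' w' x x' z'
  have c5 := hch z w w' x p
  have c6 := hch w z z' y p
  have c7 := hch x y y' z z'
  clear z1 z2 w1 w2 hch hhv hK hcr hx' hy'
  have d1 : ¬G.Adj z y' := by grind
  have d2 : ¬G.Adj z' y' := by grind
  have d3 : ¬G.Adj w x' := by grind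
  have d4 : ¬G.Adj w' x' := by grind
  have e1 : G.Adj w z := by grind
  have e2 : G.Adj w z' := by grind
  have e3 : G.Adj w' z := by grind
  have e4 : G.Adj w' z' := by grind
  have hne : w ≠ w' := by grind
  have hne' : z ≠ z' := by grind
  have e5 : G.Adj w w' := by grind
  have e6 : G.Adj z z' := by grind
  grind

end BigClique

/-! ### Clique number at least four: twin cliques -/

/-- The vertices that are adjacent to all vertices of `Q`. -/
def completeTo (G : SimpleGraph V) (Q : Finset V) : Set V :=
  {i | ∀ q ∈ Q, G.Adj i q}

/-- A clique `Q` with at least two common neighbours, which are pairwise non-adjacent, such that any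
other vertex with a neighbour in `Q` has no other neighbour in `Q` or common to all of `Q`. -/
structure TwinClique (G : SimpleGraph V) (Q : Finset V) : Prop where
  adj : ∀ a ∈ Q, ∀ b ∈ Q, a ≠ b → G.Adj a b
  three_le : 3 ≤ Q.card
  not_adj : ∀ i ∈ G.completeTo Q, ∀ j ∈ G.completeTo Q, ¬G.Adj i j
  eq_of_adj : ∀ w ∉ G.completeTo Q, w ∉ Q → ∀ q ∈ Q, G.Adj w q → ∀ r ∈ Q, G.Adj w r → r = q
  not_adj_complete : ∀ w ∉ G.completeTo Q, w ∉ Q → ∀ q ∈ Q, G.Adj w q →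
    ∀ i ∈ G.completeTo Q, ¬G.Adj w i
  exists_ne : ∃ i ∈ G.completeTo Q, ∃ j ∈ G.completeTo Q, i ≠ j

/-- An outside vertex with two neighbours in `K` misses a single vertex of `K`. By
`eq_of_missesOnly` this is `x`, so the outside vertex is complete to the rest. -/
theorem BigClique.twinClique [DecidableEq V] {K : Finset V} (hK : G.BigClique K) (hhv : G.HVNFree)
    {k : ℕ} (hch : G.ChairFree) (hcr : G.Critical k) {x x' : V} (hx : x ∈ K)
    (hx' : G.MissesOnly K x x') : G.TwinClique (K.erase x) := by
  have hxI : x ∈ G.completeTo (K.erase x) := fun q hq =>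
    hK.adj x hx q (Finset.mem_of_mem_erase hq) (Finset.ne_of_mem_erase hq).symm
  have hxI' : x' ∈ G.completeTo (K.erase x) := fun q hq =>
    hx'.2.2 q (Finset.mem_of_mem_erase hq) (Finset.ne_of_mem_erase hq)
  have hI : ∀ i ∈ G.completeTo (K.erase x), i ≠ x → G.MissesOnly K x i := by
    intro i hi hix
    have hiK : i ∉ K := fun h => G.loopless.irrefl i (hi i (Finset.mem_erase.2 ⟨hix, h⟩))
    obtain ⟨q, hq, hiq⟩ := hK.exists_not_adj i hiK
    have hqx : q = x := by
      by_contra h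
      exact hiq (hi q (Finset.mem_erase.2 ⟨h, hq⟩))
    exact ⟨hiK, hqx ▸ hiq, fun q hq hqx => hi q (Finset.mem_erase.2 ⟨hqx, hq⟩)⟩
  have hout : ∀ w ∉ G.completeTo (K.erase x), w ∉ K.erase x → ∀ q ∈ K.erase x, G.Adj w q →
      ∀ r ∈ K, G.Adj w r → r = q := by
    intro w hw hwQ q hq hwq r hr hwr
    by_contra hrq
    have hwx : w ≠ x := fun h => hw (h ▸ hxI)
    have hwK : w ∉ K := fun h => hwQ (Finset.mem_erase.2 ⟨hwx, h⟩)
    obtain ⟨s, hs, hws⟩ := hK.exists_not_adj w hwK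
    have hm := hK.missesOnly hhv hwK hr (Finset.mem_of_mem_erase hq) hrq hwr hwq hs hws
    have hsx := hK.eq_of_missesOnly hhv hch hcr hs hx hm hx'
    exact hw fun q hq => hm.2.2 q (Finset.mem_of_mem_erase hq)
      (hsx ▸ Finset.ne_of_mem_erase hq)
  refine ⟨fun a ha b hb => hK.adj a (Finset.mem_of_mem_erase ha) b (Finset.mem_of_mem_erase hb), ?_,
    fun i hi j hj hij => ?_, fun w hw hwQ q hq hwq r hr => hout w hw hwQ q hq hwq r
      (Finset.mem_of_mem_erase hr), fun w hw hwQ q hq hwq i hi hwi => ?_,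
    x, hxI, x', hxI', fun h => hx'.1 (h ▸ hx)⟩
  · have := Finset.card_erase_add_one hx
    have := hK.four_le
    omega
  · by_cases hix : i = x
    · subst hix
      exact (hI j hj hij.ne').2.1 hij.symm
    · by_cases hjx : j = x
      · subst hjx
        exact (hI i hi hix).2.1 hij
      · exact hK.not_adj_of_missesOnly hhv hx (hI i hi hix) (hI j hj hjx) hij
  · by_cases hix : i = x
    · subst hix
      exact Finset.ne_of_mem_erase hq (hout w hw hwQ q hq hwq i hx hwi).symm
    · obtain ⟨p, hp, s, hs, hps, hpx, hpq, hsx, hsq⟩ := exists_pair_ne hK.four_le x q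
      have hqK := Finset.mem_of_mem_erase hq
      have hi' := (hI i hi hix).2.2
      exact hhv q i p s w (hi q hq).symm (hK.adj q hqK p hp hpq.symm) (hK.adj q hqK s hs hsq.symm)
        (hi' p hp hpx) (hi' s hs hsx) (hK.adj p hp s hs hps) hwq hwi
        (fun h => hpq (hout w hw hwQ q hq hwq p hp h))
        (fun h => hsq (hout w hw hwQ q hq hwq s hs h))

namespace TwinClique

variable {Q : Finset V} (hQ : G.TwinClique Q)
include hQ

theorem exists_ne_ne (a b : V) : ∃ p ∈ Q, p ≠ a ∧ p ≠ b := by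
  classical
  have h1 := Finset.pred_card_le_card_erase (s := Q) (a := a)
  have h2 := Finset.pred_card_le_card_erase (s := Q.erase a) (a := b)
  have h3 := hQ.three_le
  have h4 : 0 < ((Q.erase a).erase b).card := by omega
  obtain ⟨p, hp⟩ := Finset.card_pos.1 h4
  simp only [Finset.mem_erase] at hp
  exact ⟨p, hp.2.2, hp.2.1, hp.1⟩

theorem not_adj_of_mixed {z i j q : V} (hi : i ∈ G.completeTo Q) (hj : j ∈ G.completeTo Q)
    (hzi : G.Adj z i) (hzj : ¬G.Adj z j) (hq : q ∈ Q) : ¬G.Adj z q := fun hzq =>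
  hQ.not_adj_complete z (fun hz => hQ.not_adj z hz i hi hzi) (fun hz => hzj (hj z hz).symm) q hq hzq
    i hi hzi

/-- A vertex with a neighbour common to all of `Q` misses at most one such vertex. -/
theorem adj_of_mixed (hch : G.ChairFree) {z i j l : V} (hi : i ∈ G.completeTo Q)
    (hj : j ∈ G.completeTo Q) (hl : l ∈ G.completeTo Q) (hzi : G.Adj z i) (hzj : ¬G.Adj z j)
    (hlj : l ≠ j) : G.Adj z l := by
  by_contra hzl
  obtain ⟨q, hq, -⟩ := hQ.exists_ne_ne z z
  exact hch q j l i z (hj q hq).symm (hl q hq).symm (hi q hq).symm hzi.symm hlj.symm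
    (hQ.not_adj j hj l hl) (hQ.not_adj j hj i hi) (hQ.not_adj l hl i hi)
    (fun h => hQ.not_adj_of_mixed hi hj hzi hzj hq h.symm) (fun h => hzj h.symm)
    (fun h => hzl h.symm)

variable (hch : G.ChairFree) {w q : V} (hw : w ∉ G.completeTo Q) (hwQ : w ∉ Q) (hq : q ∈ Q)
  (hwq : G.Adj w q)
include hch hw hwQ hq hwq

/-- Otherwise `q` is the centre of a chair with leaves `w`, `j` and path `q i z`. -/
theorem adj_mixed {z i j : V} (hi : i ∈ G.completeTo Q) (hj : j ∈ G.completeTo Q)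
    (hzi : G.Adj z i) (hzj : ¬G.Adj z j) : G.Adj w z := by
  by_contra hwz
  have hwI := hQ.not_adj_complete w hw hwQ q hq hwq
  exact hch q w j i z hwq.symm (hj q hq).symm (hi q hq).symm hzi.symm (fun h => hw (h ▸ hj))
    (hwI j hj) (hwI i hi) (hQ.not_adj j hj i hi)
    (fun h => hQ.not_adj_of_mixed hi hj hzi hzj hq h.symm) hwz (fun h => hzj h.symm)

theorem mixed_adj_mixed {z i j z' i' j' : V} (hi : i ∈ G.completeTo Q) (hj : j ∈ G.completeTo Q)
    (hzi : G.Adj z i) (hzj : ¬G.Adj z j) (hi' : i' ∈ G.completeTo Q) (hj' : j' ∈ G.completeTo Q)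
    (hzi' : G.Adj z' i') (hzj' : ¬G.Adj z' j') (hne : z ≠ z') : G.Adj z z' := by
  by_contra hzz
  obtain ⟨p, hp, hpq, -⟩ := hQ.exists_ne_ne q q
  exact hch w z z' q p (hQ.adj_mixed hch hw hwQ hq hwq hi hj hzi hzj)
    (hQ.adj_mixed hch hw hwQ hq hwq hi' hj' hzi' hzj') hwq (hQ.adj q hq p hp hpq.symm) hne hzz
    (hQ.not_adj_of_mixed hi hj hzi hzj hq) (hQ.not_adj_of_mixed hi' hj' hzi' hzj' hq)
    (fun h => hpq (hQ.eq_of_adj w hw hwQ q hq hwq p hp h)) (hQ.not_adj_of_mixed hi hj hzi hzj hp)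
    (hQ.not_adj_of_mixed hi' hj' hzi' hzj' hp)

theorem outer_adj_outer {k : ℕ} (hcr : G.Critical k) {w' q' : V} (hw' : w' ∉ G.completeTo Q)
    (hwQ' : w' ∉ Q) (hq' : q' ∈ Q) (hwq' : G.Adj w' q') (hne : w ≠ w') : G.Adj w w' := by
  by_contra hww
  obtain ⟨i, hi, j, hj, hij⟩ := hQ.exists_ne
  obtain ⟨z, hiz, hjz⟩ := hcr.exists_adj_not_adj hij
  have hzi := hiz.symm
  have hzj : ¬G.Adj z j := fun h => hjz h.symm
  obtain ⟨p, hp, hpq, hpq'⟩ := hQ.exists_ne_ne q q'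
  exact hch z w w' i p (hQ.adj_mixed hch hw hwQ hq hwq hi hj hzi hzj).symm
    (hQ.adj_mixed hch hw' hwQ' hq' hwq' hi hj hzi hzj).symm hzi (hi p hp) hne hww
    (hQ.not_adj_complete w hw hwQ q hq hwq i hi) (hQ.not_adj_complete w' hw' hwQ' q' hq' hwq' i hi)
    (hQ.not_adj_of_mixed hi hj hzi hzj hp) (fun h => hpq (hQ.eq_of_adj w hw hwQ q hq hwq p hp h))
    (fun h => hpq' (hQ.eq_of_adj w' hw' hwQ' q' hq' hwq' p hp h))

/-- Vertices `a`, `b`, `c` that separate pairs of `i`, `j`, `l` would form a `K₄` with `w`, in which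
`l` sees only `a` and `b`: an HVN. -/
theorem not_three_complete {k : ℕ} (hhv : G.HVNFree) (hcr : G.Critical k) {i j l : V}
    (hi : i ∈ G.completeTo Q) (hj : j ∈ G.completeTo Q) (hl : l ∈ G.completeTo Q) (hij : i ≠ j)
    (hil : i ≠ l) (hjl : j ≠ l) : False := by
  obtain ⟨a, hja, hia⟩ := hcr.exists_adj_not_adj hij.symm
  obtain ⟨b, hib, hjb⟩ := hcr.exists_adj_not_adj hij
  obtain ⟨c, hic, hlc⟩ := hcr.exists_adj_not_adj hil
  have hal := hQ.adj_of_mixed hch hj hi hl hja.symm (fun h => hia h.symm) hil.symm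
  have hbl := hQ.adj_of_mixed hch hi hj hl hib.symm (fun h => hjb h.symm) hjl.symm
  have hcj := hQ.adj_of_mixed hch hi hl hj hic.symm (fun h => hlc h.symm) hjl
  have wa := hQ.adj_mixed hch hw hwQ hq hwq hj hi hja.symm (fun h => hia h.symm)
  have wb := hQ.adj_mixed hch hw hwQ hq hwq hi hj hib.symm (fun h => hjb h.symm)
  have wc := hQ.adj_mixed hch hw hwQ hq hwq hi hl hic.symm (fun h => hlc h.symm)
  refine hhv a b w c l ?_ wa.symm ?_ wb.symm ?_ wc hal.symm hbl.symm
    (fun h => hQ.not_adj_complete w hw hwQ q hq hwq l hl h.symm) hlc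
  · exact hQ.mixed_adj_mixed hch hw hwQ hq hwq hj hi hja.symm (fun h => hia h.symm) hi hj hib.symm
      (fun h => hjb h.symm) (by rintro rfl; exact hia hib)
  · exact hQ.mixed_adj_mixed hch hw hwQ hq hwq hj hi hja.symm (fun h => hia h.symm) hi hl hic.symm
      (fun h => hlc h.symm) (by rintro rfl; exact hia hic)
  · exact hQ.mixed_adj_mixed hch hw hwQ hq hwq hi hj hib.symm (fun h => hjb h.symm) hi hl hic.symm
      (fun h => hlc h.symm) (by rintro rfl; exact hjb hcj.symm)

end TwinClique

/-- If such an edge existed, only two vertices would be complete to `Q`, and the degree bound would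
give every vertex of `Q` at least `k - m` further neighbours. For three vertices of `Q` these sets
are disjoint, and with `z`, `z'` they form a clique of at least `3(k - m) + 2 > m` vertices. -/
theorem CriticalLarge.not_adj_of_twinClique [Finite V] {m k : ℕ} (h : G.CriticalLarge m k)
    {Q : Finset V} (hQ : G.TwinClique Q) (hQm : Q.card < m) {w q : V} (hw : w ∉ G.completeTo Q)
    (hwQ : w ∉ Q) (hq : q ∈ Q) : ¬G.Adj w q := by
  classical
  have := Fintype.ofFinite V
  intro hwq
  have hch := h.chair
  have hcr := h.critical
  obtain ⟨i, hi, j, hj, hij⟩ := hQ.exists_ne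
  have hI : ∀ l ∈ G.completeTo Q, l = i ∨ l = j := by
    intro l hl
    by_contra! hne
    exact hQ.not_three_complete hch hw hwQ hq hwq h.hvn hcr hi hj hl hij hne.1.symm hne.2.symm
  obtain ⟨z, hiz, hjz⟩ := hcr.exists_adj_not_adj hij
  obtain ⟨z', hjz', hiz'⟩ := hcr.exists_adj_not_adj hij.symm
  have hzz : G.Adj z z' := hQ.mixed_adj_mixed hch hw hwQ hq hwq hi hj hiz.symm
    (fun h => hjz h.symm) hj hi hjz'.symm (fun h => hiz' h.symm) (by rintro rfl; exact hjz hjz')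
  have hzQ : ∀ q ∈ Q, ¬G.Adj z q := fun q =>
    hQ.not_adj_of_mixed hi hj hiz.symm (fun h => hjz h.symm)
  have hzQ' : ∀ q ∈ Q, ¬G.Adj z' q := fun q =>
    hQ.not_adj_of_mixed hj hi hjz'.symm (fun h => hiz' h.symm)
  let W : V → Finset V := fun q => {w | w ∉ G.completeTo Q ∧ w ∉ Q ∧ G.Adj w q}
  have hWcard : ∀ q ∈ Q, k ≤ m + (W q).card := by
    intro q hq
    have h1 := hcr.le_card (v := q) (t := (Q.erase q ∪ {i, j}) ∪ W q) fun n hqn => by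
      by_cases hnQ : n ∈ Q
      · simp [hnQ, hqn.ne']
      · by_cases hnI : n ∈ G.completeTo Q
        · rcases hI n hnI with rfl | rfl <;> simp
        · simp [W, hnQ, hnI, hqn.symm]
    have h2 := Finset.card_union_le (Q.erase q ∪ {i, j}) (W q)
    have h3 := Finset.card_union_le (Q.erase q) {i, j}
    have h4 := Finset.card_erase_add_one hq
    have h5 : ({i, j} : Finset V).card ≤ 2 := Finset.card_le_two
    omega
  obtain ⟨p, r, s, hp, hr, hs, hpr, hps, hrs⟩ := Finset.two_lt_card_iff.1 hQ.three_le
  have hdisj : ∀ p ∈ Q, ∀ r ∈ Q, p ≠ r → Disjoint (W p) (W r) := by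
    intro p hp r hr hpr
    rw [Finset.disjoint_left]
    intro a ha hb
    simp only [W, Finset.mem_filter, Finset.mem_univ, true_and] at ha hb
    exact hpr (hQ.eq_of_adj a ha.1 ha.2.1 r hr hb.2.2 p hp ha.2.2)
  have hWz : ∀ q ∈ Q, ∀ a ∈ W q, a ≠ z ∧ a ≠ z' ∧ G.Adj a z ∧ G.Adj a z' := by
    intro q hq a ha
    simp only [W, Finset.mem_filter, Finset.mem_univ, true_and] at ha
    refine ⟨?_, ?_, hQ.adj_mixed hch ha.1 ha.2.1 hq ha.2.2 hi hj hiz.symm (fun h => hjz h.symm),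
      hQ.adj_mixed hch ha.1 ha.2.1 hq ha.2.2 hj hi hjz'.symm (fun h => hiz' h.symm)⟩
    · rintro rfl; exact hzQ q hq ha.2.2
    · rintro rfl; exact hzQ' q hq ha.2.2
  have hW : ∀ a ∈ (W p ∪ W r) ∪ W s, ∃ q ∈ Q, a ∈ W q := by
    intro a ha
    simp only [Finset.mem_union] at ha
    rcases ha with (ha | ha) | ha
    exacts [⟨p, hp, ha⟩, ⟨r, hr, ha⟩, ⟨s, hs, ha⟩]
  have hcl : G.IsClique (((W p ∪ W r) ∪ W s ∪ {z, z'} : Finset V) : Set V) := by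
    intro a ha b hb hab
    simp only [Finset.coe_union _ ({z, z'} : Finset V), Set.mem_union, Finset.mem_coe] at ha hb
    simp only [Finset.mem_insert, Finset.mem_singleton] at ha hb
    rcases ha with ha | ha <;> rcases hb with hb | hb
    · obtain ⟨q, hq, ha⟩ := hW a ha
      obtain ⟨q', hq', hb⟩ := hW b hb
      simp only [W, Finset.mem_filter, Finset.mem_univ, true_and] at ha hb
      exact hQ.outer_adj_outer hch ha.1 ha.2.1 hq ha.2.2 hcr hb.1 hb.2.1 hq' hb.2.2 hab
    · obtain ⟨q, hq, ha⟩ := hW a ha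
      have := hWz q hq a ha
      rcases hb with rfl | rfl
      exacts [this.2.2.1, this.2.2.2]
    · obtain ⟨q, hq, hb⟩ := hW b hb
      have := hWz q hq b hb
      rcases ha with rfl | rfl
      exacts [this.2.2.1.symm, this.2.2.2.symm]
    · rcases ha with rfl | rfl <;> rcases hb with rfl | rfl
      exacts [absurd rfl hab, hzz, hzz.symm, absurd rfl hab]
  have hc := h.card_le _ hcl
  rw [Finset.card_union_of_disjoint, Finset.card_union_of_disjoint,
    Finset.card_union_of_disjoint (hdisj p hp r hr hpr), Finset.card_pair hzz.ne] at hc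
  · have := hWcard p hp
    have := hWcard r hr
    have := hWcard s hs
    have := h.le
    omega
  · rw [Finset.disjoint_union_left]
    exact ⟨hdisj p hp s hs hps, hdisj r hr s hs hrs⟩
  · rw [Finset.disjoint_left]
    intro a ha haz
    obtain ⟨q, hq, ha⟩ := hW a ha
    have := hWz q hq a ha
    simp only [Finset.mem_insert, Finset.mem_singleton] at haz
    exact haz.elim this.1 this.2.1

/-- `d` has the colour of `i`, is adjacent to the other common neighbours of `Q`, and is not in or
complete to `Q`. -/
structure ColorMate (G : SimpleGraph V) (Q : Finset V) (f : V → ℕ) (i d : V) : Prop where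
  notMem : d ∉ Q
  not_complete : d ∉ G.completeTo Q
  color_eq : f d = f i
  not_adj : ¬G.Adj d i
  adj : ∀ l ∈ G.completeTo Q, l ≠ i → G.Adj d l

theorem notMem_of_mem_completeTo {Q : Finset V} {i : V} (hi : i ∈ G.completeTo Q) : i ∉ Q :=
  fun h => G.loopless.irrefl i (hi i h)

namespace TwinClique

variable {Q : Finset V} (hQ : G.TwinClique Q) {k : ℕ} (hQk : Q.card < k) (hcr : G.Critical k)
  (hout : ∀ w ∉ G.completeTo Q, w ∉ Q → ∀ q ∈ Q, ¬G.Adj w q) {f : V → ℕ}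
  (hf : G.ColorsOn (Q : Set V)ᶜ k f)
include hQ hQk hcr hout hf

omit hQ in
-- The neighbours of `Q` outside `Q` are complete to it. If all these have the colour `c`, the other
-- `k - 1 ≥ |Q|` colours suffice for `Q`.
theorem not_monochromatic {c : ℕ} (hc : ∀ i ∈ G.completeTo Q, f i = c) : False := by
  classical
  have hcard : Fintype.card Q ≤ Fintype.card ((Finset.range k).erase c) := by
    have := Finset.pred_card_le_card_erase (s := Finset.range k) (a := c)
    rw [Fintype.card_coe, Fintype.card_coe]
    rw [Finset.card_range] at this
    omega
  obtain ⟨e⟩ := Function.Embedding.nonempty_of_card_le hcard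
  have he : ∀ q : Q, (e q : ℕ) < k ∧ (e q : ℕ) ≠ c := fun q => by
    have := (e q).2
    rw [Finset.mem_erase, Finset.mem_range] at this
    exact this.symm
  have hmix : ∀ q : Q, ∀ w ∉ Q, G.Adj q w → (e q : ℕ) ≠ f w := by
    intro q w hw hqw
    have hwI : w ∈ G.completeTo Q := by
      by_contra h
      exact hout w h hw q q.2 hqw.symm
    rw [hc w hwI]
    exact (he q).2
  refine hcr.not_colors (fun u => if hu : u ∈ Q then (e ⟨u, hu⟩ : ℕ) else f u) ⟨fun u _ => ?_,
    fun u _ w _ huw => ?_⟩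
  · by_cases hu : u ∈ Q
    · simpa [hu] using (he ⟨u, hu⟩).1
    · simpa [hu] using hf.1 u hu
  · by_cases hu : u ∈ Q <;> by_cases hw : w ∈ Q
    · simpa [hu, hw] using fun h => huw.ne
        (congrArg Subtype.val (e.injective (Subtype.ext h : e ⟨u, hu⟩ = e ⟨w, hw⟩)))
    · simpa [hu, hw] using hmix ⟨u, hu⟩ w hw huw
    · simpa [hu, hw] using (hmix ⟨w, hw⟩ u hu huw.symm).symm
    · simpa [hu, hw] using hf.2 u hu w hw huw

/-- Otherwise all vertices complete to `Q` could be recoloured with `c`, against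
`not_monochromatic`. -/
theorem exists_adj_complete {c : ℕ} (hc : c < k) :
    ∃ u ∉ Q, u ∉ G.completeTo Q ∧ f u = c ∧ ∃ i ∈ G.completeTo Q, G.Adj u i := by
  classical
  by_contra! hno
  refine not_monochromatic hQk hcr hout
    (f := fun u => if u ∈ G.completeTo Q then c else f u) (c := c) ⟨fun u hu => ?_,
    fun u hu w hw huw => ?_⟩ (fun i hi => by simp [hi])
  · by_cases huI : u ∈ G.completeTo Q
    · simpa [huI] using hc
    · simpa [huI] using hf.1 u hu
  · by_cases huI : u ∈ G.completeTo Q <;> by_cases hwI : w ∈ G.completeTo Q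
    · exact absurd huw (hQ.not_adj u huI w hwI)
    · simpa [huI, hwI] using fun h => hno w hw hwI h.symm u huI huw.symm
    · simpa [huI, hwI] using fun h => hno u hu huI h w hwI huw
    · simpa [huI, hwI] using hf.2 u hu w hw huw

variable (hch : G.ChairFree)
include hch

/-- A vertex of the common colour that sees some vertex complete to `Q` would miss both `i` and `j`,
but it can miss only one. -/
theorem injective_on {i j : V} (hi : i ∈ G.completeTo Q) (hj : j ∈ G.completeTo Q)
    (hij : f i = f j) : i = j := by
  by_contra hne
  have hiQ := notMem_of_mem_completeTo hi
  have hjQ := notMem_of_mem_completeTo hj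
  obtain ⟨u, huQ, -, hfu, l, hl, hul⟩ := hQ.exists_adj_complete hQk hcr hout hf (hf.1 i hiQ)
  have hui : ¬G.Adj u i := fun h => hf.2 u huQ i hiQ h hfu
  have huj : ¬G.Adj u j := fun h => hf.2 u huQ j hjQ h (hfu.trans hij)
  exact huj (hQ.adj_of_mixed hch hl hi hj hul hui (Ne.symm hne))

omit hQk hcr hout in
theorem colorMate {i d l : V} (hi : i ∈ G.completeTo Q) (hdQ : d ∉ Q) (hdI : d ∉ G.completeTo Q)
    (hd : f d = f i) (hl : l ∈ G.completeTo Q) (hdl : G.Adj d l) : G.ColorMate Q f i d := by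
  have hdi : ¬G.Adj d i := fun h => hf.2 d hdQ i (notMem_of_mem_completeTo hi) h hd
  exact ⟨hdQ, hdI, hd, hdi, fun j hj hji => hQ.adj_of_mixed hch hl hi hj hdl hdi hji⟩

theorem exists_colorMate {i : V} (hi : i ∈ G.completeTo Q) : ∃ d, G.ColorMate Q f i d := by
  obtain ⟨d, hdQ, hdI, hd, l, hl, hdl⟩ := hQ.exists_adj_complete hQk hcr hout hf
    (hf.1 i (notMem_of_mem_completeTo hi))
  exact ⟨d, hQ.colorMate hf hch hi hdQ hdI hd hl hdl⟩

/-- Otherwise `i` and `j` lie on different Kempe chains, and an exchange gives them the same colour,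
against `injective_on`. -/
theorem exists_colorMate_adj {i j l : V} (hi : i ∈ G.completeTo Q) (hj : j ∈ G.completeTo Q)
    (hl : l ∈ G.completeTo Q) (hij : i ≠ j) (hli : l ≠ i) (hlj : l ≠ j) :
    ∃ a b, G.ColorMate Q f i a ∧ G.ColorMate Q f j b ∧ G.Adj a b := by
  by_contra! hno
  have hiQ := notMem_of_mem_completeTo hi
  have hjQ := notMem_of_mem_completeTo hj
  have hfij : f i ≠ f j := fun h => hij (hQ.injective_on hQk hcr hout hf hch hi hj h)
  have hnr : ¬(G.kempe (Q : Set V)ᶜ f (f i) (f j)).Reachable i j := by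
    intro hr
    -- A closed set that contains the chain of `i`: beyond `i` and the mates of `j` there are only
    -- vertices of the colour of `i` without neighbours complete to `Q`. The chain cannot leave
    -- these for another such vertex, by a chair with leaves `i` and `l`.
    have := hr.mem_of_closed
      (s := {t | t = i ∨ G.ColorMate Q f j t ∨ f t = f i ∧ (∀ l ∈ G.completeTo Q, ¬G.Adj t l) ∧
        ∃ d, G.ColorMate Q f j d ∧ G.Adj t d}) (Or.inl rfl) ?_
    · rcases this with h | h | h
      · exact hij h.symm
      · exact h.not_complete hj
      · exact hfij h.1.symm
    rintro u hu t ⟨hut, huQ, htQ, hcol⟩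
    rcases hu with rfl | hu | ⟨hu, huI, d, hd, hud⟩
    · have ht : f t = f j := by
        rcases hcol with h | h
        exacts [h.2, absurd h.1 hfij]
      exact Or.inr (Or.inl (hQ.colorMate hf hch hj htQ
        (fun htI => hQ.not_adj u hi t htI hut) ht hi hut.symm))
    · have ht : f t = f i := by
        rcases hcol with h | h
        exacts [absurd (h.1.symm.trans hu.color_eq) hfij, h.2]
      by_cases htI : t ∈ G.completeTo Q
      · exact Or.inl (hQ.injective_on hQk hcr hout hf hch htI hi ht)
      · by_cases htN : ∃ l ∈ G.completeTo Q, G.Adj t l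
        · obtain ⟨l, hl, htl⟩ := htN
          exact absurd hut.symm (hno t u (hQ.colorMate hf hch hi htQ htI ht hl htl) hu)
        · push Not at htN
          exact Or.inr (Or.inr ⟨ht, htN, u, hu, hut.symm⟩)
    · have ht : f t = f j := by
        rcases hcol with h | h
        exacts [h.2, absurd (hu.symm.trans h.1) hfij]
      have htI : t ∉ G.completeTo Q := fun htI => huI t htI hut
      by_cases htN : ∃ l ∈ G.completeTo Q, G.Adj t l
      · obtain ⟨l, hl, htl⟩ := htN
        exact Or.inr (Or.inl (hQ.colorMate hf hch hj htQ htI ht hl htl))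
      · push Not at htN
        exact (hch d i l u t (hd.adj i hi hij) (hd.adj l hl hlj) hud.symm hut hli.symm
          (hQ.not_adj i hi l hl) (fun h => huI i hi h.symm) (fun h => huI l hl h.symm)
          (fun h => hf.2 d hd.notMem t htQ h (hd.color_eq.trans ht.symm))
          (fun h => htN i hi h.symm) (fun h => htN l hl h.symm)).elim
  refine hij (hQ.injective_on hQk hcr hout (hf.kempeSwap (hf.1 i hiQ) (hf.1 j hjQ) i) hch hi hj ?_)
  rw [kempeSwap_self, kempeSwap_of_not_reachable hnr, Equiv.swap_apply_left]

omit hQ hQk hcr in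
theorem colorMate_adj_of_adj {i j q a b d : V} (hj : j ∈ G.completeTo Q)
    (hij : i ≠ j) (hq : q ∈ Q) (ha : G.ColorMate Q f i a) (hb : G.ColorMate Q f i b)
    (hd : G.ColorMate Q f j d) (hbd : G.Adj b d) : G.Adj a d := by
  by_contra had
  have hne : a ≠ b := by rintro rfl; exact had hbd
  exact hch j q a b d (hj q hq) (ha.adj j hj hij.symm).symm (hb.adj j hj hij.symm).symm hbd
    (fun h => ha.notMem (h ▸ hq)) (fun h => hout a ha.not_complete ha.notMem q hq h.symm)
    (fun h => hout b hb.not_complete hb.notMem q hq h.symm)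
    (fun h => hf.2 a ha.notMem b hb.notMem h (ha.color_eq.trans hb.color_eq.symm))
    (fun h => hd.not_adj h.symm) (fun h => hout d hd.not_complete hd.notMem q hq h.symm) had

theorem colorMate_adj {i j l a d : V} (hi : i ∈ G.completeTo Q) (hj : j ∈ G.completeTo Q)
    (hl : l ∈ G.completeTo Q) (hij : i ≠ j) (hli : l ≠ i) (hlj : l ≠ j)
    (ha : G.ColorMate Q f i a) (hd : G.ColorMate Q f j d) : G.Adj a d := by
  obtain ⟨q, hq, -⟩ := hQ.exists_ne_ne a a
  obtain ⟨b, e, hb, he, hbe⟩ := hQ.exists_colorMate_adj hQk hcr hout hf hch hi hj hl hij hli hlj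
  have hae := colorMate_adj_of_adj hout hf hch hj hij hq ha hb he hbe
  exact (colorMate_adj_of_adj hout hf hch hi hij.symm hq hd he ha hae.symm).symm

end TwinClique

/-- By the degree bound at least four vertices `x`, `y`, `z`, `w` are complete to `Q`. Colour mates
`a`, `b`, `c` of the first three are pairwise adjacent and form a `K₄` with `w`, in which `x` sees
only `b` and `c`: an HVN. -/
theorem CriticalLarge.not_twinClique [Finite V] {m k : ℕ} (h : G.CriticalLarge m k)
    {Q : Finset V} (hQm : Q.card < m) : ¬G.TwinClique Q := by
  classical
  have := Fintype.ofFinite V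
  intro hQ
  have hch := h.chair
  have hcr := h.critical
  have h1 := h.le
  have h2 := h.four_le
  have hQk : Q.card < k := by omega
  have hout : ∀ w ∉ G.completeTo Q, w ∉ Q → ∀ q ∈ Q, ¬G.Adj w q := fun w hw hwQ q hq =>
    h.not_adj_of_twinClique hQ hQm hw hwQ hq
  obtain ⟨v, -⟩ := hQ.exists_ne
  obtain ⟨q, hq, -⟩ := hQ.exists_ne_ne v v
  have hcard : 3 < (G.completeTo Q).toFinset.card := by
    have h3 := hcr.le_card (v := q) (t := Q.erase q ∪ (G.completeTo Q).toFinset) fun n hqn => by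
      by_cases hnQ : n ∈ Q
      · simp [hnQ, hqn.ne']
      · have : n ∈ G.completeTo Q := by
          by_contra hnI
          exact hout n hnI hnQ q hq hqn.symm
        simp [this]
    have h4 := Finset.card_union_le (Q.erase q) (G.completeTo Q).toFinset
    have h5 := Finset.card_erase_add_one hq
    omega
  obtain ⟨t, ht, ht4⟩ := Finset.exists_subset_card_eq (Nat.succ_le_of_lt hcard)
  obtain ⟨x, y, z, w, hxy, hxz, hxw, hyz, hyw, hzw, rfl⟩ := Finset.card_eq_four.1 ht4
  have hx : x ∈ G.completeTo Q := Set.mem_toFinset.1 (ht (by simp))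
  have hy : y ∈ G.completeTo Q := Set.mem_toFinset.1 (ht (by simp))
  have hz : z ∈ G.completeTo Q := Set.mem_toFinset.1 (ht (by simp))
  have hw : w ∈ G.completeTo Q := Set.mem_toFinset.1 (ht (by simp))
  obtain ⟨f, hf⟩ := hcr.colors_compl q
  replace hf : G.ColorsOn (Q : Set V)ᶜ k f :=
    hf.mono (fun u hu huq => hu (by rw [Set.mem_singleton_iff.1 huq]; exact hq)) le_rfl
  obtain ⟨a, ha⟩ := hQ.exists_colorMate hQk hcr hout hf hch hx
  obtain ⟨b, hb⟩ := hQ.exists_colorMate hQk hcr hout hf hch hy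
  obtain ⟨c, hc⟩ := hQ.exists_colorMate hQk hcr hout hf hch hz
  have hab := hQ.colorMate_adj hQk hcr hout hf hch hx hy hw hxy hxw.symm hyw.symm ha hb
  have hac := hQ.colorMate_adj hQk hcr hout hf hch hx hz hw hxz hxw.symm hzw.symm ha hc
  have hbc := hQ.colorMate_adj hQk hcr hout hf hch hy hz hw hyz hyw.symm hzw.symm hb hc
  exact h.hvn b c a w x hbc hab.symm (hb.adj w hw hyw.symm) hac.symm (hc.adj w hw hzw.symm)
    (ha.adj w hw hxw.symm) (hb.adj x hx hxy).symm (hc.adj x hx hxz).symm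
    (fun h => ha.not_adj h.symm) (hQ.not_adj x hx w hw)

/-! ### Clique number at least four: the structure of a line graph -/

/-- A vertex outside a big clique has at most one neighbour in it. -/
theorem CriticalLarge.eq_of_adj_bigClique [Finite V] {m k : ℕ} (h : G.CriticalLarge m k)
    {K : Finset V} (hK : G.BigClique K) {u a b : V} (hu : u ∉ K) (ha : a ∈ K) (hb : b ∈ K)
    (hua : G.Adj u a) (hub : G.Adj u b) : a = b := by
  classical
  by_contra hab
  obtain ⟨x, hx, hux⟩ := hK.exists_not_adj u hu
  refine h.not_twinClique (Q := K.erase x) ?_ (hK.twinClique h.hvn h.chair h.critical hx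
    (hK.missesOnly h.hvn hu ha hb hab hua hub hx hux))
  have := Finset.card_erase_add_one hx
  have := h.card_le K fun a ha b hb hab => hK.adj a ha b hb hab
  omega

namespace CriticalLarge

variable [Finite V] {m k : ℕ} (h : G.CriticalLarge m k) {K : Finset V} (hK : G.BigClique K)
include h hK

theorem exists_three_outer {y : V} (hy : y ∈ K) : ∃ a b c, a ≠ b ∧ a ≠ c ∧ b ≠ c ∧
    (a ∉ K ∧ G.Adj a y) ∧ (b ∉ K ∧ G.Adj b y) ∧ (c ∉ K ∧ G.Adj c y) := by
  classical
  have := Fintype.ofFinite V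
  let Z : Finset V := {u | u ∉ K ∧ G.Adj u y}
  -- The degree is at least `k`, and `k - (m - 1) ≥ (m + 1) / 2 > 2` since `m ≥ 4`.
  have hZ : 2 < Z.card := by
    have h1 := h.critical.le_card (v := y) (t := K.erase y ∪ Z) fun n hn => by
      by_cases hnK : n ∈ K
      · simp [hnK, hn.ne']
      · simp [Z, hnK, hn.symm]
    have h2 := Finset.card_union_le (K.erase y) Z
    have h3 := Finset.card_erase_add_one hy
    have h4 := h.card_le K fun a ha b hb hab => hK.adj a ha b hb hab
    have h5 := h.le
    have h6 := h.four_le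
    omega
  obtain ⟨a, b, c, ha, hb, hc, hab, hac, hbc⟩ := Finset.two_lt_card_iff.1 hZ
  simp only [Z, Finset.mem_filter, Finset.mem_univ, true_and] at ha hb hc
  exact ⟨a, b, c, hab, hac, hbc, ha, hb, hc⟩

/-- Otherwise `z` is the centre of a chair with leaves `u`, `u'` and path `z x p`, where `p` is a
further vertex of the clique. -/
theorem outer_adj_outer_of_adj {x y y' z u u' : V} (hx : x ∈ K) (hz : z ∉ K) (hzx : G.Adj z x)
    (hy : y ∈ K) (hyx : y ≠ x) (hy' : y' ∈ K) (hyx' : y' ≠ x) (hu : u ∉ K) (huy : G.Adj u y)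
    (hu' : u' ∉ K) (huy' : G.Adj u' y') (hzu : G.Adj z u) (hzu' : G.Adj z u') (hne : u ≠ u') :
    G.Adj u u' := by
  classical
  by_contra huu
  have hcard : 0 < (K \ {x, y, y'}).card := by
    have h1 := Finset.le_card_sdiff {x, y, y'} K
    have h2 : ({x, y, y'} : Finset V).card ≤ 3 := Finset.card_le_three
    have h3 := hK.four_le
    omega
  obtain ⟨p, hp⟩ := Finset.card_pos.1 hcard
  simp only [Finset.mem_sdiff, Finset.mem_insert, Finset.mem_singleton, not_or] at hp
  obtain ⟨hp, hpx, hpy, hpy'⟩ := hp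
  exact h.chair z u u' x p hzu hzu' hzx (hK.adj x hx p hp (Ne.symm hpx)) hne huu
    (fun hux => hyx (h.eq_of_adj_bigClique hK hu hy hx huy hux))
    (fun hux => hyx' (h.eq_of_adj_bigClique hK hu' hy' hx huy' hux))
    (fun hzp => hpx (h.eq_of_adj_bigClique hK hz hp hx hzp hzx))
    (fun hup => hpy (h.eq_of_adj_bigClique hK hu hp hy hup huy))
    (fun hup => hpy' (h.eq_of_adj_bigClique hK hu' hp hy' hup huy'))

/-- If `z` and `z'` were not adjacent, chairs at `x` would make every outer neighbour of another
vertex `y` of the clique adjacent to `z` or `z'`. As `y` has three of them, one of `z`, `z'` sees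
two, and the same one does so for two vertices `y`, `y'`. The four vertices form a `K₄` in which `y`
sees exactly two: an HVN. -/
theorem outer_adj_outer {x z z' : V} (hx : x ∈ K) (hz : z ∉ K) (hzx : G.Adj z x) (hz' : z' ∉ K)
    (hzx' : G.Adj z' x) (hne : z ≠ z') : G.Adj z z' := by
  classical
  by_contra hzz
  let P : V → V → Prop := fun s y => ∃ u w, u ≠ w ∧ (u ∉ K ∧ G.Adj u y) ∧ (w ∉ K ∧ G.Adj w y) ∧
    G.Adj s u ∧ G.Adj s w
  have hP : ∀ s, s ∉ K → G.Adj s x → ∀ y ∈ K, y ≠ x → ∀ y' ∈ K, y' ≠ x → y ≠ y' → P s y →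
      ¬P s y' := by
    rintro s hs hsx y hy hyx y' hy' hyx' hyy ⟨a, b, hab, ha, hb, hsa, hsb⟩
      ⟨c, d, hcd, hc, hd, hsc, hsd⟩
    have hne : ∀ a, a ∉ K → G.Adj a y → ¬G.Adj a y' := fun a ha hay hay' =>
      hyy (h.eq_of_adj_bigClique hK ha hy hy' hay hay')
    have hadj : ∀ a b, a ∉ K → b ∉ K → G.Adj a y → G.Adj b y' → G.Adj s a → G.Adj s b →
        G.Adj a b := fun a b ha hb hay hby hsa hsb =>
      h.outer_adj_outer_of_adj hK hx hs hsx hy hyx hy' hyx' ha hay hb hby hsa hsb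
        (fun hab => hne a ha hay (hab ▸ hby))
    exact h.hvn a b c d y
      (h.outer_adj_outer_of_adj hK hx hs hsx hy hyx hy hyx ha.1 ha.2 hb.1 hb.2 hsa hsb hab)
      (hadj a c ha.1 hc.1 ha.2 hc.2 hsa hsc) (hadj a d ha.1 hd.1 ha.2 hd.2 hsa hsd)
      (hadj b c hb.1 hc.1 hb.2 hc.2 hsb hsc) (hadj b d hb.1 hd.1 hb.2 hd.2 hsb hsd)
      (h.outer_adj_outer_of_adj hK hx hs hsx hy' hyx' hy' hyx' hc.1 hc.2 hd.1 hd.2 hsc hsd hcd)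
      ha.2.symm hb.2.symm (fun hyc => hne c hc.1 hyc.symm hc.2)
      (fun hyd => hne d hd.1 hyd.symm hd.2)
  have hside : ∀ y ∈ K, y ≠ x → ∀ u, u ∉ K → G.Adj u y → G.Adj z u ∨ G.Adj z' u := by
    intro y hy hyx u hu huy
    by_contra! hzu
    exact h.chair x z z' y u hzx.symm hzx'.symm (hK.adj x hx y hy hyx.symm) huy.symm hne hzz
      (fun hzy => hyx (h.eq_of_adj_bigClique hK hz hy hx hzy hzx))
      (fun hzy => hyx (h.eq_of_adj_bigClique hK hz' hy hx hzy hzx'))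
      (fun hxu => hyx (h.eq_of_adj_bigClique hK hu hy hx huy hxu.symm)) hzu.1 hzu.2
  have hor : ∀ y ∈ K, y ≠ x → P z y ∨ P z' y := by
    intro y hy hyx
    obtain ⟨a, b, c, hab, hac, hbc, ha, hb, hc⟩ := h.exists_three_outer hK hy
    have h1 := hside y hy hyx a ha.1 ha.2
    have h2 := hside y hy hyx b hb.1 hb.2
    have h3 := hside y hy hyx c hc.1 hc.2
    rcases h1 with h1 | h1 <;> rcases h2 with h2 | h2 <;> rcases h3 with h3 | h3
    exacts [.inl ⟨a, b, hab, ha, hb, h1, h2⟩, .inl ⟨a, b, hab, ha, hb, h1, h2⟩,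
      .inl ⟨a, c, hac, ha, hc, h1, h3⟩, .inr ⟨b, c, hbc, hb, hc, h2, h3⟩,
      .inl ⟨b, c, hbc, hb, hc, h2, h3⟩, .inr ⟨a, c, hac, ha, hc, h1, h3⟩,
      .inr ⟨a, b, hab, ha, hb, h1, h2⟩, .inr ⟨a, b, hab, ha, hb, h1, h2⟩]
  have hcard : 2 < (K.erase x).card := by
    have := Finset.card_erase_add_one hx
    have := hK.four_le
    omega
  obtain ⟨a, b, c, ha, hb, hc, hab, hac, hbc⟩ := Finset.two_lt_card_iff.1 hcard
  rw [Finset.mem_erase] at ha hb hc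
  have hz1 := hP z hz hzx
  have hz2 := hP z' hz' hzx'
  rcases hor a ha.2 ha.1 with h1 | h1 <;> rcases hor b hb.2 hb.1 with h2 | h2 <;>
    rcases hor c hc.2 hc.1 with h3 | h3
  · exact hz1 a ha.2 ha.1 b hb.2 hb.1 hab h1 h2
  · exact hz1 a ha.2 ha.1 b hb.2 hb.1 hab h1 h2
  · exact hz1 a ha.2 ha.1 c hc.2 hc.1 hac h1 h3
  · exact hz2 b hb.2 hb.1 c hc.2 hc.1 hbc h2 h3
  · exact hz1 b hb.2 hb.1 c hc.2 hc.1 hbc h2 h3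
  · exact hz2 a ha.2 ha.1 c hc.2 hc.1 hac h1 h3
  · exact hz2 a ha.2 ha.1 b hb.2 hb.1 hab h1 h2
  · exact hz2 a ha.2 ha.1 b hb.2 hb.1 hab h1 h2

/-- The neighbours of `v` outside a big clique that contains `v` form a big clique with `v`. -/
theorem exists_bigClique_inter {v : V} (hv : v ∈ K) : ∃ L, G.BigClique L ∧ v ∈ L ∧
    (∀ n, G.Adj v n → n ∈ K ∨ n ∈ L) ∧ ∀ n ∈ K, n ∈ L → n = v := by
  classical
  have := Fintype.ofFinite V
  obtain ⟨a, b, c, hab, hac, hbc, ha, hb, hc⟩ := h.exists_three_outer hK hv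
  let L : Finset V := {u | u = v ∨ u ∉ K ∧ G.Adj u v}
  have hL : ∀ u, u ∈ L ↔ u = v ∨ u ∉ K ∧ G.Adj u v := by simp [L]
  refine ⟨L, ⟨fun u hu w hw huw => ?_, fun u hu => ?_, ?_⟩, (hL v).2 (.inl rfl), fun n hn => ?_,
    fun n hn hnL => ((hL n).1 hnL).resolve_right fun h => h.1 hn⟩
  · rcases (hL u).1 hu with rfl | hu <;> rcases (hL w).1 hw with rfl | hw
    exacts [absurd rfl huw, hw.2.symm, hu.2, h.outer_adj_outer hK hv hu.1 hu.2 hw.1 hw.2 huw]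
  · rw [hL] at hu
    by_cases huK : u ∈ K
    · exact ⟨a, (hL a).2 (.inr ha), fun hua => hu (.inl
        (h.eq_of_adj_bigClique hK ha.1 huK hv hua.symm ha.2))⟩
    · exact ⟨v, (hL v).2 (.inl rfl), fun huv => hu (.inr ⟨huK, huv⟩)⟩
  · calc 4 = ({v, a, b, c} : Finset V).card := (Finset.card_eq_four.2
        ⟨v, a, b, c, ha.2.ne', hb.2.ne', hc.2.ne', hab, hac, hbc, rfl⟩).symm
      _ ≤ L.card := Finset.card_le_card fun u hu => by
        simp only [Finset.mem_insert, Finset.mem_singleton] at hu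
        rw [hL]
        rcases hu with rfl | rfl | rfl | rfl
        exacts [.inl rfl, .inr ha, .inr hb, .inr hc]
  · by_cases hnK : n ∈ K
    · exact .inl hnK
    · exact .inr ((hL n).2 (.inr ⟨hnK, hn.symm⟩))

theorem exists_bigClique_mem (v : V) : ∃ K, G.BigClique K ∧ v ∈ K := by
  have hcard := hK.four_le
  obtain ⟨x, hx⟩ := Finset.card_pos.1 (by omega : 0 < K.card)
  have := h.critical.eq_univ_of_closed (s := {v | ∃ K, G.BigClique K ∧ v ∈ K}) ⟨x, K, hK, hx⟩ ?_
  · exact Set.eq_univ_iff_forall.1 this v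
  · rintro u ⟨K, hK, hu⟩ w huw
    obtain ⟨L, hL, -, hn, -⟩ := h.exists_bigClique_inter hK hu
    rcases hn w huw with hw | hw
    exacts [⟨K, hK, hw⟩, ⟨L, hL, hw⟩]

/-- The neighbourhood of `v` is covered by two cliques. -/
theorem not_claw {v a b c : V} (ha : G.Adj v a) (hb : G.Adj v b) (hc : G.Adj v c) (hab : a ≠ b)
    (hac : a ≠ c) (hbc : b ≠ c) (nab : ¬G.Adj a b) (nac : ¬G.Adj a c) (nbc : ¬G.Adj b c) :
    False := by
  obtain ⟨K, hK, hv⟩ := h.exists_bigClique_mem hK v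
  obtain ⟨L, hL, -, hn, -⟩ := h.exists_bigClique_inter hK hv
  have h1 := hn a ha
  have h2 := hn b hb
  have h3 := hn c hc
  have k1 := hK.adj
  have k2 := hL.adj
  grind

end CriticalLarge

/-! ### Clique number at least four: Shannon's argument -/

/-- At least `k - |S|` of the `k` colours are missing on a set `S`, and the three sets of missing
colours are pairwise disjoint. -/
theorem card_add_le_of_disjoint_images [DecidableEq V] {K L M : Finset V} {f : V → ℕ} {k : ℕ}
    (hKL : ∀ c < k, (∀ u ∈ K, f u ≠ c) → (∀ u ∈ L, f u ≠ c) → False)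
    (hLM : ∀ c < k, (∀ u ∈ L, f u ≠ c) → (∀ u ∈ M, f u ≠ c) → False)
    (hKM : ∀ c < k, (∀ u ∈ K, f u ≠ c) → (∀ u ∈ M, f u ≠ c) → False) :
    2 * k ≤ K.card + L.card + M.card := by
  have hmem : ∀ (S : Finset V) c, c ∈ Finset.range k \ S.image f ↔ c < k ∧ ∀ u ∈ S, f u ≠ c := by
    simp
  have hcard : ∀ S : Finset V, k ≤ (Finset.range k \ S.image f).card + S.card := by
    intro S
    have h1 := Finset.le_card_sdiff (S.image f) (Finset.range k)
    have h2 := Finset.card_image_le (s := S) (f := f)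
    rw [Finset.card_range] at h1
    omega
  have hle : ((Finset.range k \ K.image f ∪ Finset.range k \ L.image f) ∪
      Finset.range k \ M.image f).card ≤ k := by
    conv_rhs => rw [← Finset.card_range k]
    refine Finset.card_le_card fun c hc => ?_
    rw [Finset.mem_union, Finset.mem_union, hmem, hmem, hmem] at hc
    rcases hc with (hc | hc) | hc <;> exact Finset.mem_range.2 hc.1
  have hdisj : ∀ S T : Finset V, (∀ c < k, (∀ u ∈ S, f u ≠ c) → (∀ u ∈ T, f u ≠ c) → False) →
      Disjoint (Finset.range k \ S.image f) (Finset.range k \ T.image f) := by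
    intro S T h
    rw [Finset.disjoint_left]
    intro c hS hT
    rw [hmem] at hS hT
    exact h c hS.1 hS.2 hT.2
  rw [Finset.card_union_of_disjoint
    (Finset.disjoint_union_left.2 ⟨hdisj _ _ hKM, hdisj _ _ hLM⟩),
    Finset.card_union_of_disjoint (hdisj _ _ hKL)] at hle
  have := hcard K
  have := hcard L
  have := hcard M
  omega

/-- Vertices behave like edges and big cliques like vertices of a graph of maximum degree at most
`m`. The uncoloured `v` joins `K` and `L`, and `w`, whose colour is missing on `K`, joins `L` and
`M`. The colours missing on `K \ v`, `L \ v` and `M` are pairwise disjoint. -/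
theorem CriticalLarge.not_bigClique [Finite V] {m k : ℕ} (h : G.CriticalLarge m k) {K : Finset V} :
    ¬G.BigClique K := by
  classical
  intro hK
  have hcr := h.critical
  have hle := h.le
  have hfour := h.four_le
  have hcard : ∀ K, G.BigClique K → K.card ≤ m := fun K hK =>
    h.card_le K fun a ha b hb hab => hK.adj a ha b hb hab
  obtain ⟨v, hvK⟩ := Finset.card_pos.1 (lt_of_lt_of_le (by norm_num) hK.four_le : 0 < K.card)
  obtain ⟨L, hL, hvL, hvn, hKL⟩ := h.exists_bigClique_inter hK hvK
  obtain ⟨f, hf⟩ := hcr.colors_compl v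
  have hLinj : ∀ u ∈ L, u ≠ v → ∀ t ∈ L, t ≠ v → f u = f t → u = t := by
    intro u hu huv t ht htv hut
    by_contra hne
    exact hf.2 u huv t htv (hL.adj u hu t ht hne) hut
  have hKinj : ∀ u ∈ K, u ≠ v → ∀ t ∈ K, t ≠ v → f u = f t → u = t := by
    intro u hu huv t ht htv hut
    by_contra hne
    exact hf.2 u huv t htv (hK.adj u hu t ht hne) hut
  obtain ⟨w, hwL, hwv, hwK⟩ : ∃ w ∈ L, w ≠ v ∧ ∀ u ∈ K, u ≠ v → f u ≠ f w := by
    have h1 : ((K.erase v).image f).card < (Finset.range k).card := by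
      have := Finset.card_image_le (s := K.erase v) (f := f)
      have := Finset.card_erase_add_one hvK
      have := hcard K hK
      rw [Finset.card_range]
      omega
    obtain ⟨c, hck, hc⟩ := Finset.exists_mem_notMem_of_card_lt_card h1
    have hc' : ∀ u ∈ K, u ≠ v → f u ≠ c := fun u hu huv huc =>
      hc (Finset.mem_image.2 ⟨u, Finset.mem_erase.2 ⟨huv, hu⟩, huc⟩)
    obtain ⟨w, hvw, rfl⟩ := hcr.exists_adj_color hf (Finset.mem_range.1 hck)
    exact ⟨w, (hvn w hvw).resolve_left fun hw => hc' w hw hvw.ne' rfl, hvw.ne', hc'⟩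
  obtain ⟨M, hM, hwM, hwn, hLM⟩ := h.exists_bigClique_inter hL hwL
  have hvw : G.Adj v w := hL.adj v hvL w hwL hwv.symm
  have hwuniq : ∀ n, G.Adj v n → f n = f w → n = w := by
    intro n hn hnw
    rcases hvn n hn with hnK | hnL
    · exact absurd hnw (hwK n hnK hn.ne')
    · exact hLinj n hnL hn.ne' w hwL hwv hnw
  have hvM : v ∉ M := fun hv => hwv (hLM v hvL hv).symm
  have hc1 : ∀ c < k, (∀ u ∈ K.erase v, f u ≠ c) → (∀ u ∈ L.erase v, f u ≠ c) → False := by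
    intro c hck hcK hcL
    obtain ⟨n, hn, hnc⟩ := hcr.exists_adj_color hf hck
    rcases hvn n hn with h | h
    · exact hcK n (Finset.mem_erase.2 ⟨hn.ne', h⟩) hnc
    · exact hcL n (Finset.mem_erase.2 ⟨hn.ne', h⟩) hnc
  have hc2 : ∀ c < k, (∀ u ∈ L.erase v, f u ≠ c) → (∀ u ∈ M, f u ≠ c) → False := by
    intro c hck hcL hcM
    obtain ⟨z, hwz, hzv, hzc⟩ := hcr.exists_adj_of_unique hf hvw hwuniq hck (hcM w hwM).symm
    rcases hwn z hwz with h | h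
    · exact hcL z (Finset.mem_erase.2 ⟨hzv, h⟩) hzc
    · exact hcM z h hzc
  -- Given `β` missing on `K` and `M`, and `γ` missing on `L`, the chain of these colours from `b`
  -- in `L` would end at `a` in `K` and, after the uncoloured vertex is moved from `v` to `w`, also
  -- at `c` in `M`.
  have hc3 : ∀ c < k, (∀ u ∈ K.erase v, f u ≠ c) → (∀ u ∈ M, f u ≠ c) → False := by
    intro β hβk hβK hβM
    obtain ⟨γ, hγk, hγL⟩ : ∃ γ < k, ∀ u ∈ L.erase v, f u ≠ γ := by
      have h1 : ((L.erase v).image f).card < (Finset.range k).card := by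
        have := Finset.card_image_le (s := L.erase v) (f := f)
        have := Finset.card_erase_add_one hvL
        have := hcard L hL
        rw [Finset.card_range]
        omega
      obtain ⟨c, hck, hc⟩ := Finset.exists_mem_notMem_of_card_lt_card h1
      exact ⟨c, Finset.mem_range.1 hck, fun u hu huc => hc (Finset.mem_image.2 ⟨u, hu, huc⟩)⟩
    have hβγ : β ≠ γ := by
      rintro rfl
      exact hc1 β hβk hβK hγL
    have hβw : f w ≠ β := hβM w hwM
    have hγw : f w ≠ γ := hγL w (Finset.mem_erase.2 ⟨hwv, hwL⟩)
    obtain ⟨b, hvb, hb⟩ := hcr.exists_adj_color hf hβk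
    obtain ⟨a, hva, ha⟩ := hcr.exists_adj_color hf hγk
    have hbL : b ∈ L := (hvn b hvb).resolve_left fun hbK =>
      hβK b (Finset.mem_erase.2 ⟨hvb.ne', hbK⟩) hb
    have haK : a ∈ K := (hvn a hva).resolve_right fun haL =>
      hγL a (Finset.mem_erase.2 ⟨hva.ne', haL⟩) ha
    have hbuniq : ∀ n, G.Adj v n → f n = β → n = b := by
      intro n hn hnb
      rcases hvn n hn with hnK | hnL
      · exact absurd hnb (hβK n (Finset.mem_erase.2 ⟨hn.ne', hnK⟩))
      · exact hLinj n hnL hn.ne' b hbL hvb.ne' (hnb.trans hb.symm)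
    have hauniq : ∀ n, G.Adj v n → f n = γ → n = a := by
      intro n hn hna
      rcases hvn n hn with hnK | hnL
      · exact hKinj n hnK hn.ne' a haK hva.ne' (hna.trans ha.symm)
      · exact absurd hna (hγL n (Finset.mem_erase.2 ⟨hn.ne', hnL⟩))
    have hbw : b ≠ w := by rintro rfl; exact hβw hb
    have hg := hf.move hvw hwuniq
    have hgv : Function.update f v (f w) v = f w := Function.update_self ..
    have hgn : ∀ n, n ≠ v → Function.update f v (f w) n = f n := fun n hn =>
      Function.update_of_ne hn ..
    generalize Function.update f v (f w) = g at hg hgv hgn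
    have hgβ : ∀ n, g n = β → n ≠ v ∧ f n = β := by
      intro n hn
      have hnv : n ≠ v := by rintro rfl; exact hβw (hgv.symm.trans hn)
      exact ⟨hnv, (hgn n hnv).symm.trans hn⟩
    have hgγ : ∀ n, g n = γ → n ≠ v ∧ f n = γ := by
      intro n hn
      have hnv : n ≠ v := by rintro rfl; exact hγw (hgv.symm.trans hn)
      exact ⟨hnv, (hgn n hnv).symm.trans hn⟩
    obtain ⟨c, hwc, hgc⟩ := hcr.exists_adj_color hg hγk
    obtain ⟨hcv, hc⟩ := hgγ c hgc
    have hcM : c ∈ M := (hwn c hwc).resolve_left fun hcL =>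
      hγL c (Finset.mem_erase.2 ⟨hcv, hcL⟩) hc
    have hbuniq' : ∀ n, G.Adj w n → f n = β → n ≠ v → n = b := by
      intro n hn hnb hnv
      rcases hwn n hn with hnL | hnM
      · exact hLinj n hnL hnv b hbL hvb.ne' (hnb.trans hb.symm)
      · exact absurd hnb (hβM n hnM)
    have hcuniq : ∀ n, G.Adj w n → g n = γ → n = c := by
      intro n hn hgn'
      obtain ⟨hnv, hnc⟩ := hgγ n hgn'
      rcases hwn n hn with hnL | hnM
      · exact absurd hnc (hγL n (Finset.mem_erase.2 ⟨hnv, hnL⟩))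
      · by_contra hne
        exact hf.2 n hnv c hcv (hM.adj n hnM c hcM hne) (hnc.trans hc.symm)
    have hgb : g b = β := (hgn b hvb.ne').trans hb
    have hr1 := hcr.kempe_reachable hf hvb hva (fun n hn h => hbuniq n hn (h.trans hb))
      (fun n hn h => hauniq n hn (h.trans ha)) (by rwa [hb, ha])
    have hr2 := hcr.kempe_reachable hg (hL.adj w hwL b hbL hbw.symm) hwc
      (fun n hn h => hbuniq' n hn (hgβ n (h.trans hgb)).2 (hgβ n (h.trans hgb)).1)
      (fun n hn h => hcuniq n hn (h.trans hgc)) (by rwa [hgb, hgc])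
    rw [hb, ha] at hr1
    rw [hgb, hgc] at hr2
    -- The colourings differ only at `v` and `w`, and the colour moved between them is neither `β`
    -- nor `γ`.
    have hsub : G.kempe {w}ᶜ g β γ ≤ G.kempe {v}ᶜ f β γ := by
      rintro s t ⟨hst, -, -, hcol⟩
      rcases hcol with ⟨h1, h2⟩ | ⟨h1, h2⟩
      · exact ⟨hst, (hgβ s h1).1, (hgγ t h2).1, .inl ⟨(hgβ s h1).2, (hgγ t h2).2⟩⟩
      · exact ⟨hst, (hgγ s h1).1, (hgβ t h2).1, .inr ⟨(hgγ s h1).2, (hgβ t h2).2⟩⟩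
    have nab : ¬G.Adj a b := by
      intro hab
      have hbK : b ∉ K := fun hbK => hvb.ne' (hKL b hbK hbL)
      exact hva.ne' (h.eq_of_adj_bigClique hK hbK haK hvK hab.symm hvb.symm)
    have hcL : c ∉ L := fun hcL => hwc.ne' (hLM c hcL hcM)
    have nbc : ¬G.Adj b c := fun hbc =>
      hbw (h.eq_of_adj_bigClique hL hcL hbL hwL hbc.symm hwc.symm)
    have hac : a ≠ c := by
      rintro rfl
      exact hwv (h.eq_of_adj_bigClique hL hcL hwL hvL hwc.symm hva.symm)
    have hcol : ∀ s t u, (G.kempe {v}ᶜ f β γ).Adj s t → (G.kempe {v}ᶜ f β γ).Adj s u →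
        ¬G.Adj t u := by
      rintro s t u ⟨-, -, ht, h1⟩ ⟨-, -, hu, h2⟩ htu
      refine hf.2 t ht u hu htu ?_
      rcases h1 with h1 | h1 <;> rcases h2 with h2 | h2
      exacts [h1.2.trans h2.2.symm, absurd (h1.1.symm.trans h2.1) hβγ,
        absurd (h2.1.symm.trans h1.1) hβγ, h1.2.trans h2.2.symm]
    have hend : ∀ s r, G.Adj r s →
        (∀ t, (G.kempe {v}ᶜ f β γ).Adj s t → r ≠ t ∧ ¬G.Adj r t) → ∀ t u,
        (G.kempe {v}ᶜ f β γ).Adj s t → (G.kempe {v}ᶜ f β γ).Adj s u → t = u := by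
      intro s r hrs hr t u ht hu
      by_contra hne
      exact h.not_claw hK hrs.symm ht.1 hu.1 (hr t ht).1 (hr u hu).1 hne (hr t ht).2 (hr u hu).2
        (hcol s t u ht hu)
    refine not_three_ends (H := G.kempe {v}ᶜ f β γ) (a := b) (b := a) (c := c) ?_
      (by rintro rfl; exact hβγ (hb.symm.trans ha)) (by rintro rfl; exact hβγ (hb.symm.trans hc))
      hac hr1 (hr2.mono hsub) (hend b v hvb ?_) (hend a v hva ?_) (hend c w hwc ?_)
    · intro s t u y ht hu hy
      by_contra! hne
      exact h.not_claw hK ht.1 hu.1 hy.1 hne.1 hne.2.1 hne.2.2 (hcol s t u ht hu)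
        (hcol s t y ht hy) (hcol s u y hu hy)
    · rintro t ⟨hbt, -, htv, hc⟩
      refine ⟨Ne.symm htv, fun hvt => ?_⟩
      rcases hc with hc | hc
      · exact nab (hauniq t hvt hc.2 ▸ hbt.symm)
      · exact hβγ (hb.symm.trans hc.1)
    · rintro t ⟨hat, -, htv, hc⟩
      refine ⟨Ne.symm htv, fun hvt => ?_⟩
      rcases hc with hc | hc
      · exact hβγ (hc.1.symm.trans ha)
      · exact nab (hbuniq t hvt hc.2 ▸ hat)
    · rintro t ⟨hct, -, htv, h1⟩
      rcases h1 with h1 | h1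
      · exact absurd (h1.1.symm.trans hc) hβγ
      · exact ⟨fun hwt => hβw (hwt ▸ h1.2), fun hwt => nbc (hbuniq' t hwt h1.2 htv ▸ hct.symm)⟩
  -- This gives `2k ≤ (m - 1) + (m - 1) + m`, against `3m ≤ 2k + 1`.
  have hle' := card_add_le_of_disjoint_images hc1 hc2 hc3
  have := hcard K hK
  have := hcard L hL
  have := hcard M hM
  have := Finset.card_erase_add_one hvK
  have := Finset.card_erase_add_one hvL
  omega

theorem Critical.false_of_isNClique [Finite V] {m : ℕ} (hch : G.ChairFree) (hhv : G.HVNFree)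
    (hm : 4 ≤ m) (hfree : G.CliqueFree (m + 1)) {s : Finset V} (hs : G.IsNClique m s)
    (h : G.Critical (3 * m / 2)) : False := by
  classical
  refine CriticalLarge.not_bigClique (m := m) (K := s) ⟨h, hch, hhv, hm, by omega, fun t ht => ?_⟩
    ⟨fun a ha b hb hab => hs.isClique ha hb hab, fun u hu => ?_, hs.card_eq ▸ hm⟩
  · by_contra! hlt
    exact hfree.mono (Nat.succ_le_of_lt hlt) t ⟨ht, rfl⟩
  · by_contra! hall
    exact hfree _ (hs.insert hall)

/-! ### Induced subgraphs and the induction -/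

theorem chairFree_of_not_isIndContained {V : Type*} {G : SimpleGraph V}
    (h : ¬IsIndContained chairGraph G) : G.ChairFree := by
  intro c a b x p hca hcb hcx hxp hab nab nax nbx ncp nap nbp
  have hinj : Function.Injective ![c, a, b, x, p] := by
    have := hca.ne; have := hcb.ne; have := hcx.ne; have := hxp.ne
    have : a ≠ x := by rintro rfl; exact nap hxp
    have : b ≠ x := by rintro rfl; exact nbp hxp
    have : c ≠ p := by rintro rfl; exact nap hca.symm
    have : a ≠ p := by rintro rfl; exact nax hxp.symm
    have : b ≠ p := by rintro rfl; exact nbx hxp.symm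
    intro i j hij
    fin_cases i <;> fin_cases j <;> simp_all
  have hadj : ∀ i j, G.Adj (![c, a, b, x, p] i) (![c, a, b, x, p] j) ↔ chairGraph.Adj i j := by
    intro i j
    fin_cases i <;> fin_cases j <;> simp [chairGraph, hca, hca.symm, hcb, hcb.symm, hcx, hcx.symm,
      hxp, hxp.symm, nab, nax, nbx, ncp, nap, nbp, mt Adj.symm nab, mt Adj.symm nax,
      mt Adj.symm nbx, mt Adj.symm ncp, mt Adj.symm nap, mt Adj.symm nbp]
  exact h ⟨⟨⟨_, hinj⟩, hadj _ _⟩⟩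

theorem hvnFree_of_not_isIndContained {V : Type*} {G : SimpleGraph V}
    (h : ¬IsIndContained hvnGraph G) : G.HVNFree := by
  intro a b c d e hab hac had hbc hbd hcd hea heb nec ned
  have hinj : Function.Injective ![a, b, c, d, e] := by
    have := hab.ne; have := hac.ne; have := had.ne; have := hbc.ne; have := hbd.ne
    have := hcd.ne; have := hea.ne'; have := heb.ne'
    have : c ≠ e := by rintro rfl; exact ned hcd
    have : d ≠ e := by rintro rfl; exact nec hcd.symm
    intro i j hij
    fin_cases i <;> fin_cases j <;> simp_all
  have hadj : ∀ i j, G.Adj (![a, b, c, d, e] i) (![a, b, c, d, e] j) ↔ hvnGraph.Adj i j := by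
    intro i j
    fin_cases i <;> fin_cases j <;> simp [hvnGraph, hab, hab.symm, hac, hac.symm, had, had.symm,
      hbc, hbc.symm, hbd, hbd.symm, hcd, hcd.symm, hea, hea.symm, heb, heb.symm, nec, ned,
      mt Adj.symm nec, mt Adj.symm ned]
  exact h ⟨⟨⟨_, hinj⟩, hadj _ _⟩⟩

universe u in
-- The outer induction on the order makes a counterexample vertex-critical. It also colours proper
-- subgraphs of smaller clique number with fewer colours, which clique number three needs. The inner
-- induction on `m` makes the clique bound attained.
theorem exists_colorsOn_univ (n : ℕ) : ∀ {V : Type u} [Finite V] {G : SimpleGraph V},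
    Nat.card V = n → G.ChairFree → G.HVNFree → ∀ m, G.CliqueFree (m + 1) →
      ∃ f, G.ColorsOn Set.univ (3 * m / 2) f := by
  induction n using Nat.strong_induction_on with
  | _ n ih =>
  intro V _ G hn hch hhv m
  have hmin : ∀ s : Set V, s ≠ Set.univ → ∀ m, G.CliqueFreeOn s (m + 1) →
      ∃ f, G.ColorsOn s (3 * m / 2) f := by
    intro s hs m hm
    have hlt : Nat.card s < n := by
      rw [← hn, Nat.card_coe_set_eq]
      exact Set.ncard_lt_card hs
    obtain ⟨f, hf⟩ := ih _ hlt (G := G.induce s) rfl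
      (fun c a b x p h1 h2 h3 h4 h5 => hch c a b x p h1 h2 h3 h4 (fun h => h5 (Subtype.ext h)))
      (fun a b c d e => hhv a b c d e) m ((G.cliqueFree_induce_iff s _).2 hm)
    classical
    refine ⟨fun u => if hu : u ∈ s then f ⟨u, hu⟩ else 0, fun u hu => ?_, fun u hu w hw huw => ?_⟩
    · simpa [hu] using hf.1 ⟨u, hu⟩ trivial
    · simpa [hu, hw] using hf.2 ⟨u, hu⟩ trivial ⟨w, hw⟩ trivial huw
  induction m with
  | zero =>
    intro h0
    have hV : IsEmpty V := by simpa using h0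
    exact ⟨fun _ => 0, fun u => hV.elim u, fun u => hV.elim u⟩
  | succ m ihm =>
    intro hfree
    by_cases hfree' : G.CliqueFree (m + 1)
    · obtain ⟨f, hf⟩ := ihm hfree'
      exact ⟨f, hf.mono le_rfl (by omega)⟩
    by_contra! hnot
    have hcrit : G.Critical (3 * (m + 1) / 2) :=
      ⟨hnot, fun v => hmin _ (by simp) (m + 1) hfree.cliqueFreeOn⟩
    -- The clique number is `m + 1`, so the cases are one, two, three and at least four.
    rcases m with _ | _ | _ | m
    · refine hnot (fun _ => 0) ⟨fun _ _ => by norm_num, fun u _ w _ huw => ?_⟩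
      have := cliqueFree_two.1 hfree
      subst this
      exact huw.elim
    · exact hcrit.false_of_cliqueFree_three hch hfree
    · exact hcrit.false_of_cliqueFree_four hch hfree fun s hs hs3 => hmin s hs 2 hs3
    · unfold CliqueFree at hfree'
      push Not at hfree'
      obtain ⟨s, hs⟩ := hfree'
      exact hcrit.false_of_isNClique hch hhv (by omega) hfree hs

end SimpleGraph

theorem theorem2 {V : Type*} [Finite V] (G : SimpleGraph V)
    (hChair : ¬ SimpleGraph.IsIndContained chairGraph G)
    (hHVN : ¬ SimpleGraph.IsIndContained hvnGraph G) :
    2 * G.chromaticNumber ≤ 3 * (G.cliqueNum : ℕ∞) := by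
  have := Fintype.ofFinite V
  have hfree : G.CliqueFree (G.cliqueNum + 1) := fun s hs => by
    have := hs.isClique.card_le_cliqueNum
    have := hs.card_eq
    omega
  obtain ⟨f, hf⟩ := SimpleGraph.exists_colorsOn_univ _ rfl
    (SimpleGraph.chairFree_of_not_isIndContained hChair)
    (SimpleGraph.hvnFree_of_not_isIndContained hHVN) _ hfree
  have hcol : G.Colorable (3 * G.cliqueNum / 2) :=
    ⟨SimpleGraph.Coloring.mk (fun v => (⟨f v, hf.1 v trivial⟩ : Fin _)) fun {u w} huw heq =>
      hf.2 u trivial w trivial huw (congrArg Fin.val heq)⟩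
  have hle := hcol.chromaticNumber_le
  calc 2 * G.chromaticNumber ≤ 2 * ((3 * G.cliqueNum / 2 : ℕ) : ℕ∞) := by gcongr
    _ ≤ 3 * (G.cliqueNum : ℕ∞) := by exact_mod_cast Nat.mul_div_le _ _
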